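/- All Turing machines are deterministic, with a read-only input tape, one working tape and a write-only one-way output tape. The input is delimited by end markers. The working tape is infinite in both directions and initially blank, the blank being one of the symbols of the finite working alphabet; the space used is the number of working cells visited. An \emph{offline} machine may move its input head in both directions; an \emph{online} machine never moves it to the left. An online machine \emph{with shifted input} gets an input of length $n$ preceded by $n$ empty cells. For $g,h:\mathbb N\to\mathbb N$, $\mathrm{1DSPACE}'(g,h)$ is the class of functions computable by an online machine with shifted input, over some finite working alphabet, using $O(g(n))$ working cells and $O(h(n))$ output cells on inputs of length $n$. Let $A,B$ be finite alphabets. For $F:A^*\to B^*$ let $\log F$ denote the function $n\mapsto\max(1,\max_{|x|=n}|F(x)|)$, the length of the longest output on inputs of length $n$. \textbf{Theorem.} Let $f:\mathbb N\to\mathbb N$ satisfy $f(n)=\Omega(\log\log n)$, and let $F:A^*\to B^*$ be computed by an offline Turing machine with a binary (two-symbol) working alphabet using at most $f(n)$ working cells on inputs of length $n$. Suppose that the function $1^n\mapsto f(n)$ (value in binary) is computable by an offline Turing machine in space $O(f\cdot 2^f\cdot\log F)$, and that so is $1^n\mapsto\ell(n)$ for some $\ell:\mathbb N\to\mathbb N$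 with $|F(x)|\le\ell(|x|)$ for all $x$ and $\ell=O(f\cdot\log F)$. (For example $\ell=\log F$, if that is computable in this space; if $\log F=O(f)$, then $\ell=C\cdot f$ for a suitable constant $C$ works up to finitely many values, and there is no additional assumption.) Then $$F\in\mathrm{1DSPACE}'\bigl(f\cdot2^f\cdot\log F,\ \log F\bigr).$$ -/

import Mathlib

open Filter Asymptotics

namespace SpaceTM

/-- Contents of a cell of the read-only input tape: one of the two end markers, the empty symbol
(used for shifting the input), or a letter of the input alphabet. -/
inductive InputSym (A : Type) : Type
  | leftEnd
  | rightEnd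
  | empty
  | letter (a : A)

/-- Head moves. -/
inductive Move : Type
  | left
  | stay
  | right

/-- What a machine does in one step: new state, symbol written on the working tape, moves of the
two heads, and possibly one symbol appended to the write-only output tape. -/
structure Action (Q Γ B : Type) : Type where
  next : Q
  write : Γ
  inputMove : Move
  workMove : Move
  output : Option B

/-- A deterministic Turing machine with a read-only input tape over `A`, one read-write working
tape over `Γ` (the blank is one of the symbols of `Γ`), and a write-only output tape over `B`.
The value `none` of the transition function means that the machine halts. -/
structure Machine (A Γ B : Type) : Type 1 where
  State : Type
  finite_state : Finite State
  start : State
  blank : Γ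
  step : State → InputSym A → Γ → Option (Action State Γ B)

/-- The input tape that holds `x`, shifted to the right by `k` empty cells. -/
def inputTape {A : Type} (k : ℕ) (x : List A) : List (InputSym A) :=
  InputSym.leftEnd :: (List.replicate k InputSym.empty ++ x.map InputSym.letter ++
    [InputSym.rightEnd])

/-- The input head never leaves the part of the tape between the two markers. -/
def moveInput (len i : ℕ) : Move → ℕ
  | Move.left => i - 1
  | Move.stay => i
  | Move.right => min (i + 1) (len - 1)

/-- The working tape is infinite in both directions, without end markers. -/
def moveWork (p : ℤ) : Move → ℤ
  | Move.left => p - 1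
  | Move.stay => p
  | Move.right => p + 1

namespace Machine

variable {A Γ B : Type}

/-- A full configuration of a machine. -/
structure Config (M : Machine A Γ B) : Type where
  state : M.State
  inputPos : ℕ
  work : ℤ → Γ
  workPos : ℤ
  out : List B

/-- Initial configuration: the input head is on the left marker, the working tape is blank and the
output tape is empty. -/
def init (M : Machine A Γ B) : M.Config where
  state := M.start
  inputPos := 0
  work := fun _ => M.blank
  workPos := 0
  out := []

/-- The action that `M` performs in configuration `c` on the given input tape, if any. -/
def action (M : Machine A Γ B) (tape : List (InputSym A)) (c : M.Config) :
    Option (Action M.State Γ B) :=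
  M.step c.state (tape.getD c.inputPos InputSym.rightEnd) (c.work c.workPos)

/-- The configuration after performing the action `a`. -/
def perform (M : Machine A Γ B) (tape : List (InputSym A)) (c : M.Config)
    (a : Action M.State Γ B) : M.Config where
  state := a.next
  inputPos := moveInput tape.length c.inputPos a.inputMove
  work := Function.update c.work c.workPos a.write
  workPos := moveWork c.workPos a.workMove
  out := c.out ++ a.output.toList

/-- The configuration after `t` steps (halted configurations are repeated forever). -/
def run (M : Machine A Γ B) (tape : List (InputSym A)) : ℕ → M.Config
  | 0 => M.init
  | t + 1 =>
    match M.action tape (M.run tape t) with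
    | none => M.run tape t
    | some a => M.perform tape (M.run tape t) a

/-- The cells of the working tape that the head visits during the first `t` steps. -/
def visited (M : Machine A Γ B) (tape : List (InputSym A)) (t : ℕ) : Finset ℤ :=
  (Finset.range (t + 1)).image fun i => (M.run tape i).workPos

/-- On the given input tape, `M` halts with output `y` and uses at most `s` cells of its working
tape. -/
def HaltsWith (M : Machine A Γ B) (tape : List (InputSym A)) (y : List B) (s : ℕ) : Prop :=
  ∃ t, M.action tape (M.run tape t) = none ∧ (M.run tape t).out = y ∧
    (M.visited tape t).card ≤ s

/-- `M`, as an offline machine, computes `F` using at most `s n` cells of its working tape on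
every input of length `n`. -/
def ComputesOffline (M : Machine A Γ B) (F : List A → List B) (s : ℕ → ℕ) : Prop :=
  ∀ x, M.HaltsWith (inputTape 0 x) (F x) (s x.length)

/-- `M`, with shifted input (an input of length `n` is preceded by `n` empty cells), computes `F`
using at most `s n` cells of its working tape on every input of length `n`. -/
def ComputesShifted (M : Machine A Γ B) (F : List A → List B) (s : ℕ → ℕ) : Prop :=
  ∀ x, M.HaltsWith (inputTape x.length x) (F x) (s x.length)

/-- A machine is online if its input head never moves to the left. -/
def IsOnline (M : Machine A Γ B) : Prop :=
  ∀ q i g a, M.step q i g = some a → a.inputMove ≠ Move.left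

end Machine

/-- Functions computable by an offline machine, over some finite working alphabet, using `O(g)`
cells of the working tape. -/
def OfflineSpace {A B : Type} (g : ℕ → ℕ) : Set (List A → List B) :=
  {F | ∃ (Γ : Type) (_ : Finite Γ) (M : Machine A Γ B) (s : ℕ → ℕ),
    (fun n => (s n : ℝ)) =O[atTop] (fun n => (g n : ℝ)) ∧ M.ComputesOffline F s}

/-- The class `1DSPACE'(g, h)`: functions computable by an online machine with shifted input, over
some finite working alphabet, using `O(g)` cells of the working tape and `O(h)` cells of the output
tape. -/
def OneDSpacePrime {A B : Type} (g h : ℕ → ℕ) : Set (List A → List B) :=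
  {F | ∃ (Γ : Type) (_ : Finite Γ) (M : Machine A Γ B) (s o : ℕ → ℕ),
    (fun n => (s n : ℝ)) =O[atTop] (fun n => (g n : ℝ)) ∧
    (fun n => (o n : ℝ)) =O[atTop] (fun n => (h n : ℝ)) ∧
    M.IsOnline ∧ M.ComputesShifted F s ∧ ∀ x, (F x).length ≤ o x.length}

/-- The function `1^n ↦ u(n)`, with the value written in binary (least significant bit first). -/
def unaryFun (u : ℕ → ℕ) : List Unit → List Bool :=
  fun w => Nat.bits (u w.length)

/-- The quantity `log F`: the length of the longest output of `F` on inputs of length `n`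
(and at least `1`). -/
def logSize {A B : Type} [Fintype A] (F : List A → List B) (n : ℕ) : ℕ :=
  max 1 (Finset.univ.sup fun v : Fin n → A => (F (List.ofFn v)).length)

end SpaceTM

set_option linter.unusedSectionVars false

/-! What lies to the left of the current input cell matters to the offline machine `M` only through
a crossing table: for every configuration in which `M` may enter the left part, the configuration in
which it first comes back, or in which it halts, together with the output produced meanwhile. The
table for the next cell is determined by the table for the present cell and the symbol on it
(`lookSpec_succ`, `exists_iterate_correct`), so a head that only moves to the right suffices.
Besides the table, the simulation carries the configuration and the accumulated output of `M` at an
arrival at the present cell. The output is written only after `M` has been found to halt.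

Space: a run of `M` stays in a window of `f` cells, which is closed up to a ring. A configuration is
then a state and a binary word read from the head; no separate head position is needed, so there are
only `K * 2 ^ f` configurations, where `K` is the number of states (`cycStep_cycCode`). Storing the
head position as well would cost a further factor `f`. A table entry takes `O(f + ℓ)` bits, and `ℓ =
O(f · log F)`, so a table takes `O(f · 2 ^ f · log F)` bits.

Parameters: the `n` empty cells reveal `n` before the input begins. The numbers `f n` and `ℓ n` are
obtained by simulating the two given offline machines on `1 ^ n`, with a counter as input head. The
space that this needs is unknown, so bounds `Y = 0, 1, 2, …` are tried until everything fits.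
Success certifies that the parameters are exact (`params_of_fail`), and it occurs early enough
(`paramsFail_eq_zero`).

Counting to `n` costs `log n` cells, while `f` may be as small as `log log n`. A pumping argument
repairs this. If the machine for `f` has, up to the position of its input head, fewer than `n`
configurations on `1 ^ n`, then every traversal of the input repeats a configuration, and `n!`
further cells do not change the result (`eq_of_few_cores`). So `f (n + n!) = f n`, and the growth
hypothesis at `n + n!` gives `f n = Ω(log n)`. Otherwise `n` is at most the number of
configurations. In both cases `log n` is bounded by a multiple of the space used plus `f n + 1`
(`exists_size_le`).

Realization: the simulation is a sequence of arithmetical operations on Cantor codes. These are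
carried out by counter programs with polynomially bounded counters, and a Turing machine keeps the
counters in binary on parallel tracks. Its space is therefore linear in the length of the codes
(`exists_machine_of_step`). -/

namespace SpaceTM

/-! ### Segments of runs inside a fixed window of the working tape -/

namespace Machine

variable {A Γ B : Type}

/-- One step of `M` that starts and ends with the working head in `[0, W]`. -/
def StepIn (M : Machine A Γ B) (tape : List (InputSym A)) (W : ℕ) (c c' : M.Config) : Prop :=
  ∃ a, M.action tape c = some a ∧ c' = M.perform tape c a ∧
    (0 ≤ c.workPos ∧ c.workPos ≤ W) ∧ (0 ≤ c'.workPos ∧ c'.workPos ≤ W)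

theorem exists_run_of_reflTransGen (M : Machine A Γ B) (tape : List (InputSym A)) (W : ℕ)
    {c : M.Config} (h : Relation.ReflTransGen (M.StepIn tape W) M.init c) :
    ∃ t, M.run tape t = c ∧ M.visited tape t ⊆ Finset.Icc 0 (W : ℤ) := by
  induction h with
  | refl => exact ⟨0, rfl, by simp [visited, run, init]⟩
  | @tail b c _ hs ih =>
    obtain ⟨t, rfl, hv⟩ := ih
    obtain ⟨a, ha, rfl, h1, h2⟩ := hs
    refine ⟨t + 1, by simp [run, ha], ?_⟩
    intro z hz
    simp only [visited, Finset.mem_image, Finset.mem_range] at hz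
    obtain ⟨i, hi, rfl⟩ := hz
    rcases Nat.lt_succ_iff_lt_or_eq.mp hi with hi | rfl
    · exact hv (Finset.mem_image.mpr ⟨i, by simpa using hi, rfl⟩)
    · simpa [run, ha] using h2

theorem haltsWith_of_reflTransGen (M : Machine A Γ B) (tape : List (InputSym A)) (W : ℕ)
    {c : M.Config} (h : Relation.ReflTransGen (M.StepIn tape W) M.init c)
    (hc : M.action tape c = none) : M.HaltsWith tape c.out (W + 1) := by
  obtain ⟨t, rfl, hv⟩ := M.exists_run_of_reflTransGen tape W h
  exact ⟨t, hc, rfl, (Finset.card_le_card hv).trans (by simp)⟩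

end Machine

/-! ### Flowcharts over counters, and their realization on a working tape -/

/-- The symbol of the input tape in a cell. -/
def symAt {A : Type} (tape : List (InputSym A)) (i : ℕ) : InputSym A :=
  tape.getD i InputSym.rightEnd

/-- Instructions of a flowchart with labels in `L` over counters in `ρ`. -/
inductive Instr (A B ρ L : Type) : Type
  | incIf (p : InputSym A → Bool) (r : ρ) (next : L)
  | decz (r : ρ) (zero pos : L)
  | advance (next : L)
  | emit (b : B) (next : L)

/-- Values of the counters, position of the input head, and output. -/
@[ext]
structure CState (B ρ : Type) : Type where
  reg : ρ → ℕ
  pos : ℕ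
  out : List B

section Flow

variable {A B ρ L : Type} [DecidableEq ρ]

/-- One step of a flowchart, with counters at most `V`. -/
inductive FlowStep (G : L → Option (Instr A B ρ L)) (tape : List (InputSym A)) (V : ℕ) :
    L × CState B ρ → L × CState B ρ → Prop
  | incT {l l' p r s} : G l = some (.incIf p r l') → p (symAt tape s.pos) = true →
      s.reg r + 1 ≤ V →
      FlowStep G tape V (l, s) (l', { s with reg := Function.update s.reg r (s.reg r + 1) })
  | incF {l l' p r s} : G l = some (.incIf p r l') → p (symAt tape s.pos) = false →
      FlowStep G tape V (l, s) (l', s)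
  | decZ {l z n r s} : G l = some (.decz r z n) → s.reg r = 0 → FlowStep G tape V (l, s) (z, s)
  | decP {l z n r s k} : G l = some (.decz r z n) → s.reg r = k + 1 →
      FlowStep G tape V (l, s) (n, { s with reg := Function.update s.reg r k })
  | adv {l l' s} : G l = some (.advance l') →
      FlowStep G tape V (l, s) (l', { s with pos := moveInput tape.length s.pos .right })
  | emit {l l' b s} : G l = some (.emit b l') →
      FlowStep G tape V (l, s) (l', { s with out := s.out ++ [b] })

/-- Phases in the execution of one instruction on the working tape. -/
inductive Phase : Type
  | main
  | go
  | back
  | restore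

instance : Finite Phase :=
  Finite.of_injective (β := Fin 4)
    (fun p => match p with | .main => 0 | .go => 1 | .back => 2 | .restore => 3)
    (by intro a b; cases a <;> cases b <;> simp)

/-- The transition function of the machine that executes a flowchart. Cell `0` stays blank, the
cells `1, …, w` hold the binary digits of the counters. -/
def flowTrans (G : L → Option (Instr A B ρ L)) (q : L × Phase) (s : InputSym A)
    (g : Option (ρ → Bool)) : Option (Action (L × Phase) (Option (ρ → Bool)) B) :=
  match G q.1 with
  | none => none
  | some (.incIf p r l') =>
    match q.2, g with
    | .main, g =>
      if p s then some ⟨(q.1, .go), g, .stay, .right, none⟩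
      else some ⟨(l', .main), g, .stay, .stay, none⟩
    | .go, some v =>
      if v r then some ⟨(q.1, .go), some (Function.update v r false), .stay, .right, none⟩
      else some ⟨(q.1, .back), some (Function.update v r true), .stay, .left, none⟩
    | .go, none =>
      some ⟨(q.1, .back), some (Function.update (fun _ => false) r true), .stay, .left, none⟩
    | _, some v => some ⟨(q.1, .back), some v, .stay, .left, none⟩
    | _, none => some ⟨(l', .main), none, .stay, .stay, none⟩
  | some (.decz r z n) =>
    match q.2, g with
    | .main, g => some ⟨(q.1, .go), g, .stay, .right, none⟩
    | .go, some v =>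
      if v r then some ⟨(q.1, .back), some (Function.update v r false), .stay, .left, none⟩
      else some ⟨(q.1, .go), some (Function.update v r true), .stay, .right, none⟩
    | .go, none => some ⟨(q.1, .restore), none, .stay, .left, none⟩
    | .back, some v => some ⟨(q.1, .back), some v, .stay, .left, none⟩
    | .back, none => some ⟨(n, .main), none, .stay, .stay, none⟩
    | .restore, some v =>
      some ⟨(q.1, .restore), some (Function.update v r false), .stay, .left, none⟩
    | .restore, none => some ⟨(z, .main), none, .stay, .stay, none⟩
  | some (.advance l') => some ⟨(l', .main), g, .right, .stay, none⟩
  | some (.emit b l') => some ⟨(l', .main), g, .stay, .stay, some b⟩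

/-- The machine that executes a flowchart. -/
def flowMachine [Finite L] (G : L → Option (Instr A B ρ L)) (l₀ : L) :
    Machine A (Option (ρ → Bool)) B where
  State := L × Phase
  finite_state := inferInstance
  start := (l₀, .main)
  blank := none
  step := flowTrans G

theorem flowTrans_inputMove {G : L → Option (Instr A B ρ L)} {q : L × Phase} {s : InputSym A}
    {g : Option (ρ → Bool)} {a : Action (L × Phase) (Option (ρ → Bool)) B}
    (h : flowTrans G q s g = some a) : a.inputMove ≠ Move.left := by
  revert h
  unfold flowTrans
  (repeat' split) <;> intro h <;> simp only [Option.some.injEq, reduceCtorEq] at h <;>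
    subst h <;> simp

theorem flowMachine_isOnline [Finite L] (G : L → Option (Instr A B ρ L)) (l₀ : L) :
    (flowMachine G l₀).IsOnline :=
  fun _ _ _ _ h => flowTrans_inputMove h

/-- The contents of the working tape when the counters are `reg` and `w` cells are in use. -/
def cells (reg : ρ → ℕ) (w : ℕ) : ℤ → Option (ρ → Bool) := fun z =>
  if 1 ≤ z ∧ z ≤ w then some fun i => (reg i).testBit (z - 1).toNat else none

theorem cells_succ (reg : ρ → ℕ) {w j : ℕ} (h : j < w) :
    cells reg w (j + 1) = some fun i => (reg i).testBit j := by
  simp [cells]; omega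

/-- One digit of one counter is one track of one cell, so rewriting that track gives again a tape
that represents counters. -/
theorem update_cells (reg : ρ → ℕ) {w j y : ℕ} {r : ρ} {b : Bool} (h : j < w)
    (hy : ∀ i, y.testBit i = if i = j then b else (reg r).testBit i) :
    Function.update (cells reg w) (j + 1)
      (some (Function.update (fun i => (reg i).testBit j) r b)) =
    cells (Function.update reg r y) w := by
  funext z
  by_cases hz : z = j + 1
  · subst hz
    rw [Function.update_self, cells_succ _ h]
    congr 1
    funext i
    by_cases hi : i = r
    · subst hi; simp [hy]
    · simp [hi]
  · rw [Function.update_of_ne hz]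
    unfold cells
    split_ifs with h1
    · congr 1
      funext i
      by_cases hi : i = r
      · subst hi
        simp only [Function.update_self, hy]
        rw [if_neg (by omega)]
      · simp [hi]
    · rfl

variable [Finite L] (G : L → Option (Instr A B ρ L)) (l₀ : L) (tape : List (InputSym A)) (W : ℕ)

/-- The configuration of the machine of a flowchart. -/
def flowConfig (l : L) (ph : Phase) (z : ℤ) (w : ℕ) (s : CState B ρ) :
    (flowMachine G l₀).Config :=
  { state := (l, ph), inputPos := s.pos, work := cells s.reg w, workPos := z, out := s.out }

/-- A step of the machine of a flowchart that moves only the working head. -/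
theorem flowStepIn {G : L → Option (Instr A B ρ L)} {l₀ : L} {tape : List (InputSym A)} {W : ℕ}
    {l l' : L} {ph ph' : Phase} {z z' : ℤ} {w w' : ℕ} {s s' : CState B ρ}
    {a : Action (L × Phase) (Option (ρ → Bool)) B}
    (h : flowTrans G (l, ph) (symAt tape s.pos) (cells s.reg w z) = some a)
    (hl : a.next = (l', ph'))
    (hp : s'.pos = moveInput tape.length s.pos a.inputMove)
    (ho : s'.out = s.out ++ a.output.toList)
    (hw : Function.update (cells s.reg w) z a.write = cells s'.reg w')
    (hz : z' = moveWork z a.workMove) (hb : (0 ≤ z ∧ z ≤ W) ∧ (0 ≤ z' ∧ z' ≤ W)) :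
    (flowMachine G l₀).StepIn tape W (flowConfig G l₀ l ph z w s)
      (flowConfig G l₀ l' ph' z' w' s') := by
  refine ⟨a, h, ?_, hb⟩
  obtain ⟨n, g, im, wm, o⟩ := a
  simp only at hl hp ho hw hz
  subst hl hz
  unfold flowConfig Machine.perform
  simp only
  rw [hw, hp, ho]

theorem cells_zero (reg : ρ → ℕ) (w : ℕ) : cells reg w 0 = none := by simp [cells]

theorem reach_back {l l' : L}
    (hG : (∃ p r, G l = some (.incIf p r l')) ∨ ∃ r z, G l = some (.decz r z l')) (s : CState B ρ) {w : ℕ} (hw : w ≤ W) :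
    ∀ z : ℕ, z ≤ w → Relation.ReflTransGen ((flowMachine G l₀).StepIn tape (W + 1))
      (flowConfig G l₀ l .back z w s) (flowConfig G l₀ l' .main 0 w s) := by
  intro z
  induction z with
  | zero =>
    intro _
    refine Relation.ReflTransGen.single (flowStepIn (a := ⟨(l', .main), none, .stay, .stay, none⟩) ?_ rfl rfl (by simp) ?_ ?_ ?_)
    · rcases hG with ⟨p, r, hG⟩ | ⟨r, n, hG⟩ <;>
        simp [flowTrans, hG, cells]
    · simp [Function.update_eq_self_iff, cells]
    · simp [moveWork]
    · refine ⟨⟨?_, ?_⟩, ?_, ?_⟩ <;> push_cast <;> omega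
  | succ z ih =>
    intro hz
    refine Relation.ReflTransGen.head ?_ (ih (by omega))
    refine flowStepIn (a := ⟨(l, .back), some fun i => (s.reg i).testBit z, .stay, .left, none⟩) ?_ rfl rfl (by simp) ?_ ?_ ?_
    · rcases hG with ⟨p, r, hG⟩ | ⟨r, n, hG⟩ <;>
        simp [flowTrans, hG,
          cells_succ _ (show z < w by omega)]
    · rcases hG with ⟨p, r, hG⟩ | ⟨r, n, hG⟩ <;>
      simp [Function.update_eq_self_iff,
        cells_succ _ (show z < w by omega)]
    · simp [moveWork]
    · refine ⟨⟨?_, ?_⟩, ?_, ?_⟩ <;> push_cast <;> omega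

/-- The invariant of carry propagation: the digits below place `j` have already become `0`, so the
counter reads `2 ^ j * q` while its final value will be `2 ^ j * (q + 1)`. If `q` is even, the carry
is absorbed at place `j`; if `q` is odd, it moves on. The induction is on the number `d` of digits
that remain. -/
theorem reach_incGo {l l' : L} {p r} (hG : G l = some (.incIf p r l')) (V : ℕ) (hV : V.size ≤ W) :
    ∀ d j q w : ℕ, w = j + d → w ≤ W → ∀ s : CState B ρ, s.reg r = 2 ^ j * q →
      (∀ i, s.reg i < 2 ^ w) → 2 ^ j * (q + 1) ≤ V →
      ∃ w' ≤ W, (∀ i, Function.update s.reg r (2 ^ j * (q + 1)) i < 2 ^ w') ∧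
      Relation.ReflTransGen ((flowMachine G l₀).StepIn tape (W + 1))
        (flowConfig G l₀ l .go (j + 1) w s)
        (flowConfig G l₀ l' .main 0 w'
          { s with reg := Function.update s.reg r (2 ^ j * (q + 1)) }) := by
  intro d
  induction d with
  | zero =>
    intro j q w hw hwW s hr hs hq
    obtain rfl : w = j := by omega
    have hq0 : q = 0 := by
      by_contra h
      have := hs r
      rw [hr] at this
      have : 2 ^ w * 1 ≤ 2 ^ w * q := Nat.mul_le_mul_left _ (by omega)
      omega
    subst hq0
    simp only [zero_add, mul_one, mul_zero] at *
    -- The incremented value is `2 ^ w`, which is at most `V`; so `V` has more than `w` digits, and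
    -- the new cell is still available.
    have hw1 : w + 1 ≤ W := by
      have : w < V.size := Nat.lt_size.mpr hq
      omega
    refine ⟨w + 1, hw1, ?_, ?_⟩
    · intro i
      by_cases hi : i = r
      · subst hi; simp; exact Nat.pow_lt_pow_right (by norm_num) (by omega)
      · simp only [Function.update_of_ne hi]
        exact (hs i).trans (Nat.pow_lt_pow_right (by norm_num) (by omega))
    · refine Relation.ReflTransGen.head ?_ (reach_back G l₀ tape W
        (Or.inl ⟨p, r, hG⟩) _ hw1 w (by omega))
      refine flowStepIn (a := ⟨(l, .back), some (Function.update (fun _ => false) r true), .stay, .left, none⟩) ?_ rfl rfl (by simp) ?_ ?_ ?_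
      · simp [flowTrans, hG, cells]
      · funext z
        by_cases hz : z = w + 1
        · subst hz
          rw [Function.update_self, cells_succ _ (by omega)]
          refine congrArg some (funext fun i => ?_)
          by_cases hi : i = r
          · subst hi; simp
          · simp only [Function.update_of_ne hi]
            exact (Nat.testBit_lt_two_pow (hs i)).symm
        · rw [Function.update_of_ne hz]
          unfold cells
          by_cases h1 : 1 ≤ z ∧ z ≤ w
          · rw [if_pos h1, if_pos (by push_cast; omega)]
            congr 1
            funext i
            by_cases hi : i = r
            · subst hi
              simp only [Function.update_self, Nat.testBit_two_pow, hr]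
              simp; omega
            · simp [hi]
          · rw [if_neg h1, if_neg (by push_cast; omega)]
      · simp [moveWork]
      · refine ⟨⟨?_, ?_⟩, ?_, ?_⟩ <;> push_cast <;> omega
  | succ d ih =>
    intro j q w hw hwW s hr hs hq
    have hj : j < w := by omega
    rcases Nat.even_or_odd' q with ⟨k, rfl | rfl⟩
    · refine ⟨w, hwW, ?_, ?_⟩
      · intro i
        by_cases hi : i = r
        · subst hi
          rw [Function.update_self]
          have h1 := hs i
          rw [hr] at h1
          obtain ⟨e, rfl⟩ : ∃ e, w = j + (e + 1) := ⟨d, by omega⟩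
          rw [pow_add] at h1 ⊢
          have h2 := Nat.lt_of_mul_lt_mul_left h1
          have : 2 ^ (e + 1) = 2 * 2 ^ e := by ring
          exact Nat.mul_lt_mul_of_pos_left (by omega) (by positivity)
        · simp [hi, hs i]
      · refine Relation.ReflTransGen.head ?_ (reach_back G l₀ tape W
          (Or.inl ⟨p, r, hG⟩) _ hwW j (by omega))
        refine flowStepIn (a := ⟨(l, .back), some (Function.update (fun i => (s.reg i).testBit j) r true), .stay,
          .left, none⟩) ?_ rfl rfl (by simp) ?_ ?_ ?_
        · simp [flowTrans, hG, cells_succ _ hj, hr,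
            Nat.testBit_two_pow_mul]
        · apply update_cells _ hj
          intro i
          rw [hr, Nat.testBit_two_pow_mul, Nat.testBit_two_pow_mul]
          split_ifs with h
          · subst h; simp
          · by_cases hi : i ≥ j
            · obtain ⟨e, rfl⟩ : ∃ e, i = j + e + 1 := ⟨i - j - 1, by omega⟩
              simp [show j + e + 1 - j = e + 1 by omega, Nat.testBit_succ]
              rw [show (2 * k + 1) / 2 = k by omega]
            · simp [hi]
        · simp [moveWork]
        · refine ⟨⟨?_, ?_⟩, ?_, ?_⟩ <;> push_cast <;> omega
    · have hupd : ∀ i, (2 ^ (j + 1) * k).testBit i =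
          if i = j then false else (s.reg r).testBit i := by
        intro i
        rw [hr, Nat.testBit_two_pow_mul, Nat.testBit_two_pow_mul]
        split_ifs with h
        · subst h; simp
        · by_cases hi : i ≥ j
          · obtain ⟨e, rfl⟩ : ∃ e, i = j + e + 1 := ⟨i - j - 1, by omega⟩
            simp [show j + e + 1 - j = e + 1 by omega, show j + e + 1 - (j + 1) = e by omega,
              Nat.testBit_succ, show (2 * k + 1) / 2 = k by omega]
            omega
          · have : ¬ i ≥ j + 1 := by omega
            simp [hi, this]
      have hle : 2 ^ (j + 1) * k ≤ s.reg r := by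
        rw [hr, pow_succ, mul_assoc]
        exact Nat.mul_le_mul_left _ (by omega)
      obtain ⟨w', hw', hb, hreach⟩ := ih (j + 1) k w (by omega) hwW
        { s with reg := Function.update s.reg r (2 ^ (j + 1) * k) } (by simp) (by
          intro i
          by_cases hi : i = r
          · subst hi; simpa using hle.trans_lt (hs i)
          · simpa [hi] using hs i) (by
          refine le_of_eq_of_le ?_ hq
          ring)
      have he : 2 ^ (j + 1) * (k + 1) = 2 ^ j * (2 * k + 1 + 1) := by ring
      simp only [Function.update_idem, he] at hb hreach
      refine ⟨w', hw', hb, Relation.ReflTransGen.head ?_ hreach⟩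
      refine flowStepIn (a := ⟨(l, .go), some (Function.update (fun i => (s.reg i).testBit j) r false), .stay,
        .right, none⟩) ?_ rfl rfl (by simp) ?_ ?_ ?_
      · simp [flowTrans, hG, cells_succ _ hj, hr,
          Nat.testBit_two_pow_mul]
      · exact update_cells _ hj hupd
      · simp [moveWork]
      · refine ⟨⟨?_, ?_⟩, ?_, ?_⟩ <;> push_cast <;> omega

/-- A borrow that finds no digit `1` has turned all zeros of the counter into ones. This pass on the
way back undoes it. -/
theorem reach_restore {l z n : L} {r} (hG : G l = some (.decz r z n)) {w : ℕ} (hw : w ≤ W) :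
    ∀ j : ℕ, j ≤ w → ∀ s : CState B ρ, s.reg r = 2 ^ j - 1 →
      Relation.ReflTransGen ((flowMachine G l₀).StepIn tape (W + 1))
        (flowConfig G l₀ l .restore j w s)
        (flowConfig G l₀ z .main 0 w { s with reg := Function.update s.reg r 0 }) := by
  intro j
  induction j with
  | zero =>
    intro _ s hr
    have : Function.update s.reg r 0 = s.reg := by
      rw [Function.update_eq_self_iff]; simpa using hr.symm
    rw [this]
    refine Relation.ReflTransGen.single (flowStepIn (a := ⟨(z, .main), none, .stay, .stay, none⟩) ?_ rfl rfl (by simp) ?_ ?_ ?_)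
    · simp [flowTrans, hG, cells]
    · simp [Function.update_eq_self_iff, cells]
    · simp [moveWork]
    · refine ⟨⟨?_, ?_⟩, ?_, ?_⟩ <;> push_cast <;> omega
  | succ j ih =>
    intro hj s hr
    have h := ih (by omega) { s with reg := Function.update s.reg r (2 ^ j - 1) } (by simp)
    simp only [Function.update_idem] at h
    refine Relation.ReflTransGen.head ?_ h
    refine flowStepIn (a := ⟨(l, .restore), some (Function.update (fun i => (s.reg i).testBit j) r false), .stay,
      .left, none⟩) ?_ rfl rfl (by simp) ?_ ?_ ?_
    · simp [flowTrans, hG,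
        cells_succ _ (show j < w by omega)]
    · have := update_cells s.reg (w := w) (j := j) (y := 2 ^ j - 1) (r := r) (b := false)
        (by omega) (by
          intro i
          rw [hr, Nat.testBit_two_pow_sub_one, Nat.testBit_two_pow_sub_one]
          split_ifs with h
          · simp [h]
          · simp; omega)
      simpa using this
    · simp [moveWork]
    · refine ⟨⟨?_, ?_⟩, ?_, ?_⟩ <;> push_cast <;> omega

/-- The invariant of borrow propagation: the digits below place `j` have already become `1`. If `q =
0`, the borrow runs off the number, which means that the counter was zero; truncated subtraction
makes the formula `2 ^ j * q - 1` correct in this case too. -/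
theorem reach_decGo {l z n : L} {r} (hG : G l = some (.decz r z n)) :
    ∀ d j q w : ℕ, w = j + d → w ≤ W → ∀ s : CState B ρ, s.reg r = 2 ^ j * q + (2 ^ j - 1) →
      (∀ i, s.reg i < 2 ^ w) →
      Relation.ReflTransGen ((flowMachine G l₀).StepIn tape (W + 1))
        (flowConfig G l₀ l .go (j + 1) w s)
        (flowConfig G l₀ (if q = 0 then z else n) .main 0 w
          { s with reg := Function.update s.reg r (2 ^ j * q - 1) }) := by
  intro d
  induction d with
  | zero =>
    intro j q w hw hwW s hr hs
    obtain rfl : w = j := by omega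
    have hq0 : q = 0 := by
      by_contra h
      have := hs r
      rw [hr] at this
      have : 2 ^ w * 1 ≤ 2 ^ w * q := Nat.mul_le_mul_left _ (by omega)
      omega
    subst hq0
    have h := reach_restore G l₀ tape W hG hwW w le_rfl s (by simpa using hr)
    simp only [mul_zero, Nat.zero_sub, if_true]
    refine Relation.ReflTransGen.head ?_ h
    refine flowStepIn (a := ⟨(l, .restore), none, .stay, .left, none⟩) ?_ rfl rfl (by simp) ?_ ?_ ?_
    · simp [flowTrans, hG, cells]
    · rw [Function.update_eq_self_iff]
      simp [cells]
    · simp [moveWork]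
    · refine ⟨⟨?_, ?_⟩, ?_, ?_⟩ <;> push_cast <;> omega
  | succ d ih =>
    intro j q w hw hwW s hr hs
    have hj : j < w := by omega
    have hlt : 2 ^ j - 1 < 2 ^ j := Nat.sub_lt (by positivity) (by norm_num)
    rcases Nat.even_or_odd' q with ⟨k, rfl | rfl⟩
    · have hupd : ∀ i, (2 ^ (j + 1) * k + (2 ^ (j + 1) - 1)).testBit i =
          if i = j then true else (s.reg r).testBit i := by
        intro i
        have hlt' : 2 ^ (j + 1) - 1 < 2 ^ (j + 1) := Nat.sub_lt (by positivity) (by norm_num)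
        rw [hr, Nat.testBit_two_pow_mul_add _ hlt, Nat.testBit_two_pow_mul_add _ hlt',
          Nat.testBit_two_pow_sub_one, Nat.testBit_two_pow_sub_one]
        split_ifs with h1 h2 h3 h4 h5
        · simp [h1]
        · simp; omega
        · exfalso; omega
        · exfalso; omega
        · exfalso; omega
        · obtain ⟨e, rfl⟩ : ∃ e, i = j + e + 1 := ⟨i - j - 1, by omega⟩
          simp [show j + e + 1 - j = e + 1 by omega, show j + e + 1 - (j + 1) = e by omega,
            Nat.testBit_succ]
      have h := ih (j + 1) k w (by omega) hwW
        { s with reg := Function.update s.reg r (2 ^ (j + 1) * k + (2 ^ (j + 1) - 1)) } (by simp)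
        (by
          intro i
          by_cases hi : i = r
          · subst hi
            simp only [Function.update_self]
            apply Nat.lt_pow_two_of_testBit
            intro t ht
            rw [hupd, if_neg (by omega)]
            exact Nat.testBit_lt_two_pow ((hs i).trans_le (Nat.pow_le_pow_right (by norm_num) ht))
          · simpa [hi] using hs i)
      have he : 2 ^ (j + 1) * k - 1 = 2 ^ j * (2 * k) - 1 := by congr 1; ring
      have hk : (k = 0) = (2 * k = 0) := by simp
      simp only [Function.update_idem, he, hk] at h
      refine Relation.ReflTransGen.head ?_ h
      refine flowStepIn (a := ⟨(l, .go), some (Function.update (fun i => (s.reg i).testBit j) r true), .stay,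
        .right, none⟩) ?_ rfl rfl (by simp) ?_ ?_ ?_
      · simp [flowTrans, hG, cells_succ _ hj, hr,
          Nat.testBit_two_pow_mul_add _ hlt]
      · exact update_cells _ hj hupd
      · simp [moveWork]
      · refine ⟨⟨?_, ?_⟩, ?_, ?_⟩ <;> push_cast <;> omega
    · rw [if_neg (by omega)]
      refine Relation.ReflTransGen.head ?_ (reach_back G l₀ tape W
          (Or.inr ⟨r, z, hG⟩) _ hwW j (by omega))
      refine flowStepIn (a := ⟨(l, .back), some (Function.update (fun i => (s.reg i).testBit j) r false), .stay,
          .left, none⟩) ?_ rfl rfl (by simp) ?_ ?_ ?_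
      · simp [flowTrans, hG, cells_succ _ hj, hr,
          Nat.testBit_two_pow_mul_add _ hlt]
      · apply update_cells _ hj
        intro i
        have he : 2 ^ j * (2 * k + 1) - 1 = 2 ^ j * (2 * k) + (2 ^ j - 1) := by
          rw [mul_add, mul_one]; have : 0 < 2 ^ j := by positivity
          omega
        rw [he, hr, Nat.testBit_two_pow_mul_add _ hlt, Nat.testBit_two_pow_mul_add _ hlt]
        split_ifs with h1 h2
        · exfalso; omega
        · rfl
        · rename_i h2; simp [h2]
        · obtain ⟨e, rfl⟩ : ∃ e, i = j + e + 1 := ⟨i - j - 1, by omega⟩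
          simp [show j + e + 1 - j = e + 1 by omega, Nat.testBit_succ]
          congr 1; omega
      · simp [moveWork]
      · refine ⟨⟨?_, ?_⟩, ?_, ?_⟩ <;> push_cast <;> omega

/-- Each instruction begins and ends with the head on the blank cell `0`. The number `w` of cells in
use grows only when a counter gets a new top digit. -/
theorem reach_of_flowStep {V : ℕ} (hV : V.size ≤ W) {x y : L × CState B ρ}
    (h : FlowStep G tape V x y) {w : ℕ} (hw : w ≤ W) (hx : ∀ i, x.2.reg i < 2 ^ w) :
    ∃ w' ≤ W, (∀ i, y.2.reg i < 2 ^ w') ∧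
      Relation.ReflTransGen ((flowMachine G l₀).StepIn tape (W + 1))
        (flowConfig G l₀ x.1 .main 0 w x.2) (flowConfig G l₀ y.1 .main 0 w' y.2) := by
  cases h with
  | @incT l l' p r s hG hp hs =>
    obtain ⟨w', hw', hb, h⟩ := reach_incGo G l₀ tape W hG V hV w 0 (s.reg r) w (by simp) hw s
      (by simp) hx (by simpa using hs)
    simp only [pow_zero, one_mul] at hb h
    refine ⟨w', hw', hb, Relation.ReflTransGen.head ?_ h⟩
    refine flowStepIn (a := ⟨(l, .go), none, .stay, .right, none⟩) ?_ rfl rfl (by simp) ?_ ?_ ?_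
    · have : p (symAt tape s.pos) = true := hp
      simp only [flowTrans, hG, this]
      simp [cells]
    · simp [Function.update_eq_self_iff, cells_zero]
    · simp [moveWork]
    · refine ⟨⟨?_, ?_⟩, ?_, ?_⟩ <;> push_cast <;> omega
  | @incF l l' p r s hG hp =>
    refine ⟨w, hw, hx, Relation.ReflTransGen.single
      (flowStepIn (a := ⟨(l', .main), none, .stay, .stay, none⟩) ?_ rfl rfl (by simp) ?_ ?_ ?_)⟩
    · have : p (symAt tape s.pos) = false := hp
      simp only [flowTrans, hG, this]
      simp [cells]
    · simp [Function.update_eq_self_iff, cells_zero]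
    · simp [moveWork]
    · refine ⟨⟨?_, ?_⟩, ?_, ?_⟩ <;> push_cast <;> omega
  | @decZ l z n r s hG hr =>
    have h := reach_decGo G l₀ tape W hG w 0 (s.reg r) w (by simp) hw s (by simp) hx
    simp only [hr, if_true, mul_zero, Nat.zero_sub] at h
    have he : Function.update s.reg r 0 = s.reg := by simp [Function.update_eq_self_iff, hr]
    rw [he] at h
    refine ⟨w, hw, hx, Relation.ReflTransGen.head ?_ h⟩
    refine flowStepIn (a := ⟨(l, .go), none, .stay, .right, none⟩) ?_ rfl rfl (by simp) ?_ ?_ ?_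
    · simp [flowTrans, hG, cells]
    · simp [Function.update_eq_self_iff, cells_zero]
    · simp [moveWork]
    · refine ⟨⟨?_, ?_⟩, ?_, ?_⟩ <;> push_cast <;> omega
  | @decP l z n r s k hG hr =>
    have h := reach_decGo G l₀ tape W hG w 0 (s.reg r) w (by simp) hw s (by simp) hx
    simp only [hr, pow_zero, one_mul, Nat.add_sub_cancel, Nat.add_eq_zero_iff, one_ne_zero,
      and_false, if_false] at h
    refine ⟨w, hw, ?_, Relation.ReflTransGen.head ?_ h⟩
    · intro i
      by_cases hi : i = r
      · subst hi
        have := hx i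
        simp only [Function.update_self]
        simp only at this
        omega
      · simpa [hi] using hx i
    refine flowStepIn (a := ⟨(l, .go), none, .stay, .right, none⟩) ?_ rfl rfl (by simp) ?_ ?_ ?_
    · simp [flowTrans, hG, cells]
    · simp [Function.update_eq_self_iff, cells_zero]
    · simp [moveWork]
    · refine ⟨⟨?_, ?_⟩, ?_, ?_⟩ <;> push_cast <;> omega
  | @adv l l' s hG =>
    refine ⟨w, hw, hx, Relation.ReflTransGen.single
      (flowStepIn (a := ⟨(l', .main), none, .right, .stay, none⟩) ?_ rfl rfl (by simp) ?_ ?_ ?_)⟩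
    · simp [flowTrans, hG, cells]
    · simp [Function.update_eq_self_iff, cells_zero]
    · simp [moveWork]
    · refine ⟨⟨?_, ?_⟩, ?_, ?_⟩ <;> push_cast <;> omega
  | @emit l l' b s hG =>
    refine ⟨w, hw, hx, Relation.ReflTransGen.single
      (flowStepIn (a := ⟨(l', .main), none, .stay, .stay, some b⟩) ?_ rfl rfl (by simp) ?_ ?_ ?_)⟩
    · simp [flowTrans, hG, cells]
    · simp [Function.update_eq_self_iff, cells_zero]
    · simp [moveWork]
    · refine ⟨⟨?_, ?_⟩, ?_, ?_⟩ <;> push_cast <;> omega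

/-- The two additional cells are the blank cell `0` and the blank cell beyond the digits, where the
head notices the end of the numbers. -/
theorem flowMachine_haltsWith {V : ℕ} {l : L} {s : CState B ρ}
    (h : Relation.ReflTransGen (FlowStep G tape V) (l₀, ⟨fun _ => 0, 0, []⟩) (l, s))
    (hl : G l = none) : (flowMachine G l₀).HaltsWith tape s.out (V.size + 2) := by
  have key : ∃ w' ≤ V.size, (∀ i, s.reg i < 2 ^ w') ∧
      Relation.ReflTransGen ((flowMachine G l₀).StepIn tape (V.size + 1))
        (flowConfig G l₀ l₀ .main 0 0 ⟨fun _ => 0, 0, []⟩) (flowConfig G l₀ l .main 0 w' s) := by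
    clear hl
    generalize hy : (l, s) = y at h
    induction h generalizing l s with
    | refl =>
      obtain ⟨rfl, rfl⟩ := Prod.mk.inj hy
      exact ⟨0, by omega, by simp, .refl⟩
    | @tail b c _ hs ih =>
      subst hy
      obtain ⟨w, hw, hb, hr⟩ := ih (l := b.1) (s := b.2) rfl
      obtain ⟨w', hw', hb', hr'⟩ := reach_of_flowStep G l₀ tape V.size le_rfl hs hw hb
      exact ⟨w', hw', hb', hr.trans hr'⟩
  obtain ⟨w, _, _, hr⟩ := key
  have he : flowConfig G l₀ l₀ .main 0 0 (⟨fun _ => 0, 0, []⟩ : CState B ρ) =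
      (flowMachine G l₀).init := by
    simp only [flowConfig, Machine.init, flowMachine, Machine.Config.mk.injEq, true_and, and_true]
    funext z
    unfold cells
    rw [if_neg (by push_cast; omega)]
  rw [he] at hr
  exact (flowMachine G l₀).haltsWith_of_reflTransGen tape _ hr
    (by change flowTrans G (l, .main) _ _ = none; simp [flowTrans, hl])

end Flow

end SpaceTM

namespace SpaceTM

/-! ### Structured programs -/

/-- Structured counter programs with input and output. `branch r P Q` runs `P` if the counter `r` is
zero and otherwise decrements it and runs `Q`; `loop r P` decrements `r` and runs `P` as long as
`r` is not zero. -/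
inductive Prog (A B ρ : Type) : Type
  | incIf (p : InputSym A → Bool) (r : ρ)
  | advance
  | emit (b : B)
  | seq (P Q : Prog A B ρ)
  | branch (r : ρ) (P Q : Prog A B ρ)
  | loop (r : ρ) (P : Prog A B ρ)

variable {A B ρ ρ' L : Type}

/-- Execution of a structured program with counters at most `V`. -/
inductive Exec [DecidableEq ρ] (tape : List (InputSym A)) (V : ℕ) :
    Prog A B ρ → CState B ρ → CState B ρ → Prop
  | incT {p r s} : p (symAt tape s.pos) = true → s.reg r + 1 ≤ V →
      Exec tape V (.incIf p r) s { s with reg := Function.update s.reg r (s.reg r + 1) }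
  | incF {p r s} : p (symAt tape s.pos) = false → Exec tape V (.incIf p r) s s
  | advance {s} : Exec tape V .advance s { s with pos := moveInput tape.length s.pos .right }
  | emit {b s} : Exec tape V (.emit b) s { s with out := s.out ++ [b] }
  | seq {P Q s t u} : Exec tape V P s t → Exec tape V Q t u → Exec tape V (.seq P Q) s u
  | branchZ {r P Q s t} : s.reg r = 0 → Exec tape V P s t → Exec tape V (.branch r P Q) s t
  | branchP {r P Q s t k} : s.reg r = k + 1 →
      Exec tape V Q { s with reg := Function.update s.reg r k } t →
      Exec tape V (.branch r P Q) s t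
  | loopZ {r P s} : s.reg r = 0 → Exec tape V (.loop r P) s s
  | loopP {r P s t u k} : s.reg r = k + 1 →
      Exec tape V P { s with reg := Function.update s.reg r k } t →
      Exec tape V (.loop r P) t u → Exec tape V (.loop r P) s u

namespace Prog

/-- Renaming of the counters. -/
def map (g : ρ → ρ') : Prog A B ρ → Prog A B ρ'
  | incIf p r => incIf p (g r)
  | advance => advance
  | emit b => emit b
  | seq P Q => seq (P.map g) (Q.map g)
  | branch r P Q => branch (g r) (P.map g) (Q.map g)
  | loop r P => loop (g r) (P.map g)

/-- The counters that occur in a program. -/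
def regs : Prog A B ρ → Set ρ
  | incIf _ r => {r}
  | advance => ∅
  | emit _ => ∅
  | seq P Q => P.regs ∪ Q.regs
  | branch r P Q => {r} ∪ (P.regs ∪ Q.regs)
  | loop r P => {r} ∪ P.regs

theorem finite_regs (P : Prog A B ρ) : P.regs.Finite := by
  induction P <;> simp_all [regs]

/-- Labels of the flowchart of a program. -/
def Lab : Prog A B ρ → Type
  | incIf _ _ => Unit
  | advance => Unit
  | emit _ => Unit
  | seq P Q => P.Lab ⊕ Q.Lab
  | branch _ P Q => Option (P.Lab ⊕ Q.Lab)
  | loop _ P => Option P.Lab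

theorem finite_lab (P : Prog A B ρ) : Finite P.Lab := by
  induction P with
  | seq P Q h1 h2 => exact (inferInstance : Finite (P.Lab ⊕ Q.Lab))
  | branch r P Q h1 h2 => exact (inferInstance : Finite (Option (P.Lab ⊕ Q.Lab)))
  | loop r P h => exact (inferInstance : Finite (Option P.Lab))
  | incIf | advance | emit => exact (inferInstance : Finite Unit)

/-- The initial label. -/
def start : (P : Prog A B ρ) → P.Lab
  | incIf _ _ => ()
  | advance => ()
  | emit _ => ()
  | seq P _ => Sum.inl P.start
  | branch _ _ _ => none
  | loop _ _ => none

end Prog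

/-- Renaming of the labels in an instruction. -/
def Instr.map {L L' : Type} (e : L → L') : Instr A B ρ L → Instr A B ρ L'
  | incIf p r l => incIf p r (e l)
  | decz r z n => decz r (e z) (e n)
  | advance l => advance (e l)
  | emit b l => emit b (e l)

namespace Prog

/-- The flowchart of a program; `none` is the exit. -/
def code : (P : Prog A B ρ) → P.Lab → Instr A B ρ (Option P.Lab)
  | incIf p r, _ => .incIf p r none
  | advance, _ => .advance none
  | emit b, _ => .emit b none
  | seq P Q, Sum.inl l =>
    (P.code l).map fun o => o.elim (some (Sum.inr Q.start)) fun l => some (Sum.inl l)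
  | seq _ Q, Sum.inr l => (Q.code l).map fun o => o.elim none fun l => some (Sum.inr l)
  | branch r P Q, none => .decz r (some (some (Sum.inl P.start))) (some (some (Sum.inr Q.start)))
  | branch _ P _, some (Sum.inl l) =>
    (P.code l).map fun o => o.elim none fun l => some (some (Sum.inl l))
  | branch _ _ Q, some (Sum.inr l) =>
    (Q.code l).map fun o => o.elim none fun l => some (some (Sum.inr l))
  | loop r P, none => .decz r none (some (some P.start))
  | loop _ P, some l => (P.code l).map fun o => o.elim (some none) fun l => some (some l)

/-- The flowchart of `P` is a part of the flowchart `G`, with exit `x`. -/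
def Embeds (G : L → Option (Instr A B ρ L)) (P : Prog A B ρ) (e : P.Lab → L) (x : L) : Prop :=
  ∀ l, G (e l) = some ((P.code l).map fun o => o.elim x e)

end Prog

theorem Instr.map_map {L L' L'' : Type} (e : L → L') (e' : L' → L'') (i : Instr A B ρ L) :
    (i.map e).map e' = i.map (e' ∘ e) := by
  cases i <;> rfl

theorem Instr.map_congr {L L' : Type} {e e' : L → L'} (h : ∀ l, e l = e' l)
    (i : Instr A B ρ L) : i.map e = i.map e' := by
  rw [funext h]

/-- The surrounding flowchart, the embedding and the exit are universally quantified so that the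
induction applies to subprograms: the exit of the first part of a sequence is the start of the
second part, and the exit of the body of a loop is the label of its test. -/
theorem Exec.flow [DecidableEq ρ] {tape : List (InputSym A)} {V : ℕ} {P : Prog A B ρ}
    {s t : CState B ρ} (h : Exec tape V P s t) :
    ∀ {L : Type} (G : L → Option (Instr A B ρ L)) (e : P.Lab → L) (x : L), P.Embeds G e x →
      Relation.ReflTransGen (FlowStep G tape V) (e P.start, s) (x, t) := by
  induction h with
  | incT h1 h2 => intro L G e x hG; exact .single (.incT (hG ()) h1 h2)
  | incF h => intro L G e x hG; exact .single (.incF (hG ()) h)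
  | advance => intro L G e x hG; exact .single (.adv (hG ()))
  | emit => intro L G e x hG; exact .single (.emit (hG ()))
  | @seq P Q _ _ _ _ _ ih1 ih2 =>
    intro L G e x hG
    refine (ih1 G (fun l => e (Sum.inl l)) (e (Sum.inr Q.start)) ?_).trans
      (ih2 G (fun l => e (Sum.inr l)) x ?_)
    · intro l
      rw [hG (Sum.inl l)]
      simp only [Prog.code, Instr.map_map]
      exact congrArg some (Instr.map_congr (by rintro (_ | l) <;> rfl) _)
    · intro l
      rw [hG (Sum.inr l)]
      simp only [Prog.code, Instr.map_map]
      exact congrArg some (Instr.map_congr (by rintro (_ | l) <;> rfl) _)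
  | @branchZ r P Q s t h _ ih =>
    intro L G e x hG
    refine .head (.decZ (hG none) h) (ih G (fun l => e (some (Sum.inl l))) x ?_)
    intro l
    rw [hG (some (Sum.inl l))]
    simp only [Prog.code, Instr.map_map]
    exact congrArg some (Instr.map_congr (by rintro (_ | l) <;> rfl) _)
  | @branchP r P Q s t k h _ ih =>
    intro L G e x hG
    refine .head (.decP (hG none) h) (ih G (fun l => e (some (Sum.inr l))) x ?_)
    intro l
    rw [hG (some (Sum.inr l))]
    simp only [Prog.code, Instr.map_map]
    exact congrArg some (Instr.map_congr (by rintro (_ | l) <;> rfl) _)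
  | loopZ h => intro L G e x hG; exact .single (.decZ (hG none) h)
  | @loopP r P s t u k h _ _ ih1 ih2 =>
    intro L G e x hG
    refine .head (.decP (hG none) h) ((ih1 G (fun l => e (some l)) (e none) ?_).trans (ih2 G e x hG))
    intro l
    rw [hG (some l)]
    simp only [Prog.code, Instr.map_map]
    exact congrArg some (Instr.map_congr (by rintro (_ | l) <;> rfl) _)

/-- Execution is compatible with renaming the counters. -/
theorem Exec.map [DecidableEq ρ] [DecidableEq ρ'] {tape : List (InputSym A)} {V : ℕ}
    {P : Prog A B ρ} {s t : CState B ρ} (h : Exec tape V P s t) (g : ρ → ρ') :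
    ∀ R : Set ρ, P.regs ⊆ R → Set.InjOn g R → ∀ s' : CState B ρ',
      (∀ r ∈ R, s'.reg (g r) = s.reg r) → s'.pos = s.pos → s'.out = s.out →
      ∃ t' : CState B ρ', Exec tape V (P.map g) s' t' ∧ (∀ r ∈ R, t'.reg (g r) = t.reg r) ∧
        t'.pos = t.pos ∧ t'.out = t.out ∧ ∀ r' ∉ g '' R, t'.reg r' = s'.reg r' := by
  have upd : ∀ (R : Set ρ), Set.InjOn g R → ∀ (u : ρ → ℕ) (u' : ρ' → ℕ),
      (∀ r ∈ R, u' (g r) = u r) → ∀ r₀ ∈ R, ∀ y : ℕ,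
      (∀ r ∈ R, Function.update u' (g r₀) y (g r) = Function.update u r₀ y r) ∧
      ∀ r' ∉ g '' R, Function.update u' (g r₀) y r' = u' r' := by
    intro R hR u u' hu r₀ h₀ y
    refine ⟨fun r hr => ?_, fun r' hr' => ?_⟩
    · by_cases h : r = r₀
      · subst h; simp
      · rw [Function.update_of_ne h, Function.update_of_ne (fun h' => h (hR hr h₀ h')), hu r hr]
    · rw [Function.update_of_ne]
      rintro rfl
      exact hr' ⟨r₀, h₀, rfl⟩
  induction h with
  | @incT p r s h1 h2 =>
    intro R hP hR s' hs hp ho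
    have hr : r ∈ R := hP rfl
    obtain ⟨u1, u2⟩ := upd R hR s.reg s'.reg hs r hr (s.reg r + 1)
    refine ⟨_, .incT (by rw [hp]; exact h1) (by rw [hs r hr]; exact h2), ?_, hp, ho, ?_⟩
    · simpa only [hs r hr] using u1
    · simpa only [hs r hr] using u2
  | incF h =>
    intro R hP hR s' hs hp ho
    exact ⟨s', .incF (by rw [hp]; exact h), hs, hp, ho, fun _ _ => rfl⟩
  | advance =>
    intro R hP hR s' hs hp ho
    exact ⟨_, .advance, hs, by simp [hp], ho, fun _ _ => rfl⟩
  | emit =>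
    intro R hP hR s' hs hp ho
    exact ⟨_, .emit, hs, hp, by simp [ho], fun _ _ => rfl⟩
  | seq _ _ ih1 ih2 =>
    intro R hP hR s' hs hp ho
    obtain ⟨t', e1, h1, hp1, ho1, k1⟩ := ih1 R (Set.subset_union_left.trans hP) hR s' hs hp ho
    obtain ⟨u', e2, h2, hp2, ho2, k2⟩ := ih2 R (Set.subset_union_right.trans hP) hR t' h1 hp1 ho1
    exact ⟨u', .seq e1 e2, h2, hp2, ho2, fun r hr => (k2 r hr).trans (k1 r hr)⟩
  | @branchZ r P Q s t h _ ih =>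
    intro R hP hR s' hs hp ho
    obtain ⟨t', e1, h1, hp1, ho1, k1⟩ :=
      ih R ((Set.subset_union_left.trans Set.subset_union_right).trans hP) hR s' hs hp ho
    exact ⟨t', .branchZ (by rw [hs r (hP (Or.inl rfl)), h]) e1, h1, hp1, ho1, k1⟩
  | @branchP r P Q s t k h _ ih =>
    intro R hP hR s' hs hp ho
    have hr : r ∈ R := hP (Or.inl rfl)
    obtain ⟨u1, u2⟩ := upd R hR s.reg s'.reg hs r hr k
    obtain ⟨t', e1, h1, hp1, ho1, k1⟩ :=
      ih R ((Set.subset_union_right.trans Set.subset_union_right).trans hP) hR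
        { s' with reg := Function.update s'.reg (g r) k } u1 hp ho
    exact ⟨t', .branchP (by rw [hs r hr, h]) e1, h1, hp1, ho1,
      fun r' hr' => (k1 r' hr').trans (u2 r' hr')⟩
  | @loopZ r P s h =>
    intro R hP hR s' hs hp ho
    exact ⟨s', .loopZ (by rw [hs r (hP (Or.inl rfl)), h]), hs, hp, ho, fun _ _ => rfl⟩
  | @loopP r P s t u k h _ _ ih1 ih2 =>
    intro R hP hR s' hs hp ho
    have hr : r ∈ R := hP (Or.inl rfl)
    obtain ⟨u1, u2⟩ := upd R hR s.reg s'.reg hs r hr k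
    obtain ⟨t', e1, h1, hp1, ho1, k1⟩ :=
      ih1 R (Set.subset_union_right.trans hP) hR
        { s' with reg := Function.update s'.reg (g r) k } u1 hp ho
    obtain ⟨v', e2, h2, hp2, ho2, k2⟩ := ih2 R hP hR t' h1 hp1 ho1
    exact ⟨v', .loopP (by rw [hs r hr, h]) e1 e2, h2, hp2, ho2,
      fun q hq => (k2 q hq).trans ((k1 q hq).trans (u2 q hq))⟩

/-- A program that always terminates within its bounds is realized by an online machine. -/
theorem exists_machine_of_prog (P : Prog A B ℕ) :
    ∃ (Γ : Type) (_ : Finite Γ) (M : Machine A Γ B), M.IsOnline ∧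
      ∀ (tape : List (InputSym A)) (V : ℕ) (t : CState B ℕ),
        Exec tape V P ⟨fun _ => 0, 0, []⟩ t → M.HaltsWith tape t.out (V.size + 2) := by
  -- Only finitely many counters occur. Renaming them into `Fin (m + 1)` makes the number of tracks,
  -- and hence the working alphabet, finite.
  obtain ⟨m, hm⟩ := P.finite_regs.bddAbove
  let g : ℕ → Fin (m + 1) := fun r => Fin.ofNat (m + 1) r
  have hinj : Set.InjOn g (Set.Iic m) := by
    intro a ha b hb h
    have := congrArg Fin.val h
    simp only [Set.mem_Iic] at ha hb
    simpa [g, Nat.mod_eq_of_lt (Nat.lt_succ_of_le ha),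
      Nat.mod_eq_of_lt (Nat.lt_succ_of_le hb)] using this
  let P' := P.map g
  have := P'.finite_lab
  let G : Option P'.Lab → Option (Instr A B (Fin (m + 1)) (Option P'.Lab)) :=
    fun o => o.map P'.code
  refine ⟨Option (Fin (m + 1) → Bool), inferInstance, flowMachine G (some P'.start),
    flowMachine_isOnline _ _, ?_⟩
  intro tape V t h
  obtain ⟨t', h', _, _, ho, _⟩ := h.map g (Set.Iic m) (fun r hr => hm hr) hinj
    ⟨fun _ => 0, 0, []⟩ (by simp) rfl rfl
  rw [← ho]
  refine flowMachine_haltsWith G (some P'.start) tape (l := none) (h'.flow G some none ?_) rfl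
  intro l
  change some (P'.code l) = _
  congr 1
  have : (fun o : Option P'.Lab => o.elim none some) = id := by funext o; cases o <;> rfl
  rw [this]
  cases P'.code l <;> rfl

end SpaceTM

namespace SpaceTM

/-! ### Arithmetic functions computable in linear space -/

/-- Counters whose values are listed in `l`, the remaining ones being zero. -/
def regList (l : List ℕ) : ℕ → ℕ := fun r => l.getD r 0

theorem regList_append_zero (l : List ℕ) : regList (l ++ [0]) = regList l := by
  funext r
  unfold regList
  rcases lt_trichotomy r l.length with h | h | h
  · rw [List.getD_append _ _ _ _ h]
  · subst h; simp
  · rw [List.getD_eq_default _ _ (by simp; omega), List.getD_eq_default _ _ (by omega)]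

theorem update_regList (l : List ℕ) {r : ℕ} (h : r < l.length) (y : ℕ) :
    Function.update (regList l) r y = regList (l.set r y) := by
  funext i
  unfold regList
  by_cases hi : i = r
  · subst hi
    rw [Function.update_self, List.getD_eq_getElem _ _ (by simpa using h)]
    simp
  · rw [Function.update_of_ne hi]
    simp [List.getD_eq_getElem?_getD, List.getElem?_set_ne (Ne.symm hi)]

variable {A B : Type}

/-- Execution of a program without input and output. -/
def PExec (V : ℕ) (P : Prog A B ℕ) (σ τ : ℕ → ℕ) : Prop :=
  ∀ tape i o, Exec tape V P ⟨σ, i, o⟩ ⟨τ, i, o⟩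

namespace Prog

/-- Increment a counter. -/
def inc (r : ℕ) : Prog A B ℕ := incIf (fun _ => true) r

/-- Do nothing. -/
def skip : Prog A B ℕ := incIf (fun _ => false) 0

/-- Set a counter to zero. -/
def clear (r : ℕ) : Prog A B ℕ := loop r skip

/-- Add the counter `r` to the counter `r'` and clear it. -/
def move (r r' : ℕ) : Prog A B ℕ := loop r (inc r')

end Prog

namespace PExec

variable {V : ℕ} {P Q : Prog A B ℕ}

theorem inc {l : List ℕ} {r : ℕ} (hr : r < l.length) (h : l.getD r 0 + 1 ≤ V) :
    PExec V (.inc r : Prog A B ℕ) (regList l) (regList (l.set r (l.getD r 0 + 1))) := by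
  intro tape i o
  rw [← update_regList l hr]
  exact .incT rfl h

theorem skip {σ : ℕ → ℕ} : PExec V (.skip : Prog A B ℕ) σ σ := fun _ _ _ => .incF rfl

theorem seq {σ τ υ : ℕ → ℕ} (h1 : PExec V P σ τ) (h2 : PExec V Q τ υ) :
    PExec V (.seq P Q) σ υ := fun tape i o => .seq (h1 tape i o) (h2 tape i o)

theorem branchZ {l : List ℕ} {τ : ℕ → ℕ} {r : ℕ} (hr : l.getD r 0 = 0)
    (h : PExec V P (regList l) τ) : PExec V (.branch r P Q) (regList l) τ :=
  fun tape i o => .branchZ hr (h tape i o)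

theorem branchP {l : List ℕ} {τ : ℕ → ℕ} {r k : ℕ} (hl : r < l.length) (hr : l.getD r 0 = k + 1)
    (h : PExec V Q (regList (l.set r k)) τ) : PExec V (.branch r P Q) (regList l) τ := by
  intro tape i o
  rw [← update_regList l hl] at h
  exact .branchP hr (h tape i o)

/-- A loop that runs through a given sequence of states. -/
theorem loop {r n : ℕ} (S : ℕ → List ℕ) (hl : ∀ i ≤ n, r < (S i).length)
    (hr : ∀ i ≤ n, (S i).getD r 0 = n - i)
    (h : ∀ i < n, PExec V P (regList ((S i).set r (n - i - 1))) (regList (S (i + 1)))) :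
    PExec V (.loop r P) (regList (S 0)) (regList (S n)) := by
  intro tape p o
  suffices H : ∀ d i, i + d = n → Exec tape V (.loop r P) ⟨regList (S i), p, o⟩
      ⟨regList (S n), p, o⟩ from H n 0 (by omega)
  intro d
  induction d with
  | zero =>
    intro i hi
    obtain rfl : i = n := by omega
    exact .loopZ (by simpa [regList] using hr i le_rfl)
  | succ d ih =>
    intro i hi
    have h1 := h i (by omega) tape p o
    rw [← update_regList _ (hl i (by omega))] at h1
    exact .loopP (k := n - i - 1) (by have := hr i (by omega); simp only [regList]; omega) h1
      (ih (i + 1) (by omega))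

theorem clear {l : List ℕ} {r : ℕ} (hr : r < l.length) :
    PExec V (.clear r : Prog A B ℕ) (regList l) (regList (l.set r 0)) := by
  have := loop (V := V) (r := r) (P := (.skip : Prog A B ℕ)) (n := l.getD r 0)
    (fun i => l.set r (l.getD r 0 - i)) (by simpa using fun _ _ => hr)
    (by intro i _; simp [hr])
    (by intro i hi; simp only [List.set_set, Nat.sub_sub]; exact skip)
  simpa [hr, Prog.clear] using this

theorem move {l : List ℕ} {r r' : ℕ} (hr : r < l.length) (hr' : r' < l.length) (hne : r ≠ r')
    (h : l.getD r 0 + l.getD r' 0 ≤ V) : PExec V (.move r r' : Prog A B ℕ) (regList l)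
      (regList ((l.set r 0).set r' (l.getD r 0 + l.getD r' 0))) := by
  have := loop (V := V) (r := r) (P := (.inc r' : Prog A B ℕ)) (n := l.getD r 0)
    (fun i => (l.set r (l.getD r 0 - i)).set r' (l.getD r' 0 + i)) (by simpa using fun _ _ => hr)
    (by
      intro i _
      rw [List.getD_eq_getElem _ _ (by simpa using hr), List.getElem_set_ne hne.symm]
      simp)
    (by
      intro i hi
      have h2 := inc (A := A) (B := B) (V := V) (r := r')
        (l := (l.set r (l.getD r 0 - (i + 1))).set r' (l.getD r' 0 + i)) (by simpa using hr')
      rw [List.getD_eq_getElem _ _ (by simpa using hr')] at h2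
      simp only [List.getElem_set_self, List.set_set] at h2
      have h3 : ((l.set r (l.getD r 0 - i)).set r' (l.getD r' 0 + i)).set r (l.getD r 0 - i - 1) =
          (l.set r (l.getD r 0 - (i + 1))).set r' (l.getD r' 0 + i) := by
        rw [List.set_comm _ _ hne.symm, List.set_set, Nat.sub_sub]
      rw [h3]
      exact h2 (by omega))
  have he : (l.set r (l[r]?.getD 0)).set r' (l[r']?.getD 0) = l := by simp [hr, hr']
  simp only [List.getD_eq_getElem?_getD, Nat.sub_zero, Nat.add_zero, he, Nat.sub_self] at this
  simpa [Nat.add_comm, Prog.move] using this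

/-- A program acts in the same way on counters that are shifted by the length of `p`. -/
theorem shift {l l' : List ℕ} (h : PExec V P (regList l) (regList l')) (p : List ℕ) :
    PExec V (P.map (· + p.length)) (regList (p ++ l)) (regList (p ++ l')) := by
  intro tape i o
  obtain ⟨t', h', h1, h2, h3, h4⟩ := (h tape i o).map (· + p.length) Set.univ (Set.subset_univ _)
    (fun a _ b _ hab => Nat.add_right_cancel hab) ⟨regList (p ++ l), i, o⟩
    (by intro r _; simp [regList, List.getElem?_append_right]) rfl rfl
  have : t' = ⟨regList (p ++ l'), i, o⟩ := by
    ext r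
    · by_cases hr : p.length ≤ r
      · obtain ⟨q, rfl⟩ := Nat.exists_eq_add_of_le' hr
        simpa [regList, List.getElem?_append_right] using h1 q trivial
      · rw [h4 r (by rintro ⟨q, _, rfl⟩; simp at hr)]
        simp only [regList]
        rw [List.getD_append _ _ _ _ (by omega), List.getD_append _ _ _ _ (by omega)]
    · exact h2
    · rw [h3]
  rwa [this] at h'

end PExec

/-! #### Cantor pairing -/

/-- Triangular numbers. -/
def tri : ℕ → ℕ
  | 0 => 0
  | n + 1 => tri n + (n + 1)

/-- The Cantor pairing function. -/
def cpair (a b : ℕ) : ℕ := tri (a + b) + a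

/-- The successor of a pair in the enumeration by Cantor pairing. -/
def nextPair : ℕ × ℕ → ℕ × ℕ
  | (a, 0) => (0, a + 1)
  | (a, b + 1) => (a + 1, b)

/-- The inverse of Cantor pairing. -/
def unpr (n : ℕ) : ℕ × ℕ := nextPair^[n] (0, 0)

/-- `nextPair` walks along an antidiagonal with increasing first coordinate and then jumps to the
start of the next one. This makes `unpr`, an iteration of `nextPair`, a right inverse of pairing. -/
theorem cpair_nextPair (p : ℕ × ℕ) : cpair (nextPair p).1 (nextPair p).2 = cpair p.1 p.2 + 1 := by
  obtain ⟨a, _ | b⟩ := p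
  · simp [nextPair, cpair, tri]; omega
  · simp [nextPair, cpair, tri, show a + 1 + b = a + (b + 1) by omega]; omega

theorem cpair_unpr (n : ℕ) : cpair (unpr n).1 (unpr n).2 = n := by
  induction n with
  | zero => simp [unpr, cpair, tri]
  | succ n ih =>
    unfold unpr at *
    rw [Function.iterate_succ_apply', cpair_nextPair, ih]

theorem tri_mono : Monotone tri := monotone_nat_of_le_succ fun n => by simp [tri]

theorem tri_strict {a b : ℕ} (h : a < b) : tri a + a < tri b := by
  have : tri (a + 1) ≤ tri b := tri_mono h
  simp only [tri] at this
  omega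

theorem cpair_inj {a b a' b' : ℕ} (h : cpair a b = cpair a' b') : a = a' ∧ b = b' := by
  unfold cpair at h
  rcases lt_trichotomy (a + b) (a' + b') with h1 | h1 | h1
  · have := tri_strict h1; omega
  · rw [h1] at h; omega
  · have := tri_strict h1; omega

theorem unpr_cpair (a b : ℕ) : unpr (cpair a b) = (a, b) :=
  Prod.ext_iff.mpr (cpair_inj (cpair_unpr (cpair a b)))

theorem cpair_mono {a b a' b' : ℕ} (h1 : a ≤ a') (h2 : b ≤ b') : cpair a b ≤ cpair a' b' :=
  Nat.add_le_add (tri_mono (by omega)) h1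

theorem tri_le (n : ℕ) : tri n ≤ n * n := by
  induction n with
  | zero => simp [tri]
  | succ n ih => simp only [tri]; nlinarith

theorem cpair_le (a b : ℕ) : cpair a b ≤ (a + b + 1) ^ 2 := by
  have := tri_le (a + b)
  unfold cpair
  nlinarith

theorem left_le_cpair (a b : ℕ) : a ≤ cpair a b := by unfold cpair; omega

theorem le_tri (n : ℕ) : n ≤ tri n := by
  cases n with
  | zero => simp
  | succ n => simp only [tri]; omega

theorem right_le_cpair (a b : ℕ) : b ≤ cpair a b := by
  have := le_tri (a + b)
  unfold cpair; omega

theorem unpr_le (n : ℕ) : (unpr n).1 ≤ n ∧ (unpr n).2 ≤ n := by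
  have h1 := left_le_cpair (unpr n).1 (unpr n).2
  have h2 := right_le_cpair (unpr n).1 (unpr n).2
  rw [cpair_unpr] at h1 h2
  exact ⟨h1, h2⟩

namespace Prog

/-- Replace the counters `0` and `1` by their Cantor pairing. -/
def cpair : Prog A B ℕ :=
  .seq (.move 1 2) (.seq (.loop 0 (.seq (.inc 3) (.inc 2)))
    (.seq (.loop 2 (.seq (.inc 3) (.seq (.loop 2 (.seq (.inc 3) (.inc 4))) (.move 4 2))))
      (.move 3 0)))

/-- Replace the counter `0` by the pair it codes. -/
def unpair : Prog A B ℕ :=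
  .seq (.loop 0 (.branch 2 (.seq (.move 1 2) (.inc 2)) (.inc 1)))
    (.seq (.move 1 0) (.move 2 1))

end Prog

theorem regList_zero1 (a : ℕ) : regList [a, 0] = regList [a] := regList_append_zero [a]
theorem regList_zero2 (a b : ℕ) : regList [a, b, 0] = regList [a, b] := regList_append_zero [a, b]
theorem regList_zero3 (a b c : ℕ) : regList [a, b, c, 0] = regList [a, b, c] :=
  regList_append_zero [a, b, c]
theorem regList_zero4 (a b c d : ℕ) : regList [a, b, c, d, 0] = regList [a, b, c, d] :=
  regList_append_zero [a, b, c, d]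

theorem pexec_cpair {V a b : ℕ} (h : cpair a b ≤ V) :
    PExec V (.cpair : Prog A B ℕ) (regList [a, b]) (regList [cpair a b]) := by
  have hs : a + b ≤ V := (le_tri _).trans ((Nat.le_add_right _ a).trans h)
  rw [← regList_zero2, ← regList_zero3, ← regList_zero4]
  refine (PExec.move (by simp) (by simp) (by simp) (by simp; omega)).seq ?_
  simp only [List.set_cons_succ, List.set_cons_zero, List.getD_cons_succ, List.getD_cons_zero,
    add_zero]
  have h1 : PExec V (.loop 0 (.seq (.inc 3) (.inc 2)) : Prog A B ℕ) (regList [a, 0, b, 0, 0])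
      (regList [0, 0, a + b, a, 0]) := by
    have := PExec.loop (A := A) (B := B) (V := V) (r := 0) (n := a)
      (P := .seq (.inc 3) (.inc 2)) (fun i => [a - i, 0, b + i, i, 0]) (by simp) (by simp)
      (by
        intro i hi
        exact (PExec.inc (by simp) (by simp; omega)).seq (PExec.inc (by simp) (by simp; omega)))
    simpa [Nat.add_comm] using this
  refine h1.seq ?_
  -- A round that starts with `m + 1` in counter `2` adds `m + 1` to counter `3`, namely `1` for the
  -- decrement and `m` in the inner loop, and restores `m` from the copy in counter `4`. All rounds
  -- together add `tri (a + b)`.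
  have h2 : PExec V (.loop 2 (.seq (.inc 3) (.seq (.loop 2 (.seq (.inc 3) (.inc 4))) (.move 4 2)))
      : Prog A B ℕ) (regList [0, 0, a + b, a, 0]) (regList [0, 0, 0, cpair a b, 0]) := by
    have := PExec.loop (A := A) (B := B) (V := V) (r := 2) (n := a + b)
      (P := .seq (.inc 3) (.seq (.loop 2 (.seq (.inc 3) (.inc 4))) (.move 4 2)))
      (fun i => [0, 0, a + b - i, a + (tri (a + b) - tri (a + b - i)), 0]) (by simp) (by simp)
      (by
        intro i hi
        obtain ⟨m, hm⟩ : ∃ m, a + b - i = m + 1 := ⟨a + b - i - 1, by omega⟩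
        have hm' : a + b - (i + 1) = m := by omega
        have htm : tri (m + 1) ≤ tri (a + b) := tri_mono (by omega)
        have ht : tri (m + 1) = tri m + (m + 1) := rfl
        have hV : tri (a + b) + a ≤ V := h
        simp only [hm, hm', Nat.add_sub_cancel, List.set_cons_succ, List.set_cons_zero]
        refine (PExec.inc (by simp) (by simp; omega)).seq ?_
        simp only [List.set_cons_succ, List.set_cons_zero, List.getD_cons_succ,
          List.getD_cons_zero]
        have h3 := PExec.loop (A := A) (B := B) (V := V) (r := 2) (n := m)
          (P := .seq (.inc 3) (.inc 4))
          (fun j => [0, 0, m - j, a + (tri (a + b) - tri (m + 1)) + 1 + j, j]) (by simp) (by simp)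
          (by
            intro j hj
            exact (PExec.inc (by simp) (by simp; omega)).seq
              (PExec.inc (by simp) (by simp; omega)))
        simp only [Nat.sub_zero, add_zero, Nat.sub_self] at h3
        refine h3.seq ?_
        have h4 := PExec.move (A := A) (B := B) (V := V) (r := 4) (r' := 2)
          (l := [0, 0, 0, a + (tri (a + b) - tri (m + 1)) + 1 + m, m]) (by simp) (by simp)
          (by simp) (by simp; omega)
        simp only [List.set_cons_succ, List.set_cons_zero, List.getD_cons_succ,
          List.getD_cons_zero, add_zero] at h4
        have he : a + (tri (a + b) - tri (m + 1)) + 1 + m = a + (tri (a + b) - tri m) := by omega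
        rw [he] at h4 ⊢
        exact h4)
    simpa [cpair, tri, Nat.add_comm] using this
  refine h2.seq ?_
  have h5 := PExec.move (A := A) (B := B) (V := V) (r := 3) (r' := 0)
    (l := [0, 0, 0, cpair a b, 0]) (by simp) (by simp) (by simp) (by simpa using h)
  simpa [regList_zero1, regList_zero2, regList_zero3, regList_zero4] using h5

/-- The program performs `nextPair` as often as the code says. After `i` rounds both coordinates are
at most `i`, so no counter exceeds the code. -/
theorem pexec_unpair {V n : ℕ} (h : n ≤ V) : PExec V (.unpair : Prog A B ℕ) (regList [n])
    (regList [(unpr n).1, (unpr n).2]) := by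
  have hle : ∀ i ≤ n, cpair (unpr i).1 (unpr i).2 ≤ V := fun i hi => by
    rw [cpair_unpr]; omega
  have h1 : PExec V (.loop 0 (.branch 2 (.seq (.move 1 2) (.inc 2)) (.inc 1)) : Prog A B ℕ)
      (regList [n, 0, 0]) (regList [0, (unpr n).1, (unpr n).2]) := by
    have := PExec.loop (A := A) (B := B) (V := V) (r := 0) (n := n)
      (P := .branch 2 (.seq (.move 1 2) (.inc 2)) (.inc 1))
      (fun i => [n - i, (unpr i).1, (unpr i).2]) (by simp) (by simp)
      (by
        intro i hi
        have hb := hle (i + 1) (by omega)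
        have h1 := left_le_cpair (unpr (i + 1)).1 (unpr (i + 1)).2
        have h2 := right_le_cpair (unpr (i + 1)).1 (unpr (i + 1)).2
        have hu : unpr (i + 1) = nextPair (unpr i) := Function.iterate_succ_apply' _ _ _
        rw [hu] at hb h1 h2 ⊢
        rw [show n - i - 1 = n - (i + 1) by omega]
        rcases hab : unpr i with ⟨a, _ | b⟩
        · simp only [hab, nextPair] at hb h1 h2 ⊢
          refine PExec.branchZ (by simp) ?_
          exact (PExec.move (by simp) (by simp) (by simp) (by simp; omega)).seq
            (PExec.inc (by simp) (by simp; omega))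
        · simp only [hab, nextPair] at hb h1 h2 ⊢
          exact PExec.branchP (k := b) (by simp) (by simp) (PExec.inc (by simp) (by simp; omega)))
    simpa [unpr] using this
  rw [← regList_zero1, ← regList_zero2]
  refine h1.seq ?_
  have hb := unpr_le n
  refine (PExec.move (by simp) (by simp) (by simp) (by simp; omega)).seq ?_
  have h5 := PExec.move (A := A) (B := B) (V := V) (r := 2) (r' := 1)
    (l := [(unpr n).1, 0, (unpr n).2]) (by simp) (by simp) (by simp) (by simp; omega)
  simpa [regList_zero2] using h5

end SpaceTM

namespace SpaceTM

/-! ### Functions computable in linear space -/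

/-- Numerical functions computed by a counter program whose counters are polynomially bounded. -/
def LS (f : ℕ → ℕ) : Prop :=
  ∃ c : ℕ, (∀ x, f x ≤ (x + 2) ^ c) ∧ ∀ A B : Type, ∃ P : Prog A B ℕ,
    ∀ x V, (x + 2) ^ c ≤ V → PExec V P (regList [x]) (regList [f x])

theorem pow_add_two_le (x c : ℕ) : (x + 2) ^ c + 2 ≤ (x + 2) ^ (c + 2) := by
  have h1 : 1 ≤ (x + 2) ^ c := Nat.one_le_pow _ _ (by omega)
  have h2 : 4 ≤ (x + 2) ^ 2 := by rw [sq]; nlinarith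
  rw [pow_add]
  nlinarith

theorem pow_pow_le (x c d : ℕ) {y : ℕ} (hy : y ≤ (x + 2) ^ c) :
    (y + 2) ^ d ≤ (x + 2) ^ ((c + 2) * d) := by
  rw [pow_mul]
  exact Nat.pow_le_pow_left ((Nat.add_le_add_right hy 2).trans (pow_add_two_le x c)) d

theorem pow_add_two_mono (x : ℕ) {c d : ℕ} (h : c ≤ d) : (x + 2) ^ c ≤ (x + 2) ^ d :=
  Nat.pow_le_pow_right (by omega) h

theorem le_pow_add_two (x : ℕ) {c : ℕ} (h : 1 ≤ c) : x + 2 ≤ (x + 2) ^ c := by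
  simpa using pow_add_two_mono x h

theorem cpair_le_pow (x c : ℕ) {a b : ℕ} (ha : a ≤ (x + 2) ^ c) (hb : b ≤ (x + 2) ^ c) :
    cpair a b ≤ (x + 2) ^ ((c + 2) * 2) := by
  refine (cpair_le _ _).trans ?_
  rw [pow_mul]
  refine Nat.pow_le_pow_left ?_ 2
  have h1 : 1 ≤ (x + 2) ^ c := Nat.one_le_pow _ _ (by omega)
  have h2 : 4 ≤ (x + 2) ^ 2 := by rw [sq]; nlinarith
  rw [pow_add]
  nlinarith

namespace LS

theorem id : LS fun x => x :=
  ⟨1, by simp, fun _ _ => ⟨.skip, fun _ _ _ => .skip⟩⟩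

theorem zero : LS fun _ => 0 := by
  refine ⟨1, by simp, fun A B => ⟨.clear 0, fun x V _ => ?_⟩⟩
  simpa [regList_zero1] using PExec.clear (A := A) (B := B) (V := V) (l := [x]) (r := 0) (by simp)

theorem succ : LS Nat.succ := by
  refine ⟨1, by simp, fun A B => ⟨.inc 0, fun x V h => ?_⟩⟩
  exact PExec.inc (A := A) (B := B) (l := [x]) (r := 0) (by simp) (by simp at h ⊢; omega)

theorem comp {f g : ℕ → ℕ} (hf : LS f) (hg : LS g) : LS fun x => f (g x) := by
  obtain ⟨c, hc, hf⟩ := hf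
  obtain ⟨d, hd, hg⟩ := hg
  have key : ∀ x, (g x + 2) ^ c ≤ (x + 2) ^ (d + (d + 2) * c) := fun x =>
    (pow_pow_le x d c (hd x)).trans (pow_add_two_mono x (by omega))
  refine ⟨d + (d + 2) * c, fun x => (hc _).trans (key x), fun A B => ?_⟩
  obtain ⟨P, hP⟩ := hf A B
  obtain ⟨Q, hQ⟩ := hg A B
  exact ⟨.seq Q P, fun x V h => (hQ x V ((pow_add_two_mono x (by omega)).trans h)).seq
    (hP _ V ((key x).trans h))⟩

theorem const (n : ℕ) : LS fun _ => n := by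
  induction n with
  | zero => exact zero
  | succ n ih => exact succ.comp ih

theorem fst : LS fun x => (unpr x).1 := by
  refine ⟨1, fun x => by have := unpr_le x; simp; omega, fun A B =>
    ⟨.seq .unpair (.clear 1), fun x V h => (pexec_unpair (by simp at h; omega)).seq ?_⟩⟩
  simpa [regList_zero1] using
    PExec.clear (A := A) (B := B) (V := V) (l := [(unpr x).1, (unpr x).2]) (r := 1) (by simp)

theorem snd : LS fun x => (unpr x).2 := by
  refine ⟨1, fun x => by have := unpr_le x; simp; omega, fun A B =>
    ⟨.seq .unpair (.seq (.clear 0) (.move 1 0)), fun x V h =>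
      (pexec_unpair (by simp at h; omega)).seq (PExec.seq (PExec.clear (by simp)) ?_)⟩⟩
  have hx := unpr_le x
  simpa [regList_zero1] using
    PExec.move (A := A) (B := B) (V := V) (l := [0, (unpr x).2]) (r := 1) (r' := 0) (by simp)
      (by simp) (by simp) (by simp at h ⊢; omega)

theorem pair {f g : ℕ → ℕ} (hf : LS f) (hg : LS g) : LS fun x => cpair (f x) (g x) := by
  obtain ⟨c, hc, hf⟩ := hf
  obtain ⟨d, hd, hg⟩ := hg
  have hle : ∀ x, cpair (f x) (g x) ≤ (x + 2) ^ ((c + d + 2) * 2) := fun x =>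
    cpair_le_pow x (c + d) ((hc x).trans (pow_add_two_mono x (by omega)))
      ((hd x).trans (pow_add_two_mono x (by omega)))
  refine ⟨(c + d + 2) * 2, hle, fun A B => ?_⟩
  obtain ⟨P, hP⟩ := hf A B
  obtain ⟨Q, hQ⟩ := hg A B
  -- Two copies of `x` are made in counters `1` and `2`. The first program works on the upper copy,
  -- its result is parked in counter `0`, and the second program then works on the remaining copy.
  refine ⟨.seq (.loop 0 (.seq (.inc 1) (.inc 2))) (.seq (P.map (· + 2)) (.seq (.move 2 0)
    (.seq (Q.map (· + 1)) .cpair))), fun x V h => ?_⟩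
  have hx : x + 2 ≤ V := (le_pow_add_two x (by omega)).trans h
  have hf : f x ≤ V := ((hc x).trans (pow_add_two_mono x (by omega))).trans h
  have h1 : PExec V (.loop 0 (.seq (.inc 1) (.inc 2)) : Prog A B ℕ) (regList [x])
      (regList [0, x, x]) := by
    have := PExec.loop (A := A) (B := B) (V := V) (r := 0) (n := x)
      (P := .seq (.inc 1) (.inc 2)) (fun i => [x - i, i, i]) (by simp) (by simp)
      (by
        intro i hi
        exact (PExec.inc (by simp) (by simp; omega)).seq (PExec.inc (by simp) (by simp; omega)))
    simpa [regList_zero1, regList_zero2] using this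
  refine h1.seq (((hP x V ((pow_add_two_mono x (by omega)).trans h)).shift [0, x]).seq ?_)
  refine (PExec.move (l := [0, x, f x]) (by simp) (by simp) (by simp) (by simpa using hf)).seq ?_
  have h2 := (hQ x V ((pow_add_two_mono x (by omega)).trans h)).shift [f x]
  simp only [List.cons_append, List.nil_append, List.set_cons_succ, List.set_cons_zero,
    List.getD_cons_succ, List.getD_cons_zero, add_zero, regList_zero2] at h2 ⊢
  exact h2.seq (pexec_cpair ((hle x).trans h))

/-- Iteration with a polynomial bound on the intermediate values. -/
theorem iterate {step : ℕ → ℕ} (hs : LS step) {c : ℕ}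
    (hc : ∀ z, ∀ i ≤ (unpr z).1, step^[i] (unpr z).2 ≤ (z + 2) ^ c) :
    LS fun z => step^[(unpr z).1] (unpr z).2 := by
  obtain ⟨d, hd, hs⟩ := hs
  refine ⟨c + (c + 2) * d + 1, fun z => (hc z _ le_rfl).trans (pow_add_two_mono z (by omega)),
    fun A B => ?_⟩
  obtain ⟨P, hP⟩ := hs A B
  refine ⟨.seq .unpair (.seq (.loop 0 (P.map (· + 1))) (.move 1 0)), fun z V h => ?_⟩
  have hz := (le_pow_add_two z (show 1 ≤ c + (c + 2) * d + 1 by omega)).trans h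
  refine (pexec_unpair (by omega)).seq ?_
  have h1 := PExec.loop (A := A) (B := B) (V := V) (r := 0) (n := (unpr z).1)
    (P := P.map (· + 1)) (fun i => [(unpr z).1 - i, step^[i] (unpr z).2]) (by simp) (by simp)
    (by
      intro i hi
      have := (hP (step^[i] (unpr z).2) V (((pow_pow_le z c d (hc z i hi.le)).trans
        (pow_add_two_mono z (by omega))).trans h)).shift [(unpr z).1 - i - 1]
      rw [Function.iterate_succ_apply']
      simpa [Nat.sub_sub] using this)
  simp only [Nat.sub_zero, Nat.sub_self, Function.iterate_zero] at h1
  refine h1.seq ?_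
  simpa [regList_zero1] using PExec.move (A := A) (B := B) (V := V)
    (l := [0, step^[(unpr z).1] (unpr z).2]) (r := 1) (r' := 0) (by simp) (by simp) (by simp)
    (by simpa using ((hc z _ le_rfl).trans (pow_add_two_mono z (by omega))).trans h)

/-- Starting with `(0, 0)`, the map `(u, v) ↦ (v, v + 1)` iterated `x` times leaves the predecessor
of `x` in the first component. -/
theorem pred : LS Nat.pred := by
  have hstep : LS fun w => cpair (unpr w).2 ((unpr w).2 + 1) := snd.pair (succ.comp snd)
  have hit : ∀ i u v, (fun w => cpair (unpr w).2 ((unpr w).2 + 1))^[i] (cpair u v) =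
      cpair (if i = 0 then u else v + i - 1) (v + i) := by
    intro i u v
    induction i with
    | zero => simp
    | succ i ih => rw [Function.iterate_succ_apply', ih, unpr_cpair]; simp [Nat.add_assoc]
  have h := (hstep.iterate (c := 8) (by
    intro z i hi
    have h1 := unpr_le z
    have h2 := unpr_le (unpr z).2
    have hsq : z + z ≤ (z + 2) ^ 2 := by nlinarith
    rw [← cpair_unpr (unpr z).2, hit]
    refine cpair_le_pow z 2 ?_ ?_
    · split_ifs <;> omega
    · omega)).comp (id.pair zero)
  have := fst.comp h
  convert this using 2 with x
  rw [unpr_cpair, show (0 : ℕ) = cpair 0 0 from rfl, hit, unpr_cpair]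
  simp only [Nat.pred_eq_sub_one]
  split_ifs with hx <;> omega

theorem sub {f g : ℕ → ℕ} (hf : LS f) (hg : LS g) : LS fun x => f x - g x := by
  have h := (pred.iterate (c := 1) (by
    intro z i _
    have h1 := unpr_le z
    rw [Nat.pred_iterate]
    simp only [pow_one]
    omega)).comp (hg.pair hf)
  convert h using 2 with x
  rw [unpr_cpair, Nat.pred_iterate]

theorem min {f g : ℕ → ℕ} (hf : LS f) (hg : LS g) : LS fun x => min (f x) (g x) := by
  convert hf.sub (hf.sub hg) using 2 with x
  omega

end LS

/-! #### Functions between types of tuples -/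

/-- Numerical codes. -/
class Enc (α : Type) where
  enc : α → ℕ
  inj : Function.Injective enc

instance : Enc ℕ := ⟨fun n => n, fun _ _ h => h⟩

instance {α β : Type} [Enc α] [Enc β] : Enc (α × β) :=
  ⟨fun p => cpair (Enc.enc p.1) (Enc.enc p.2), fun p q h => by
    obtain ⟨h1, h2⟩ := cpair_inj h
    exact Prod.ext (Enc.inj h1) (Enc.inj h2)⟩

/-- A code for the elements of a finite type. -/
@[reducible]
noncomputable def encOfFinite (α : Type) [Finite α] : Enc α :=
  ⟨fun a => Finite.equivFin α a, fun _ _ h => (Finite.equivFin α).injective (Fin.ext h)⟩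

open Enc in
/-- Functions that are computable in linear space on codes. -/
def LSp {α β : Type} [Enc α] [Enc β] (f : α → β) : Prop :=
  ∃ g, LS g ∧ ∀ a, g (enc a) = enc (f a)

namespace LSp

open Enc

variable {α β γ δ : Type} [Enc α] [Enc β] [Enc γ] [Enc δ]

theorem of_LS {f : ℕ → ℕ} (h : LS f) : LSp f := ⟨f, h, fun _ => rfl⟩

theorem id : LSp fun a : α => a := ⟨_, LS.id, fun _ => rfl⟩

theorem const (b : β) : LSp fun _ : α => b := ⟨_, LS.const (enc b), fun _ => rfl⟩

theorem comp {f : β → γ} {g : α → β} (hf : LSp f) (hg : LSp g) : LSp fun a => f (g a) := by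
  obtain ⟨f', hf', hf⟩ := hf
  obtain ⟨g', hg', hg⟩ := hg
  exact ⟨_, hf'.comp hg', fun a => by rw [hg, hf]⟩

theorem fst {f : γ → α × β} (hf : LSp f) : LSp fun x => (f x).1 := by
  refine comp (f := Prod.fst) ⟨_, LS.fst, fun p => ?_⟩ hf
  simp [enc, unpr_cpair]

theorem snd {f : γ → α × β} (hf : LSp f) : LSp fun x => (f x).2 := by
  refine comp (f := Prod.snd) ⟨_, LS.snd, fun p => ?_⟩ hf
  simp [enc, unpr_cpair]

theorem mk {f : γ → α} {g : γ → β} (hf : LSp f) (hg : LSp g) : LSp fun x => (f x, g x) := by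
  obtain ⟨f', hf', hf⟩ := hf
  obtain ⟨g', hg', hg⟩ := hg
  exact ⟨_, hf'.pair hg', fun a => by simp [enc, hf, hg]⟩

theorem enc {f : γ → α} (hf : LSp f) : LSp fun x => Enc.enc (f x) := by
  obtain ⟨f', hf', hf⟩ := hf
  exact ⟨f', hf', hf⟩

theorem sub {f g : γ → ℕ} (hf : LSp f) (hg : LSp g) : LSp fun x => f x - g x := by
  obtain ⟨f', hf', hf⟩ := hf
  obtain ⟨g', hg', hg⟩ := hg
  exact ⟨_, hf'.sub hg', fun a => by rw [hf, hg]; rfl⟩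

theorem succ {f : γ → ℕ} (hf : LSp f) : LSp fun x => f x + 1 := comp (of_LS LS.succ) hf

/-- Iteration with a bound that is computable in linear space. -/
theorem iterate {step : γ → α → α} (hs : LSp fun p : γ × α => step p.1 p.2) {n : γ → ℕ}
    (hn : LSp n) {x : γ → α} (hx : LSp x) {bd : γ → ℕ} (hbd : LSp bd)
    (h : ∀ y, ∀ i ≤ n y, Enc.enc ((step y)^[i] (x y)) ≤ bd y) :
    LSp fun y => (step y)^[n y] (x y) := by
  obtain ⟨s', hs', hs⟩ := hs
  obtain ⟨n', hn', hn⟩ := hn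
  obtain ⟨x', hx', hx⟩ := hx
  obtain ⟨b', hb', hb⟩ := hbd
  -- On numbers that are not codes of intended arguments nothing is known about `s'`, whereas
  -- `LS.iterate` needs a bound for all arguments. The minimum with the bound supplies it; by `h` it
  -- has no effect on the intended arguments.
  have hS : LS fun w => cpair (unpr w).1 (min (s' w) (b' (unpr w).1)) :=
    LS.fst.pair (hs'.min (hb'.comp LS.fst))
  obtain ⟨d, hd, _⟩ := hb'
  have hbound : ∀ z, ∀ i ≤ (unpr z).1,
      (fun w => cpair (unpr w).1 (min (s' w) (b' (unpr w).1)))^[i] (unpr z).2 ≤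
        (z + 2) ^ ((d + 1 + 2) * 2) := by
    intro z i _
    have h1 := unpr_le z
    have key : ∀ i, ∃ v ≤ (z + 2) ^ (d + 1),
        (fun w => cpair (unpr w).1 (min (s' w) (b' (unpr w).1)))^[i] (unpr z).2 =
          cpair (unpr (unpr z).2).1 v := by
      have h2 := unpr_le (unpr z).2
      intro i
      induction i with
      | zero => exact ⟨(unpr (unpr z).2).2,
          by have := le_pow_add_two z (show 1 ≤ d + 1 by omega); omega, by simp [cpair_unpr]⟩
      | succ i ih =>
        obtain ⟨v, hv, he⟩ := ih
        rw [Function.iterate_succ_apply', he]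
        refine ⟨_, (min_le_right _ _).trans ((hd _).trans ?_), by rw [unpr_cpair]⟩
        exact (Nat.pow_le_pow_left (by simp only; omega) _).trans
          (pow_add_two_mono z (Nat.le_succ d))
    obtain ⟨v, hv, he⟩ := key i
    rw [he]
    refine cpair_le_pow z (d + 1) ?_ hv
    have h2 := unpr_le (unpr z).2
    have := le_pow_add_two z (show 1 ≤ d + 1 by omega)
    omega
  have hit : ∀ y, ∀ i ≤ n y,
      (fun w => cpair (unpr w).1 (min (s' w) (b' (unpr w).1)))^[i]
        (cpair (Enc.enc y) (Enc.enc (x y))) =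
      cpair (Enc.enc y) (Enc.enc ((step y)^[i] (x y))) := by
    intro y i
    induction i with
    | zero => simp
    | succ i ih =>
      intro hi
      have hb1 := h y (i + 1) hi
      rw [Function.iterate_succ_apply'] at hb1
      rw [Function.iterate_succ_apply', ih (by omega), Function.iterate_succ_apply']
      simp only [unpr_cpair]
      have := hs (y, (step y)^[i] (x y))
      simp only [Enc.enc] at this hb
      rw [this, hb, min_eq_left hb1]
  refine ⟨_, LS.snd.comp ((hS.iterate hbound).comp (hn'.pair (LS.id.pair hx'))), fun y => ?_⟩
  simp only [unpr_cpair]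
  rw [hn, hx]
  exact (congrArg (fun w => (unpr w).2) (hit y (n y) le_rfl)).trans (by rw [unpr_cpair])

end LSp

end SpaceTM

/-! ### Arithmetic, division and case distinction in linear space. -/

namespace SpaceTM

theorem add_le_cpair (a b : ℕ) : a + b ≤ cpair a b :=
  (le_tri _).trans (Nat.le_add_right _ _)

theorem two_mul_tri (n : ℕ) : 2 * tri n = n * (n + 1) := by
  induction n with
  | zero => simp [tri]
  | succ n ih => simp only [tri]; nlinarith

/-- The code of the pair of factors can thus serve as the bound that `iterate` requires for repeated
addition. -/
theorem mul_le_cpair (a b : ℕ) : a * b ≤ cpair a b := by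
  have := two_mul_tri (a + b)
  unfold cpair
  nlinarith [sq_nonneg a, sq_nonneg b]

namespace LSp

open Enc

variable {α β γ δ : Type} [Enc α] [Enc β] [Enc γ] [Enc δ]

theorem add {f g : γ → ℕ} (hf : LSp f) (hg : LSp g) : LSp fun x => f x + g x := by
  have := iterate (step := fun _ a => a + 1) (succ (snd id)) hg hf (mk hf hg).enc
    (fun y i hi => by
      have := add_le_cpair (f y) (g y)
      simp only [← Nat.succ_eq_add_one, Nat.succ_iterate]
      simp only [Enc.enc]
      omega)
  simpa only [← Nat.succ_eq_add_one, Nat.succ_iterate] using this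

theorem add_const_iterate (a : ℕ) (n x : ℕ) : (fun y => y + a)^[n] x = x + n * a := by
  induction n with
  | zero => simp
  | succ n ih => rw [Function.iterate_succ_apply', ih]; ring

theorem mul {f g : γ → ℕ} (hf : LSp f) (hg : LSp g) : LSp fun x => f x * g x := by
  have := iterate (step := fun y a => a + f y) (add (snd id) (hf.comp (fst id))) hg
    (const 0) (mk hf hg).enc
    (fun y i hi => by
      have h1 := mul_le_cpair (f y) (g y)
      rw [add_const_iterate]
      simp only [Enc.enc]
      nlinarith)
  convert this using 2 with x
  rw [add_const_iterate]
  ring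

/-- A conditional is an iteration: applying `p ↦ (p.2, p.2)` to `(a, b)` no times leaves `a` in
front, and any positive number of times leaves `b`. -/
theorem ite_zero {c : γ → ℕ} {a b : γ → α} (hc : LSp c) (ha : LSp a) (hb : LSp b) :
    LSp fun x => if c x = 0 then a x else b x := by
  have hit : ∀ (p : α × α) n, (fun p : α × α => (p.2, p.2))^[n] p =
      if n = 0 then p else (p.2, p.2) := by
    intro p n
    induction n with
    | zero => simp
    | succ n ih => rw [Function.iterate_succ_apply', ih]; split_ifs <;> simp_all
  have := iterate (step := fun (_ : γ) (p : α × α) => (p.2, p.2))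
    (mk (snd (snd id)) (snd (snd id))) hc (mk ha hb)
    (add (mk ha hb).enc (mk hb hb).enc)
    (fun y i hi => by
      rw [hit]
      split_ifs <;> simp)
  convert fst this using 2 with x
  rw [hit]
  split_ifs <;> simp

theorem ite_le {f g : γ → ℕ} {a b : γ → α} (hf : LSp f) (hg : LSp g) (ha : LSp a) (hb : LSp b) :
    LSp fun x => if f x ≤ g x then a x else b x := by
  convert ite_zero (hf.sub hg) ha hb using 3 with x
  omega

theorem ite_eq {f g : γ → ℕ} {a b : γ → α} (hf : LSp f) (hg : LSp g) (ha : LSp a) (hb : LSp b) :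
    LSp fun x => if f x = g x then a x else b x := by
  convert ite_zero ((hf.sub hg).add (hg.sub hf)) ha hb using 3 with x
  omega

/-- Quotient and remainder are found by counting up to `f x` with a remainder that is reset whenever
it reaches the divisor. For the divisor `0` it is never reset, in agreement with `n / 0 = 0` and `n
% 0 = n`. -/
theorem divMod {f g : γ → ℕ} (hf : LSp f) (hg : LSp g) : LSp fun x => (f x / g x, f x % g x) := by
  have hit : ∀ d n, (fun p : ℕ × ℕ => if p.2 + 1 = d then (p.1 + 1, 0) else (p.1, p.2 + 1))^[n]
      (0, 0) = (n / d, n % d) := by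
    intro d n
    induction n with
    | zero => simp
    | succ n ih =>
      rw [Function.iterate_succ_apply', ih]
      simp only
      rcases Nat.eq_zero_or_pos d with rfl | hd
      · simp
      · have h1 := Nat.div_add_mod n d
        have h2 := Nat.mod_lt n hd
        split_ifs with h
        · have h3 : n + 1 = d * (n / d + 1) := by rw [mul_add, mul_one]; omega
          rw [h3, Nat.mul_div_cancel_left _ hd, Nat.mul_mod_right]
        · have h3 : n + 1 = (n % d + 1) + d * (n / d) := by omega
          have h4 : n % d + 1 < d := by omega
          rw [h3, Nat.add_mul_div_left _ _ hd, Nat.add_mul_mod_self_left, Nat.mod_eq_of_lt h4,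
            Nat.div_eq_of_lt h4, zero_add]
  have := iterate (step := fun (y : γ) (p : ℕ × ℕ) =>
      if p.2 + 1 = g y then (p.1 + 1, 0) else (p.1, p.2 + 1))
    (ite_eq (succ (snd (snd id))) (hg.comp (fst id)) (mk (succ (fst (snd id))) (const 0))
      (mk (fst (snd id)) (succ (snd (snd id))))) hf (const (0, 0)) (mk hf hf).enc
    (fun y i hi => by
      rw [hit]
      exact cpair_mono ((Nat.div_le_self _ _).trans hi) ((Nat.mod_le _ _).trans hi))
  convert this using 2 with x
  rw [hit]

theorem div {f g : γ → ℕ} (hf : LSp f) (hg : LSp g) : LSp fun x => f x / g x :=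
  fst (divMod hf hg)

theorem mod {f g : γ → ℕ} (hf : LSp f) (hg : LSp g) : LSp fun x => f x % g x :=
  snd (divMod hf hg)

theorem min {f g : γ → ℕ} (hf : LSp f) (hg : LSp g) : LSp fun x => min (f x) (g x) := by
  simpa only [min_def] using ite_le hf hg hf hg

theorem pow {f : γ → ℕ} (hf : LSp f) (n : ℕ) : LSp fun x => f x ^ n := by
  induction n with
  | zero => simpa using const 1
  | succ n ih => simpa only [pow_succ] using ih.mul hf

/-- Definition by cases over a finite type. -/
theorem cases [Finite α] {f : α → γ → β} {g : γ → α} (hg : LSp g) (hf : ∀ a, LSp (f a)) :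
    LSp fun x => f (g x) x := by
  -- The finitely many cases are collected into one numerical function by induction on a finite set
  -- of codes, each new code adding one equality test.
  have key : ∀ s : Finset ℕ, ∃ h : ℕ × ℕ → ℕ, LSp h ∧
      ∀ a x, Enc.enc a ∈ s → h (Enc.enc (a : α), Enc.enc x) = Enc.enc (f a x) := by
    classical
    intro s
    induction s using Finset.induction_on with
    | empty => exact ⟨fun _ => 0, const 0, by simp⟩
    | insert n s _ ih =>
      obtain ⟨h, hh, hs⟩ := ih
      by_cases hn : ∃ a : α, Enc.enc a = n
      · obtain ⟨a₀, rfl⟩ := hn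
        obtain ⟨f', hf', hfa⟩ := hf a₀
        refine ⟨fun p => if p.1 = Enc.enc a₀ then f' p.2 else h p,
          ite_eq (fst id) (const _) ((of_LS hf').comp (snd id)) hh, fun a x ha => ?_⟩
        by_cases he : Enc.enc a = Enc.enc a₀
        · obtain rfl := Enc.inj he
          simp [hfa]
        · simp only [he, if_false]
          exact hs a x ((Finset.mem_insert.mp ha).resolve_left he)
      · refine ⟨h, hh, fun a x ha => hs a x ((Finset.mem_insert.mp ha).resolve_left ?_)⟩
        exact fun he => hn ⟨a, he⟩
  obtain ⟨h, ⟨h', hh', hh⟩, hs⟩ := key (Set.finite_range (Enc.enc : α → ℕ)).toFinset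
  obtain ⟨g', hg', hg⟩ := hg
  refine ⟨_, hh'.comp (hg'.pair LS.id), fun x => ?_⟩
  rw [hg]
  have := hh (Enc.enc (g x), Enc.enc x)
  rw [hs _ _ (by simp)] at this
  exact this

/-- Functions on a finite type. -/
theorem of_finite [Finite α] (f : α → β) : LSp f :=
  cases (f := fun a (_ : α) => f a) id fun a => const (f a)

end LSp

end SpaceTM

namespace SpaceTM

/-! ### Machines whose states are codes of tuples -/

/-- What a machine on codes does after a transition. -/
inductive Act (B : Type) : Type
  | cont
  | adv
  | halt
  | emit (b : B)

instance {B : Type} [Finite B] : Finite (Act B) :=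
  Finite.of_injective (β := Fin 3 ⊕ B)
    (fun a => match a with
      | .cont => .inl 0 | .adv => .inl 1 | .halt => .inl 2 | .emit b => .inr b)
    (by intro a b; cases a <;> cases b <;> simp)

instance {A : Type} [Finite A] : Finite (InputSym A) :=
  Finite.of_injective (β := Fin 3 ⊕ A)
    (fun a => match a with
      | .leftEnd => .inl 0 | .rightEnd => .inl 1 | .empty => .inl 2 | .letter b => .inr b)
    (by intro a b; cases a <;> cases b <;> simp)

noncomputable instance {A : Type} [Finite A] : Enc (InputSym A) := encOfFinite _

noncomputable instance {B : Type} [Finite B] : Enc (Act B) := encOfFinite _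

section

variable {A B X : Type}

/-- One transition of a machine on codes: state, position of the input head, and output. -/
inductive NMStep (step : X × InputSym A → X × Act B) (tape : List (InputSym A)) :
    X × ℕ × List B → X × ℕ × List B → Prop
  | cont {x i o x'} : step (x, symAt tape i) = (x', .cont) → NMStep step tape (x, i, o) (x', i, o)
  | adv {x i o x'} : step (x, symAt tape i) = (x', .adv) →
      NMStep step tape (x, i, o) (x', moveInput tape.length i .right, o)
  | emit {x i o x' b} : step (x, symAt tape i) = (x', .emit b) →
      NMStep step tape (x, i, o) (x', i, o ++ [b])

/-- Sequences of transitions through states with codes at most `V`. -/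
def NMReach [Enc X] (step : X × InputSym A → X × Act B) (tape : List (InputSym A)) (V : ℕ) :
    X × ℕ × List B → X × ℕ × List B → Prop :=
  Relation.ReflTransGen fun s s' => NMStep step tape s s' ∧ Enc.enc s.1 ≤ V ∧ Enc.enc s'.1 ≤ V

end

namespace Prog

variable {A B : Type}

/-- Add a constant to a counter. -/
def incN (r : ℕ) : ℕ → Prog A B ℕ
  | 0 => skip
  | n + 1 => seq (incN r n) (inc r)

/-- Add the minimum of `m` and the code of the symbol under the input head to a counter. -/
def readSym [Enc (InputSym A)] (r : ℕ) : ℕ → Prog A B ℕ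
  | 0 => skip
  | n + 1 => seq (readSym r n) (incIf (fun s => decide (n < Enc.enc s)) r)

/-- Emit the letter of the list whose index is in the counter `r`, and clear this counter. -/
def emitSel (r : ℕ) : List B → Prog A B ℕ
  | [] => skip
  | b :: l => branch r (emit b) (emitSel r l)

end Prog

section

variable {A B : Type} {V : ℕ}

theorem pexec_incN {l : List ℕ} {r : ℕ} (hr : r < l.length) :
    ∀ n, l.getD r 0 + n ≤ V →
      PExec V (.incN r n : Prog A B ℕ) (regList l) (regList (l.set r (l.getD r 0 + n))) := by
  intro n
  induction n with
  | zero =>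
    intro _
    simpa [hr, Prog.incN] using PExec.skip (A := A) (B := B) (V := V) (σ := regList l)
  | succ n ih =>
    intro h
    refine (ih (by omega)).seq ?_
    have := PExec.inc (A := A) (B := B) (V := V) (l := l.set r (l.getD r 0 + n)) (r := r)
      (by simpa using hr) (by simp [hr] at h ⊢; omega)
    simpa [hr, Nat.add_assoc] using this

theorem exec_readSym [Enc (InputSym A)] {tape : List (InputSym A)} {i : ℕ} {o : List B} {x : ℕ} :
    ∀ n, Enc.enc (symAt tape i) ≤ V → Exec tape V (.readSym 2 n) ⟨regList [0, x, 0], i, o⟩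
      ⟨regList [0, x, min n (Enc.enc (symAt tape i))], i, o⟩ := by
  intro n
  induction n with
  | zero => intro _; simpa [Prog.readSym] using PExec.skip (A := A) (B := B) (V := V) tape i o
  | succ n ih =>
    intro h
    refine (ih h).seq ?_
    by_cases hn : n < Enc.enc (symAt tape i)
    · have h1 : min (n + 1) (Enc.enc (symAt tape i)) = n + 1 := by omega
      have h2 : min n (Enc.enc (symAt tape i)) = n := by omega
      rw [h1, h2]
      have := Exec.incT (V := V) (tape := tape) (s := ⟨regList [0, x, n], i, o⟩)
        (p := fun s => decide (n < Enc.enc s)) (r := 2) (by simpa using hn)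
        (by simp [regList]; omega)
      simp only [update_regList [0, x, n] (show 2 < [0, x, n].length by simp)] at this
      simpa [regList] using this
    · have h1 : min (n + 1) (Enc.enc (symAt tape i)) = Enc.enc (symAt tape i) := by omega
      have h2 : min n (Enc.enc (symAt tape i)) = Enc.enc (symAt tape i) := by omega
      rw [h1, h2]
      exact .incF (by simpa using hn)

theorem exec_emitSel {tape : List (InputSym A)} {i : ℕ} {o : List B} {x : ℕ} {b : B} :
    ∀ (l : List B) (k : ℕ), l[k]? = some b →
      Exec tape V (.emitSel 2 l) ⟨regList [0, x, k], i, o⟩ ⟨regList [0, x, 0], i, o ++ [b]⟩ := by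
  intro l
  induction l with
  | nil => simp
  | cons c l ih =>
    intro k hk
    rcases k with _ | k
    · simp only [List.getElem?_cons_zero, Option.some.injEq] at hk
      subst hk
      exact .branchZ rfl .emit
    · refine .branchP (k := k) rfl ?_
      rw [update_regList [0, x, k + 1] (show 2 < [0, x, k + 1].length by simp)]
      exact ih k (by simpa using hk)

/-- The number by which the program of a machine on codes represents an action. -/
noncomputable def actNum [Finite B] : Act B → ℕ
  | .cont => 0
  | .adv => 1
  | .halt => 2
  | .emit b => 3 + Finite.equivFin B b

/-- A transition function in linear space yields a machine in space `O(log V)` if all states passed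
through have codes at most `V`. Counter `0` is the flag that keeps the main loop going, counter `1`
holds the code of the state, and counter `2` holds first the input symbol and then the number of the
action. -/
theorem exists_machine_of_step {X : Type} [Finite A] [Finite B] [Enc X]
    {step : X × InputSym A → X × Act B} (hstep : LSp step) (x₀ : X) :
    ∃ (Γ : Type) (_ : Finite Γ) (M : Machine A Γ B) (C : ℕ), M.IsOnline ∧
      ∀ (tape : List (InputSym A)) (V : ℕ) (x : X) (i : ℕ) (y : List B),
        NMReach step tape V (x₀, 0, []) (x, i, y) → Enc.enc x₀ ≤ V →
        (step (x, symAt tape i)).2 = .halt → M.HaltsWith tape y (C * (V.size + 1)) := by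
  obtain ⟨g, ⟨c, hc, hg⟩, hgs⟩ := LSp.mk (LSp.fst hstep)
    (LSp.comp (LSp.of_finite (actNum (B := B))) (LSp.snd hstep))
  obtain ⟨P, hP⟩ := hg A B
  obtain ⟨m, hm⟩ : ∃ m, ∀ s : InputSym A, Enc.enc s ≤ m := by
    obtain ⟨m, hm⟩ := (Set.finite_range (Enc.enc : InputSym A → ℕ)).bddAbove
    exact ⟨m, fun s => hm ⟨s, rfl⟩⟩
  let bl : List B := List.ofFn (Finite.equivFin B).symm
  let body : Prog A B ℕ := .seq (.readSym 2 m) (.seq (Prog.cpair.map (· + 1)) (.seq (P.map (· + 1))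
    (.seq (Prog.unpair.map (· + 1)) (.branch 2 (.inc 0) (.branch 2 (.seq .advance (.inc 0))
      (.branch 2 .skip (.seq (.emitSel 2 bl) (.inc 0))))))))
  obtain ⟨Γ, hΓ, M, hM, hrun⟩ := exists_machine_of_prog
    (.seq (.inc 0) (.seq (.incN 1 (Enc.enc x₀)) (.loop 0 body)))
  refine ⟨Γ, hΓ, M, (m + 2) * (2 * c + 2) + 3, hM, ?_⟩
  intro tape V x i y hreach hx₀ hhalt
  -- The code of the pair of state and symbol is below the square of `V + m + 3`, and the program
  -- for `g` raises this to the power `c`; the exponent `2 * c + 2` covers both.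
  obtain ⟨V', hV'⟩ : ∃ V', V' = (V + m + 3) ^ (2 * c + 2) := ⟨_, rfl⟩
  have hbase : V + m + 3 ≤ V' := by
    rw [hV']
    exact (pow_one (V + m + 3)).symm.le.trans (Nat.pow_le_pow_right (by omega) (by omega))
  have hbody : ∀ (x : X) (i : ℕ) (o : List B), Enc.enc x ≤ V → ∀ t,
      Exec tape V' (.branch 2 (.inc 0) (.branch 2 (.seq .advance (.inc 0))
        (.branch 2 .skip (.seq (.emitSel 2 bl) (.inc 0)))))
        ⟨regList [0, Enc.enc (step (x, symAt tape i)).1, actNum (step (x, symAt tape i)).2], i, o⟩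
        t → Exec tape V' body ⟨regList [0, Enc.enc x], i, o⟩ t := by
    intro x i o hx t ht
    have hs := hm (symAt tape i)
    have h1 : cpair (Enc.enc x) (Enc.enc (symAt tape i)) + 2 ≤ (V + m + 3) ^ 2 := by
      have h1 := cpair_le (Enc.enc x) (Enc.enc (symAt tape i))
      have h2 : (Enc.enc x + Enc.enc (symAt tape i) + 1) ^ 2 ≤ (V + m + 1) ^ 2 :=
        Nat.pow_le_pow_left (by omega) 2
      nlinarith
    have h2 : cpair (Enc.enc x) (Enc.enc (symAt tape i)) ≤ V' := by
      rw [hV']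
      exact le_trans (by omega) (h1.trans (Nat.pow_le_pow_right (by omega) (by omega)))
    have h3 : (cpair (Enc.enc x) (Enc.enc (symAt tape i)) + 2) ^ c ≤ V' := by
      rw [hV']
      refine (Nat.pow_le_pow_left h1 c).trans ?_
      rw [← pow_mul]
      exact Nat.pow_le_pow_right (by omega) (by omega)
    have h4 : g (cpair (Enc.enc x) (Enc.enc (symAt tape i))) =
        cpair (Enc.enc (step (x, symAt tape i)).1) (actNum (step (x, symAt tape i)).2) :=
      hgs (x, symAt tape i)
    have e1 := exec_readSym (V := V') (tape := tape) (i := i) (o := o) (x := Enc.enc x) m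
      (by omega)
    rw [min_eq_right hs, regList_zero2] at e1
    refine e1.seq (((pexec_cpair h2).shift [0] tape i o).seq (((hP _ V' h3).shift [0] tape i o).seq
      (((pexec_unpair ((hc _).trans h3)).shift [0] tape i o).seq ?_)))
    rw [h4, unpr_cpair]
    exact ht
  have inc0 : ∀ (x i : ℕ) (o : List B), Exec tape V' (.inc 0) ⟨regList [0, x, 0], i, o⟩
      ⟨regList [1, x], i, o⟩ := by
    intro x i o
    have := PExec.inc (A := A) (B := B) (V := V') (l := [0, x, 0]) (r := 0) (by simp)
      (by simp; omega) tape i o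
    simpa [regList_zero2] using this
  have upd : ∀ x n k : ℕ, Function.update (regList [0, x, n]) 2 k = regList [0, x, k] :=
    fun x n k => update_regList [0, x, n] (show 2 < [0, x, n].length by simp) k
  have upd0 : ∀ x : ℕ, Function.update (regList [1, x]) 0 0 = regList [0, x] :=
    fun x => update_regList [1, x] (show 0 < [1, x].length by simp) 0
  have hfin : ∃ r j, Exec tape V' (.loop 0 body) ⟨regList [1, Enc.enc x], i, y⟩ ⟨r, j, y⟩ := by
    have hx : Enc.enc x ≤ V := by
      rcases Relation.ReflTransGen.cases_tail hreach with h | ⟨b, _, _, _, h⟩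
      · obtain ⟨h1, _⟩ := Prod.mk.inj h
        rw [h1]; exact hx₀
      · exact h
    refine ⟨regList [0, Enc.enc (step (x, symAt tape i)).1, 0], i,
      .loopP (k := 0) rfl ?_ (.loopZ rfl)⟩
    rw [upd0]
    refine hbody x i y hx _ ?_
    rw [hhalt]
    refine .branchP (k := 1) rfl (.branchP (k := 0) rfl (.branchZ ?_ ?_))
    · simp [upd]
    · simp only [upd]
      exact PExec.skip tape i y
  -- Induction from the end of the run: one more round of the body is put in front of a completed
  -- execution of the loop.
  have hall : ∀ s : X × ℕ × List B, NMReach step tape V s (x, i, y) →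
      ∃ r j, Exec tape V' (.loop 0 body) ⟨regList [1, Enc.enc s.1], s.2.1, s.2.2⟩ ⟨r, j, y⟩ := by
    intro s hs
    induction hs using Relation.ReflTransGen.head_induction_on with
    | refl => exact hfin
    | @head a b hab _ ih =>
      obtain ⟨r, j, ih⟩ := ih
      obtain ⟨hab, ha, _⟩ := hab
      refine ⟨r, j, .loopP (k := 0) rfl ?_ ih⟩
      rw [upd0]
      cases hab with
      | @cont x i o x' h =>
        refine hbody x i o ha _ ?_
        rw [h]
        exact .branchZ rfl (inc0 _ _ _)
      | @adv x i o x' h =>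
        refine hbody x i o ha _ ?_
        rw [h]
        refine .branchP (k := 0) rfl (.branchZ (by simp) ?_)
        simp only [upd]
        exact .seq .advance (inc0 _ _ _)
      | @emit x i o x' b h =>
        refine hbody x i o ha _ ?_
        rw [h]
        have he : actNum (Act.emit b) = Finite.equivFin B b + 2 + 1 := by
          simp only [actNum]; omega
        rw [he]
        refine .branchP (k := Finite.equivFin B b + 2) rfl
          (.branchP (k := Finite.equivFin B b + 1) (by simp)
          (.branchP (k := Finite.equivFin B b) (by simp [upd]) ?_))
        simp only [upd]
        refine .seq (exec_emitSel bl _ ?_) (inc0 _ _ _)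
        simp [bl]
  obtain ⟨r, j, hloop⟩ := hall _ hreach
  have hstart : Exec tape V' (.seq (.inc 0) (.seq (.incN 1 (Enc.enc x₀)) (.loop 0 body)))
      ⟨fun _ => 0, 0, []⟩ ⟨r, j, y⟩ := by
    have h0 : (fun _ => 0 : ℕ → ℕ) = regList [0, 0] := by
      rw [regList_zero1, ← List.nil_append [0], regList_append_zero]
      funext r; simp [regList]
    rw [h0]
    refine .seq (PExec.inc (by simp) (by simp; omega) tape 0 [])
      (.seq (pexec_incN (r := 1) (by simp) (Enc.enc x₀) (by simp; omega) tape 0 []) ?_)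
    simpa using hloop
  obtain ⟨t, ht1, ht2, ht3⟩ := hrun tape V' _ hstart
  refine ⟨t, ht1, ht2, ht3.trans ?_⟩
  have hsize : V'.size ≤ (V.size + m + 2) * (2 * c + 2) + 1 := by
    rw [Nat.size_le, hV', pow_succ 2, pow_mul 2]
    have h1 : V + m + 3 ≤ 2 ^ (V.size + m + 2) := by
      have h2 := Nat.lt_size_self V
      have h3 : m < 2 ^ m := Nat.lt_two_pow_self
      have h4 : 1 ≤ 2 ^ V.size := Nat.one_le_two_pow
      have h5 : 2 ^ (V.size + m + 2) = 2 ^ V.size * 2 ^ m * 4 := by ring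
      rw [h5]
      nlinarith
    have := Nat.pow_le_pow_left h1 (2 * c + 2)
    have h2 : 0 < (2 ^ (V.size + m + 2)) ^ (2 * c + 2) := by positivity
    omega
  nlinarith [Nat.zero_le (V.size * m * c), Nat.zero_le (V.size * m), Nat.zero_le (V.size * c),
    Nat.zero_le (m * c)]

end

end SpaceTM

namespace SpaceTM

/-! ### The window of the working tape used by a run -/

namespace Machine

variable {A Γ B : Type} (M : Machine A Γ B) (tape : List (InputSym A))

theorem run_succ_of_some {t : ℕ} {a} (h : M.action tape (M.run tape t) = some a) :
    M.run tape (t + 1) = M.perform tape (M.run tape t) a := by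
  simp [run, h]

theorem run_succ_of_none {t : ℕ} (h : M.action tape (M.run tape t) = none) :
    M.run tape (t + 1) = M.run tape t := by
  simp [run, h]

variable {M tape}

/-- A halting computation has a first time at which it halts. -/
theorem HaltsWith.exists_first {y : List B} {s : ℕ} (h : M.HaltsWith tape y s) :
    ∃ t, M.action tape (M.run tape t) = none ∧ (∀ i < t, M.action tape (M.run tape i) ≠ none) ∧
      (M.run tape t).out = y ∧ (M.visited tape t).card ≤ s := by
  classical
  obtain ⟨t, h1, h2, h3⟩ := h
  have hex : ∃ t, M.action tape (M.run tape t) = none := ⟨t, h1⟩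
  have hle : Nat.find hex ≤ t := Nat.find_min' hex h1
  have hrun : ∀ d, M.run tape (Nat.find hex + d) = M.run tape (Nat.find hex) := by
    intro d
    induction d with
    | zero => rfl
    | succ d ih =>
      rw [← Nat.add_assoc, run_succ_of_none, ih]
      rw [ih]
      exact Nat.find_spec hex
  refine ⟨Nat.find hex, Nat.find_spec hex, fun i hi => Nat.find_min hex hi, ?_, ?_⟩
  · rw [← h2, ← hrun (t - Nat.find hex)]
    congr 2
    omega
  · refine le_trans (Finset.card_le_card ?_) h3
    exact Finset.image_subset_image (Finset.range_subset_range.mpr (by omega))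

theorem moveWork_bounds (p : ℤ) (m : Move) : p - 1 ≤ moveWork p m ∧ moveWork p m ≤ p + 1 := by
  cases m <;> simp only [moveWork] <;> omega

theorem workPos_succ (t : ℕ) : (M.run tape t).workPos - 1 ≤ (M.run tape (t + 1)).workPos ∧
    (M.run tape (t + 1)).workPos ≤ (M.run tape t).workPos + 1 := by
  rcases h : M.action tape (M.run tape t) with _ | a
  · rw [run_succ_of_none M tape h]; omega
  · rw [run_succ_of_some M tape h]; exact moveWork_bounds _ _

theorem mem_visited {t i : ℕ} (h : i ≤ t) : (M.run tape i).workPos ∈ M.visited tape t :=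
  Finset.mem_image.mpr ⟨i, by simpa [Nat.lt_succ_iff] using h, rfl⟩

/-- The head starts at `0` and moves by at most one cell at a time, so it has visited everything
between `0` and its position. -/
theorem mem_visited_of_between (t : ℕ) :
    ∀ z : ℤ, (0 ≤ z ∧ z ≤ (M.run tape t).workPos) ∨ ((M.run tape t).workPos ≤ z ∧ z ≤ 0) →
      z ∈ M.visited tape t := by
  induction t with
  | zero =>
    intro z hz
    have h0 : (M.run tape 0).workPos = 0 := rfl
    have : z = (M.run tape 0).workPos := by omega
    rw [this]; exact mem_visited le_rfl
  | succ t ih =>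
    intro z hz
    by_cases h : z = (M.run tape (t + 1)).workPos
    · rw [h]; exact mem_visited le_rfl
    · have := workPos_succ (M := M) (tape := tape) t
      have hm := ih z (by omega)
      exact Finset.image_subset_image (Finset.range_subset_range.mpr (by omega)) hm

/-- A run that visits at most `s` cells stays in a window of `s` cells. -/
theorem exists_window {t s : ℕ} (h : (M.visited tape t).card ≤ s) :
    ∃ a : ℤ, ∀ i ≤ t, a ≤ (M.run tape i).workPos ∧ (M.run tape i).workPos < a + s := by
  have hne : (M.visited tape t).Nonempty := ⟨_, mem_visited le_rfl⟩
  refine ⟨(M.visited tape t).min' hne, fun i hi => ?_⟩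
  obtain ⟨a, ha⟩ : ∃ a, a = (M.visited tape t).min' hne := ⟨_, rfl⟩
  have hmin := (M.visited tape t).min'_mem hne
  rw [← ha] at hmin ⊢
  have hle : a ≤ (M.run tape i).workPos := ha ▸ Finset.min'_le _ _ (mem_visited hi)
  refine ⟨hle, ?_⟩
  -- The leftmost visited cell and the current one are both joined to `0` by visited cells. Hence
  -- all cells between them are visited, and the number of visited cells bounds their distance.
  have hsub : Finset.Icc a (M.run tape i).workPos ⊆ M.visited tape t := by
    intro z hz
    rw [Finset.mem_Icc] at hz
    have mono : ∀ j ≤ t, M.visited tape j ⊆ M.visited tape t := fun j hj =>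
      Finset.image_subset_image (Finset.range_subset_range.mpr (by omega))
    obtain ⟨j, hj, hja⟩ := Finset.mem_image.mp hmin
    have hj' : j ≤ t := by simpa [Nat.lt_succ_iff] using hj
    rcases le_total 0 z with h0 | h0
    · exact mono i hi (mem_visited_of_between i z (Or.inl ⟨h0, hz.2⟩))
    · exact mono j hj' (mem_visited_of_between j z (Or.inr ⟨by omega, h0⟩))
  have := Finset.card_le_card hsub
  rw [Int.card_Icc] at this
  omega

theorem work_eq_blank {t : ℕ} {a : ℤ} {s : ℕ}
    (h : ∀ i ≤ t, a ≤ (M.run tape i).workPos ∧ (M.run tape i).workPos < a + s) :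
    ∀ i ≤ t, ∀ z : ℤ, ¬ (a ≤ z ∧ z < a + s) → (M.run tape i).work z = M.blank := by
  intro i
  induction i with
  | zero => intro _ z _; rfl
  | succ i ih =>
    intro hi z hz
    rcases hact : M.action tape (M.run tape i) with _ | b
    · rw [run_succ_of_none M tape hact]; exact ih (by omega) z hz
    · rw [run_succ_of_some M tape hact]
      have := h i (by omega)
      simp only [perform]
      rw [Function.update_of_ne (by rintro rfl; exact hz this)]
      exact ih (by omega) z hz

end Machine

/-! ### Binary machines on a cyclic tape -/

/-- A word on a cyclic binary tape, read from the head, after the bit under the head has been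
replaced by `b` and the head has moved; `u` is the word without the bit under the head, and the
length of the tape is `n` where `H = 2 ^ (n - 1)`. -/
def cycMove (H b u : ℕ) : Move → ℕ
  | Move.left => (b + 2 * u) % H * 2 + (b + 2 * u) / H
  | Move.stay => b + 2 * u
  | Move.right => u + b * H

/-- The word of length `n` on a periodic tape, read from position `p`. -/
def cycWord (β : ℤ → ℕ) (n : ℕ) (p : ℤ) : ℕ := ∑ j ∈ Finset.range n, β (p + j) * 2 ^ j

theorem cycWord_succ (β : ℤ → ℕ) (n : ℕ) (p : ℤ) :
    cycWord β (n + 1) p = β p + 2 * cycWord β n (p + 1) := by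
  unfold cycWord
  rw [Finset.sum_range_succ', Finset.mul_sum, add_comm]
  congr 1
  · simp
  · refine Finset.sum_congr rfl fun j _ => ?_
    rw [pow_succ, show p + ((j + 1 : ℕ) : ℤ) = p + 1 + j by push_cast; ring]
    ring

theorem cycWord_succ' (β : ℤ → ℕ) (n : ℕ) (p : ℤ) :
    cycWord β (n + 1) p = cycWord β n p + β (p + n) * 2 ^ n := Finset.sum_range_succ _ _

theorem cycWord_lt {β : ℤ → ℕ} (h : ∀ z, β z ≤ 1) (n : ℕ) (p : ℤ) : cycWord β n p < 2 ^ n := by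
  induction n with
  | zero => simp [cycWord]
  | succ n ih =>
    rw [cycWord_succ', pow_succ]
    have := h (p + n)
    nlinarith

theorem cycWord_congr {β β' : ℤ → ℕ} {n : ℕ} {p : ℤ} (h : ∀ j : ℕ, j < n → β (p + j) = β' (p + j)) :
    cycWord β n p = cycWord β' n p :=
  Finset.sum_congr rfl fun j hj => by rw [h j (Finset.mem_range.mp hj)]

/-- A move of the head rotates the word. To the right, the bit just left reappears at the end, since
by periodicity it is also the bit `n + 1` cells further on; to the left, the last bit comes to the
front. -/
theorem cycWord_moveWork {β : ℤ → ℕ} (h : ∀ z, β z ≤ 1) {n : ℕ}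
    (hper : ∀ z, β (z + (n + 1 : ℕ)) = β z) (p : ℤ) (m : Move) :
    cycWord β (n + 1) (moveWork p m) = cycMove (2 ^ n) (β p) (cycWord β n (p + 1)) m := by
  cases m with
  | stay => exact cycWord_succ β n p
  | right =>
    simp only [moveWork, cycMove]
    rw [cycWord_succ', show p + 1 + (n : ℤ) = p + (n + 1 : ℕ) by push_cast; ring, hper]
  | left =>
    simp only [moveWork, cycMove]
    rw [← cycWord_succ, cycWord_succ' β n p, cycWord_succ β n (p - 1), sub_add_cancel]
    have h1 : β (p + n) = β (p - 1) := by
      rw [← hper (p - 1)]; congr 1; push_cast; ring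
    have h2 := cycWord_lt h n p
    rw [h1, Nat.add_mul_mod_self_right, Nat.mod_eq_of_lt h2,
      Nat.add_mul_div_right _ _ (by positivity), Nat.div_eq_of_lt h2]
    ring

section Cyc

variable {A B : Type} (M : Machine A Bool B)

/-- The number of states. -/
noncomputable def Machine.numStates {Γ : Type} (M : Machine A Γ B) : ℕ := Nat.card M.State

/-- The number of a state. -/
noncomputable def Machine.stateCode {Γ : Type} (M : Machine A Γ B) : M.State ≃ Fin M.numStates :=
  haveI := M.finite_state
  Finite.equivFin M.State

/-- The digit that represents a binary symbol: the blank is `0`. -/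
def Machine.digit (b : Bool) : ℕ := if b = M.blank then 0 else 1

/-- The transition of a binary machine on a cyclic tape of length `n`, where `H = 2 ^ (n - 1)`.
Configurations are numbers `q + K * w`, where `q` is the number of the state, `K` the number of
states, and `w` the word on the tape, read from the head. -/
noncomputable def Machine.cycStep (H : ℕ) (s : InputSym A) (c : ℕ) :
    Option (Move × ℕ × Option B) :=
  if h : c % M.numStates < M.numStates then
    (M.step (M.stateCode.symm ⟨c % M.numStates, h⟩) s
      (if c / M.numStates % 2 = 0 then M.blank else !M.blank)).map fun a =>
        (a.inputMove, M.stateCode a.next + M.numStates *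
          cycMove H (M.digit a.write) (c / M.numStates / 2) a.workMove, a.output)
  else none

/-- The periodic tape that agrees with the working tape on the window `[a, a + n)`. -/
def Machine.perTape (a : ℤ) (n : ℕ) (w : ℤ → Bool) (z : ℤ) : ℕ := M.digit (w (a + (z - a) % n))

/-- The number of a configuration on the cyclic tape. -/
noncomputable def Machine.cycCode (a : ℤ) (n : ℕ) (c : M.Config) : ℕ :=
  M.stateCode c.state + M.numStates * cycWord (M.perTape a n c.work) n c.workPos

variable {M}

theorem Machine.cycCode_lt (a : ℤ) (n : ℕ) (c : M.Config) :
    M.cycCode a n c < M.numStates * 2 ^ n := by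
  have h1 := cycWord_lt (β := M.perTape a n c.work)
    (fun z => by unfold perTape digit; split_ifs <;> omega) n c.workPos
  have h2 := (M.stateCode c.state).isLt
  unfold cycCode
  nlinarith

theorem Machine.cycCode_init (a : ℤ) (n : ℕ) : M.cycCode a n M.init = M.stateCode M.start := by
  simp [cycCode, init, cycWord, perTape, digit]

/-- As long as the head stays in the window, the ring is a faithful picture of the working tape. The
step on codes does not depend on the position `a` of the window, so the simulation need not know it.
-/
theorem Machine.cycStep_cycCode {n : ℕ} {a : ℤ} (tape : List (InputSym A)) (c : M.Config)
    (hc : a ≤ c.workPos ∧ c.workPos < a + (n + 1 : ℕ)) :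
    M.cycStep (2 ^ n) (symAt tape c.inputPos) (M.cycCode a (n + 1) c) =
      (M.action tape c).map fun b =>
        (b.inputMove, M.cycCode a (n + 1) (M.perform tape c b), b.output) := by
  have hlt := (M.stateCode c.state).isLt
  have hmod : M.cycCode a (n + 1) c % M.numStates = M.stateCode c.state := by
    unfold cycCode; rw [Nat.add_mul_mod_self_left, Nat.mod_eq_of_lt hlt]
  have hdiv : M.cycCode a (n + 1) c / M.numStates =
      cycWord (M.perTape a (n + 1) c.work) (n + 1) c.workPos := by
    unfold cycCode
    rw [Nat.add_mul_div_left _ _ (by omega), Nat.div_eq_of_lt hlt, zero_add]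
  have hdig : ∀ b, M.digit b ≤ 1 := fun b => by unfold digit; split_ifs <;> omega
  have hp : M.perTape a (n + 1) c.work c.workPos = M.digit (c.work c.workPos) := by
    unfold perTape
    rw [Int.emod_eq_of_lt (by omega) (by omega)]
    congr 2; ring
  have hw2 : cycWord (M.perTape a (n + 1) c.work) (n + 1) c.workPos / 2 =
      cycWord (M.perTape a (n + 1) c.work) n (c.workPos + 1) := by
    rw [cycWord_succ, hp]
    have := hdig (c.work c.workPos)
    omega
  have hbit : (if cycWord (M.perTape a (n + 1) c.work) (n + 1) c.workPos % 2 = 0 then M.blank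
      else !M.blank) = c.work c.workPos := by
    rw [cycWord_succ, hp, Nat.add_mul_mod_self_left]
    unfold digit
    rcases h1 : c.work c.workPos <;> rcases h2 : M.blank <;> simp
  unfold cycStep
  rw [dif_pos (by rw [hmod]; exact hlt)]
  have hq : M.stateCode.symm ⟨M.cycCode a (n + 1) c % M.numStates, by rw [hmod]; exact hlt⟩ =
      c.state := by
    rw [Equiv.symm_apply_eq]
    exact Fin.ext hmod
  rw [hq, hdiv, hbit, hw2]
  unfold action symAt
  refine congrArg (fun g => Option.map g _) (funext fun b => ?_)
  refine Prod.ext rfl (Prod.ext ?_ rfl)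
  simp only [cycCode, perform]
  congr 2
  have hper : ∀ z, M.perTape a (n + 1) (Function.update c.work c.workPos b.write)
      (z + (n + 1 : ℕ)) = M.perTape a (n + 1) (Function.update c.work c.workPos b.write) z := by
    intro z
    unfold perTape
    rw [show z + ((n + 1 : ℕ) : ℤ) - a = z - a + ((n + 1 : ℕ) : ℤ) by ring, Int.add_emod_right]
  symm
  rw [cycWord_moveWork (fun z => by unfold perTape; exact hdig _) hper]
  congr 1
  · unfold perTape
    rw [Int.emod_eq_of_lt (by omega) (by omega), show a + (c.workPos - a) = c.workPos by ring,
      Function.update_self]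
  · apply cycWord_congr
    intro j hj
    unfold perTape
    rw [Function.update_of_ne]
    -- If the cell `p + 1 + j` with `j < n` were identified with the written cell `p`, the length `n
    -- + 1` of the ring would divide `1 + j`, which is too small.
    intro h
    have h1 : (c.workPos + 1 + j - a) % ((n + 1 : ℕ) : ℤ) = c.workPos - a := by omega
    have h2 := Int.emod_add_mul_ediv (c.workPos + 1 + j - a) ((n + 1 : ℕ) : ℤ)
    rw [h1] at h2
    have h3 : ((n + 1 : ℕ) : ℤ) * ((c.workPos + 1 + j - a) / ((n + 1 : ℕ) : ℤ)) = 1 + j := by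
      linarith
    have h4 : ((n + 1 : ℕ) : ℤ) ∣ 1 + j := ⟨_, h3.symm⟩
    have := Int.le_of_dvd (by omega) h4
    push_cast at this
    omega

end Cyc

end SpaceTM

namespace SpaceTM

/-! ### One-way simulation of two-way computations by crossing tables -/

section Transducer

variable {A B : Type} [Finite B]

/-- The base of the numerical representation of outputs. -/
noncomputable def outBase (B : Type) : ℕ := Nat.card B + 1

/-- The number represented by an output. -/
noncomputable def outCode : List B → ℕ
  | [] => 0
  | b :: l => Finite.equivFin B b + outBase B * outCode l

/-- An output is represented by a power of the base and a number. -/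
noncomputable def outPair (l : List B) : ℕ × ℕ := (outBase B ^ l.length, outCode l)

/-- Concatenation in terms of representations. -/
def pairMul (p q : ℕ × ℕ) : ℕ × ℕ := (p.1 * q.1, p.2 + p.1 * q.2)

theorem outPair_append (l l' : List B) : outPair (l ++ l') = pairMul (outPair l) (outPair l') := by
  have : ∀ l l' : List B, outCode (l ++ l') = outCode l + outBase B ^ l.length * outCode l' := by
    intro l l'
    induction l with
    | nil => simp [outCode]
    | cons b l ih => simp only [List.cons_append, outCode, ih, List.length_cons]; ring
  simp only [outPair, pairMul, List.length_append, this, pow_add]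

theorem outCode_lt (l : List B) : outCode l < outBase B ^ l.length := by
  induction l with
  | nil => simp [outCode]
  | cons b l ih =>
    have h1 := (Finite.equivFin B b).isLt
    simp only [outCode, List.length_cons, pow_succ]
    have h2 : (Finite.equivFin B b : ℕ) < outBase B := by unfold outBase; omega
    nlinarith

/-- Results of the simulation at a cell: a status (`0`: in progress, `1`: the cell has been left to
the right, `2`: halted, other values: failure), a configuration, and the output. -/
abbrev Res : Type := ℕ × ℕ × ℕ × ℕ

/-- The largeness of a result. -/
def Res.size (r : Res) : ℕ := r.1 + r.2.1 + r.2.2.1 + r.2.2.2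

/-- Replace results that are too large by a failure. -/
def guardRes (G : ℕ) (r : Res) : Res := if r.size ≤ G then r else (3, 0, 1, 0)

/-- One step of the simulation at a cell that holds `s`; the computation on the cells to the left
is replaced by the table `Lk`. -/
noncomputable def iterStep (cs : InputSym A → ℕ → Option (Move × ℕ × Option B)) (G : ℕ)
    (Lk : ℕ → Res) (s : InputSym A) (r : Res) : Res :=
  if r.1 = 0 then
    guardRes G <| match cs s r.2.1 with
    | none => (2, r.2)
    | some (.stay, c, o) => (0, c, pairMul r.2.2 (outPair o.toList))
    | some (.right, c, o) => (1, c, pairMul r.2.2 (outPair o.toList))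
    | some (.left, c, o) => (if (Lk c).1 = 1 then 0 else (Lk c).1, (Lk c).2.1,
        pairMul (pairMul r.2.2 (outPair o.toList)) (Lk c).2.2)
  else r

/-- The simulation at a cell, started after the cell to the left has been left with result `r`. -/
noncomputable def runCell (cs : InputSym A → ℕ → Option (Move × ℕ × Option B)) (G N : ℕ)
    (Lk : ℕ → Res) (s : InputSym A) (r : Res) : Res :=
  (iterStep cs G Lk s)^[N] (if r.1 = 1 then (0, r.2) else r)

theorem guardRes_size {G : ℕ} (hG : 4 ≤ G) (r : Res) : (guardRes G r).size ≤ G := by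
  unfold guardRes
  split_ifs with h
  · exact h
  · simpa [Res.size] using hG

theorem iterStep_size {cs : InputSym A → ℕ → Option (Move × ℕ × Option B)} {G : ℕ} (hG : 4 ≤ G)
    {Lk : ℕ → Res} {s : InputSym A} {r : Res} (hr : r.size ≤ G) :
    (iterStep cs G Lk s r).size ≤ G := by
  unfold iterStep
  split_ifs
  · exact guardRes_size hG _
  · exact hr

theorem iterStep_iterate_size {cs : InputSym A → ℕ → Option (Move × ℕ × Option B)} {G : ℕ}
    (hG : 4 ≤ G) {Lk : ℕ → Res} {s : InputSym A} {r : Res} (hr : r.size ≤ G) (m : ℕ) :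
    ((iterStep cs G Lk s)^[m] r).size ≤ G := by
  induction m with
  | zero => exact hr
  | succ m ih => rw [Function.iterate_succ_apply']; exact iterStep_size hG ih

theorem runCell_size {cs : InputSym A → ℕ → Option (Move × ℕ × Option B)} {G : ℕ} (hG : 4 ≤ G)
    (N : ℕ) {Lk : ℕ → Res} {s : InputSym A} {r : Res} (hr : r.size ≤ G) :
    (runCell cs G N Lk s r).size ≤ G := by
  refine iterStep_iterate_size hG ?_ N
  split_ifs with h
  · simp only [Res.size, h] at hr ⊢; omega
  · exact hr

/-- A halting computation of a two-way transducer with `N` configurations: positions,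
configurations, moves, letters emitted, and accumulated outputs. -/
structure TwoWayRun (cs : InputSym A → ℕ → Option (Move × ℕ × Option B))
    (tape : List (InputSym A)) (N T : ℕ) (pos c : ℕ → ℕ) (mv : ℕ → Move) (e : ℕ → Option B)
    (out : ℕ → List B) : Prop where
  pos_zero : pos 0 = 0
  lt : ∀ t ≤ T, c t < N
  step : ∀ t < T, cs (symAt tape (pos t)) (c t) = some (mv t, c (t + 1), e t)
  pos_succ : ∀ t < T, pos (t + 1) = moveInput tape.length (pos t) (mv t)
  halt : cs (symAt tape (pos T)) (c T) = none
  out_zero : out 0 = []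
  out_succ : ∀ t < T, out (t + 1) = out t ++ (e t).toList

namespace TwoWayRun

variable {cs : InputSym A → ℕ → Option (Move × ℕ × Option B)} {tape : List (InputSym A)}
  {N T : ℕ} {pos c : ℕ → ℕ} {mv : ℕ → Move} {e : ℕ → Option B} {out : ℕ → List B}

theorem exists_out (h : TwoWayRun cs tape N T pos c mv e out) {u : ℕ} :
    ∀ w, u ≤ w → w ≤ T → ∃ d, out w = out u ++ d := by
  intro w hw
  induction w, hw using Nat.le_induction with
  | base => exact fun _ => ⟨[], by simp⟩
  | succ w hw ih =>
    intro hT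
    obtain ⟨d, hd⟩ := ih (by omega)
    exact ⟨d ++ (e w).toList, by rw [h.out_succ w (by omega), hd, List.append_assoc]⟩

theorem out_length_le (h : TwoWayRun cs tape N T pos c mv e out) {u w : ℕ} (hw : u ≤ w)
    (hT : w ≤ T) : (out u).length ≤ (out w).length := by
  obtain ⟨d, hd⟩ := h.exists_out w hw hT
  rw [hd]; simp

/-- A deterministic computation that repeats a configuration at the same position is periodic from
then on. The halting time, shifted back by the period, would then be a time at which the computation
continues. -/
theorem injOn (h : TwoWayRun cs tape N T pos c mv e out) {u w : ℕ} (huw : u < w) (hw : w ≤ T)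
    (hp : pos u = pos w) : c u ≠ c w := by
  intro hc
  have key : ∀ j, w + j ≤ T → pos (u + j) = pos (w + j) ∧ c (u + j) = c (w + j) := by
    intro j
    induction j with
    | zero => exact fun _ => ⟨hp, hc⟩
    | succ j ih =>
      intro hj
      obtain ⟨h1, h2⟩ := ih (by omega)
      have e1 := h.step (u + j) (by omega)
      have e2 := h.step (w + j) (by omega)
      rw [h1, h2, e2] at e1
      simp only [Option.some.injEq, Prod.mk.injEq] at e1
      have p1 := h.pos_succ (u + j) (by omega)
      have p2 := h.pos_succ (w + j) (by omega)
      rw [← Nat.add_assoc, ← Nat.add_assoc, p1, p2, h1, ← e1.1]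
      exact ⟨rfl, e1.2.1.symm⟩
  obtain ⟨h1, h2⟩ := key (T - w) (by omega)
  have e1 := h.step (u + (T - w)) (by omega)
  rw [h1, h2, Nat.add_sub_cancel' hw, h.halt] at e1
  simp at e1

variable (T pos mv) in
/-- `s` is the first time from `u` on at which the cell `i` is left to the right. -/
def Exits (i u s : ℕ) : Prop :=
  u ≤ s ∧ s < T ∧ pos s = i ∧ mv s = .right ∧ ∀ w, u ≤ w → w < s → ¬ (pos w = i ∧ mv w = .right)

variable (T pos mv) in
/-- The cell `i` is not left to the right from the time `u` on. -/
def Stays (i u : ℕ) : Prop := ∀ w, u ≤ w → w < T → ¬ (pos w = i ∧ mv w = .right)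

variable (T pos c mv out) in
/-- `r` is the correct result of the simulation at the cell `i` from the time `u` on, if the output
accumulated before is `l`. -/
def Correct (i u : ℕ) (l : List B) (r : Res) : Prop :=
  (∀ s d, Exits T pos mv i u s → out (s + 1) = out u ++ d →
    r = (1, c (s + 1), outPair (l ++ d))) ∧
  (∀ d, Stays T pos mv i u → out T = out u ++ d → r = (2, c T, outPair (l ++ d)))

variable (T pos c mv out) in
/-- The table is correct for all entries into the cell `i` from the right. -/
def CellSpec (i : ℕ) (R : ℕ → Res) : Prop :=
  ∀ u ≤ T, pos u = i → Correct T pos c mv out i u [] (R (c u))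

variable (T pos c mv out) in
/-- The table is correct for all computations to the left of the cell `i`. -/
def LookSpec (i : ℕ) (Lk : ℕ → Res) : Prop :=
  ∀ u < T, pos u = i → mv u = .left →
    (∀ w d, u < w → w ≤ T → pos w = i → (∀ x, u < x → x < w → pos x ≠ i) →
      out w = out (u + 1) ++ d → Lk (c (u + 1)) = (1, c w, outPair d)) ∧
    ((∀ x, u < x → x ≤ T → pos x ≠ i) → ∀ d, out T = out (u + 1) ++ d →
      Lk (c (u + 1)) = (2, c T, outPair d))

/-- A left move on the left marker leaves the head where it is, so it counts as an immediate return
with empty output. -/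
theorem lookSpec_zero (h : TwoWayRun cs tape N T pos c mv e out) {Lk : ℕ → Res}
    (hLk : ∀ x < N, Lk x = (1, x, 1, 0)) : LookSpec T pos c mv out 0 Lk := by
  intro u hu hp hm
  have h1 : pos (u + 1) = 0 := by rw [h.pos_succ u hu, hp, hm]; rfl
  rw [hLk _ (h.lt (u + 1) hu)]
  refine ⟨fun w d huw hw _ hx hd => ?_, fun hx => absurd h1 (hx (u + 1) (by omega) (by omega))⟩
  obtain rfl : w = u + 1 := by
    by_contra hne
    exact hx (u + 1) (by omega) (by omega) h1
  obtain rfl : d = [] := by simpa using hd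
  simp [outPair, outCode]

theorem moveInput_le (len i : ℕ) (m : Move) : moveInput len i m ≤ i + 1 := by
  cases m <;> simp only [moveInput] <;> omega

/-- After a left move from cell `i + 1` the head is on cell `i`, and it can return only by a right
move from there, since it moves one cell at a time. So the first return is the first exit of cell
`i` to the right. The condition on `i` ensures that this right move is not blocked by the end of the
tape. -/
theorem lookSpec_succ (h : TwoWayRun cs tape N T pos c mv e out) {i : ℕ} {R : ℕ → Res}
    (hi : i + 1 < tape.length) (hR : CellSpec T pos c mv out i R) :
    LookSpec T pos c mv out (i + 1) R := by
  intro u hu hp hm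
  have h1 : pos (u + 1) = i := by rw [h.pos_succ u hu, hp, hm]; rfl
  have hbelow : ∀ v, u + 1 ≤ v → v ≤ T → (∀ x, u < x → x ≤ v → pos x ≠ i + 1) → pos v ≤ i := by
    intro v hv
    induction v, hv using Nat.le_induction with
    | base => intro _ _; omega
    | succ v hv ih =>
      intro hT hx
      have h2 := ih (by omega) (fun x h1 h2 => hx x h1 (by omega))
      have h3 := hx (v + 1) (by omega) le_rfl
      have h4 := h.pos_succ v (by omega)
      have h5 := moveInput_le tape.length (pos v) (mv v)
      omega
  have hright : ∀ x, x < T → pos x = i → mv x = .right → pos (x + 1) = i + 1 := by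
    intro x hx hp hm
    rw [h.pos_succ x hx, hp, hm]
    simp only [moveInput]; omega
  have hspec := hR (u + 1) hu h1
  refine ⟨fun w d huw hw hpw hx hd => ?_, fun hx d hd => ?_⟩
  · obtain ⟨s, rfl⟩ : ∃ s, w = s + 1 := ⟨w - 1, by omega⟩
    have hs : u + 1 ≤ s := by
      by_contra hlt
      obtain rfl : s = u := by omega
      omega
    have hs1 := hbelow s hs (by omega) (fun x h1 h2 => hx x h1 (by omega))
    have hs2 := h.pos_succ s (by omega)
    have hs3 := moveInput_le tape.length (pos s) (mv s)
    have hpi : pos s = i := by omega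
    have hms : mv s = .right := by
      rcases hm : mv s with _ | _ | _
      · rw [hm, hpw] at hs2; simp only [moveInput] at hs2; omega
      · rw [hm, hpw] at hs2; simp only [moveInput] at hs2; omega
      · rfl
    have := hspec.1 s d ⟨hs, by omega, hpi, hms, fun w h1 h2 h3 =>
      hx (w + 1) (by omega) (by omega) (hright w (by omega) h3.1 h3.2)⟩ hd
    simpa using this
  · have := hspec.2 d (fun w h1 h2 h3 =>
      hx (w + 1) (by omega) (by omega) (hright w (by omega) h3.1 h3.2)) hd
    simpa using this

/-- The guard never acts on values from a genuine run: the status is at most `3`, the configuration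
is below `N`, and each half of the represented output is at most `outBase B ^ L`. -/
theorem guardRes_eq {G L x : ℕ} {st : ℕ} {l : List B} (hG : N + 2 * outBase B ^ L + 3 ≤ G)
    (hst : st ≤ 3) (hx : x < N) (hl : l.length ≤ L) :
    guardRes G (st, x, outPair l) = (st, x, outPair l) := by
  unfold guardRes
  rw [if_pos]
  have h1 := outCode_lt l
  have h2 : outBase B ^ l.length ≤ outBase B ^ L :=
    Nat.pow_le_pow_right (by unfold outBase; omega) hl
  simp only [Res.size, outPair]
  omega

theorem iterate_eq_of_fixed {α : Type} {f : α → α} {x y : α} {m n : ℕ} (h : f^[m] x = y)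
    (hy : f y = y) (hmn : m ≤ n) : f^[n] x = y := by
  obtain ⟨d, rfl⟩ := Nat.exists_eq_add_of_le' hmn
  rw [Function.iterate_add_apply, h]
  exact Function.iterate_fixed hy d

-- Each iteration leads from one visit of cell `i` to the next, or ends the simulation at this cell.
-- So the number of iterations is at most the number of remaining visits, and the proof is by strong
-- induction on the remaining time. The length condition on `l` keeps all accumulated outputs below
-- the guard.
open Classical in
theorem exists_iterate_correct (h : TwoWayRun cs tape N T pos c mv e out) {i G L : ℕ}
    {Lk : ℕ → Res} (hLk : LookSpec T pos c mv out i Lk)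
    (hG : N + 2 * outBase B ^ L + 3 ≤ G) :
    ∀ n u, u ≤ T → T - u = n → pos u = i → ∀ l : List B,
      l.length + ((out T).length - (out u).length) ≤ L →
      ∃ m ≤ ((Finset.Icc u T).filter fun w => pos w = i).card, ∃ r : Res, r.1 ≠ 0 ∧
        (iterStep cs G Lk (symAt tape i))^[m] (0, c u, outPair l) = r ∧
        Correct T pos c mv out i u l r := by
  intro n
  induction n using Nat.strong_induction_on with
  | _ n ih =>
  intro u hu hn hp l hl
  have hmem : u ∈ (Finset.Icc u T).filter fun w => pos w = i := by simp [hu, hp]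
  have hcard : ∀ w, u < w → ((Finset.Icc w T).filter fun w => pos w = i).card + 1 ≤
      ((Finset.Icc u T).filter fun w => pos w = i).card := by
    intro w hw
    rw [Nat.succ_le_iff]
    refine Finset.card_lt_card ⟨fun x hx => ?_, fun hsub => ?_⟩
    · simp only [Finset.mem_filter, Finset.mem_Icc] at hx ⊢
      exact ⟨⟨by omega, hx.1.2⟩, hx.2⟩
    · have := hsub hmem
      simp only [Finset.mem_filter, Finset.mem_Icc] at this
      omega
  have hpos : 1 ≤ ((Finset.Icc u T).filter fun w => pos w = i).card :=
    Finset.card_pos.mpr ⟨u, hmem⟩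
  -- continuation at a later visit of the cell
  have hcont : ∀ w d, u < w → w ≤ T → pos w = i → out w = out u ++ d →
      iterStep cs G Lk (symAt tape i) (0, c u, outPair l) = (0, c w, outPair (l ++ d)) →
      (∀ x, u ≤ x → x < w → ¬ (pos x = i ∧ mv x = .right)) →
      ∃ m ≤ ((Finset.Icc u T).filter fun w => pos w = i).card, ∃ r : Res, r.1 ≠ 0 ∧
        (iterStep cs G Lk (symAt tape i))^[m] (0, c u, outPair l) = r ∧
        Correct T pos c mv out i u l r := by
    intro w d huw hw hpw hd hit hx
    have hle := h.out_length_le hw le_rfl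
    have hlen : (out w).length = (out u).length + d.length := by rw [hd]; simp
    obtain ⟨m, hm, r, hr, hmr, hc⟩ := ih (T - w) (by omega) w hw rfl hpw (l ++ d) (by
      rw [List.length_append]; omega)
    refine ⟨m + 1, (Nat.succ_le_succ hm).trans (hcard w huw), r, hr, ?_, ?_⟩
    · rw [Function.iterate_succ_apply, hit, hmr]
    · refine ⟨fun s d' hs hd' => ?_, fun d' hs hd' => ?_⟩
      · have hsw : w ≤ s := by
          by_contra hlt
          exact hx s hs.1 (by omega) ⟨hs.2.2.1, hs.2.2.2.1⟩
        obtain ⟨d'', hd''⟩ := h.exists_out (s + 1) (show w ≤ s + 1 by omega) hs.2.1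
        have := hc.1 s d'' ⟨hsw, hs.2.1, hs.2.2.1, hs.2.2.2.1,
          fun x h1 h2 => hs.2.2.2.2 x (by omega) h2⟩ hd''
        rw [hd', hd, List.append_assoc] at hd''
        rw [this, List.append_cancel_left hd'', List.append_assoc]
      · obtain ⟨d'', hd''⟩ := h.exists_out T hw le_rfl
        have := hc.2 d'' (fun x h1 h2 => hs x (by omega) h2) hd''
        rw [hd', hd, List.append_assoc] at hd''
        rw [this, List.append_cancel_left hd'', List.append_assoc]
  rcases Nat.lt_or_ge u T with huT | huT
  · have hstep := h.step u huT
    have hout := h.out_succ u huT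
    have hps := h.pos_succ u huT
    rw [hp] at hstep
    have hlen1 : (out (u + 1)).length = (out u).length + (e u).toList.length := by
      rw [hout]; simp
    have hle1 := h.out_length_le (show u + 1 ≤ T by omega) le_rfl
    have hll : (l ++ (e u).toList).length ≤ L := by rw [List.length_append]; omega
    rcases hm : mv u with _ | _ | _
    · -- move to the left
      rw [hm] at hstep hps
      obtain ⟨hret, hno⟩ := hLk u huT hp hm
      have hnr : ∀ x, x = u → ¬ (pos x = i ∧ mv x = .right) := by
        rintro x rfl ⟨_, h2⟩; rw [hm] at h2; simp at h2
      -- If the cell is visited again, the table gives the configuration at the first return and the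
      -- iteration continues there. Otherwise the computation halts to the left of the cell, and the
      -- table already gives the final configuration and output.
      by_cases hex : ∃ w, u < w ∧ w ≤ T ∧ pos w = i
      · obtain ⟨h1, h2, h3⟩ := Nat.find_spec hex
        have hmin : ∀ x, u < x → x < Nat.find hex → pos x ≠ i := fun x hx1 hx2 hx3 =>
          Nat.find_min hex hx2 ⟨hx1, by omega, hx3⟩
        obtain ⟨d, hd⟩ := h.exists_out (Nat.find hex) (show u + 1 ≤ Nat.find hex by omega) h2
        have hr := hret _ d h1 h2 h3 hmin hd
        rw [hout, List.append_assoc] at hd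
        refine hcont _ _ h1 h2 h3 hd ?_ ?_
        · have hlenw : (out (Nat.find hex)).length =
              (out u).length + ((e u).toList ++ d).length := by rw [hd]; simp
          have hlew := h.out_length_le h2 le_rfl
          unfold iterStep
          rw [if_pos rfl]
          simp only [hstep, hr, if_true]
          rw [← outPair_append, ← outPair_append, List.append_assoc]
          exact guardRes_eq hG (by omega) (h.lt _ h2) (by rw [List.length_append]; omega)
        · intro x hx1 hx2
          rcases Nat.lt_or_ge u x with hlt | hge
          · exact fun hx3 => hmin x hlt hx2 hx3.1
          · exact hnr x (by omega)
      · have hno' : ∀ x, u < x → x ≤ T → pos x ≠ i := fun x h1 h2 h3 => hex ⟨x, h1, h2, h3⟩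
        obtain ⟨d, hd⟩ := h.exists_out T (show u + 1 ≤ T by omega) le_rfl
        have hr := hno hno' d hd
        rw [hout, List.append_assoc] at hd
        have hlenw : (out T).length = (out u).length + ((e u).toList ++ d).length := by
          rw [hd]; simp
        refine ⟨1, hpos, (2, c T, outPair (l ++ ((e u).toList ++ d))), by simp, ?_, ?_, ?_⟩
        · rw [Function.iterate_one]
          unfold iterStep
          rw [if_pos rfl]
          simp only [hstep, hr]
          rw [← outPair_append, ← outPair_append, List.append_assoc, if_neg (by norm_num)]
          exact guardRes_eq hG (by omega) (h.lt _ le_rfl) (by rw [List.length_append]; omega)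
        · intro s d' hs _
          exfalso
          rcases Nat.lt_or_ge u s with hlt | hge
          · exact hno' s hlt hs.2.1.le hs.2.2.1
          · exact hnr s (by have := hs.1; omega) ⟨hs.2.2.1, hs.2.2.2.1⟩
        · intro d' _ hd'
          rw [hd'] at hd
          rw [List.append_cancel_left hd]
    · -- no move
      rw [hm] at hstep hps
      refine hcont (u + 1) (e u).toList (by omega) (by omega) (by rw [hps, hp]; rfl) hout ?_ ?_
      · unfold iterStep
        rw [if_pos rfl]
        simp only [hstep]
        rw [← outPair_append]
        exact guardRes_eq hG (by omega) (h.lt _ huT) hll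
      · intro x hx1 hx2 hx3
        obtain rfl : x = u := by omega
        rw [hm] at hx3; simp at hx3
    · -- move to the right
      rw [hm] at hstep hps
      refine ⟨1, hpos, (1, c (u + 1), outPair (l ++ (e u).toList)), by simp, ?_, ?_, ?_⟩
      · rw [Function.iterate_one]
        unfold iterStep
        rw [if_pos rfl]
        simp only [hstep]
        rw [← outPair_append]
        exact guardRes_eq hG (by omega) (h.lt _ huT) hll
      · intro s d hs hd
        obtain rfl : s = u := by
          by_contra hne
          exact hs.2.2.2.2 u le_rfl (by have := hs.1; omega) ⟨hp, hm⟩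
        rw [hout] at hd
        rw [List.append_cancel_left hd]
      · intro d hs _
        exact absurd ⟨hp, hm⟩ (hs u le_rfl huT)
  · obtain rfl : u = T := by omega
    have hhalt := h.halt
    rw [hp] at hhalt
    refine ⟨1, hpos, (2, c u, outPair l), by simp, ?_, ?_, ?_⟩
    · rw [Function.iterate_one]
      unfold iterStep
      rw [if_pos rfl]
      simp only [hhalt]
      exact guardRes_eq hG (by omega) (h.lt _ le_rfl) (by omega)
    · intro s d hs
      exact absurd hs.2.1 (by have := hs.1; omega)
    · intro d _ hd
      obtain rfl : d = [] := by simpa using hd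
      simp

/-- The visits of one cell have pairwise different configurations, so there are at most `N` of them.
The `N` iterations in `runCell` therefore reach a final result, which is a fixed point of further
iterations. -/
theorem runCell_correct (h : TwoWayRun cs tape N T pos c mv e out) {i G L : ℕ}
    {Lk : ℕ → Res} (hLk : LookSpec T pos c mv out i Lk)
    (hG : N + 2 * outBase B ^ L + 3 ≤ G) {u : ℕ} (hu : u ≤ T) (hp : pos u = i) {l : List B}
    (hl : l.length + ((out T).length - (out u).length) ≤ L) :
    Correct T pos c mv out i u l
      (runCell cs G N Lk (symAt tape i) (1, c u, outPair l)) := by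
  classical
  obtain ⟨m, hm, r, hr, hit, hc⟩ := h.exists_iterate_correct hLk hG (T - u) u hu rfl hp l hl
  have hcard : ((Finset.Icc u T).filter fun w => pos w = i).card ≤ N := by
    rw [← Finset.card_range N]
    refine Finset.card_le_card_of_injOn c (fun w hw => ?_) (fun w hw w' hw' hww => ?_)
    · simp only [Finset.coe_filter, Finset.mem_Icc, Set.mem_ofPred_eq] at hw
      simpa using h.lt w hw.1.2
    · simp only [Finset.coe_filter, Finset.mem_Icc, Set.mem_ofPred_eq] at hw hw'
      rcases lt_trichotomy w w' with hlt | heq | hgt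
      · exact absurd hww (h.injOn hlt hw'.1.2 (hw.2.trans hw'.2.symm))
      · exact heq
      · exact absurd hww.symm (h.injOn hgt hw.1.2 (hw'.2.trans hw.2.symm))
  have hfix : iterStep cs G Lk (symAt tape i) r = r := by
    unfold iterStep; rw [if_neg hr]
  unfold runCell
  rw [if_pos rfl, iterate_eq_of_fixed hit hfix (hm.trans hcard)]
  exact hc

end TwoWayRun

end Transducer

end SpaceTM

namespace SpaceTM

/-! ### Runs of binary machines as runs of two-way transducers -/

/-- The position of the window depends on the input, but it is visible neither in the code of the
initial configuration, where the word is blank, nor in the transitions on codes. -/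
theorem Machine.HaltsWith.exists_twoWayRun {A B : Type} {M : Machine A Bool B}
    {tape : List (InputSym A)} {y : List B} {n : ℕ} (h : M.HaltsWith tape y (n + 1)) :
    ∃ T pos c mv e out, TwoWayRun (M.cycStep (2 ^ n)) tape (M.numStates * 2 ^ (n + 1)) T pos c mv e
      out ∧ c 0 = M.stateCode M.start ∧ out T = y := by
  obtain ⟨T, hT, hlt, hy, hcard⟩ := h.exists_first
  obtain ⟨a, ha⟩ := exists_window hcard
  have hstep : ∀ t < T, ∃ b, M.action tape (M.run tape t) = some b := fun t ht =>
    Option.ne_none_iff_exists'.mp (hlt t ht)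
  have hsp : ∀ t ≤ T, _ := fun t ht => M.cycStep_cycCode tape (M.run tape t) (ha t ht)
  refine ⟨T, fun t => (M.run tape t).inputPos, fun t => M.cycCode a (n + 1) (M.run tape t),
    fun t => ((M.action tape (M.run tape t)).map fun b => b.inputMove).getD .stay,
    fun t => ((M.action tape (M.run tape t)).map fun b => b.output).getD none,
    fun t => (M.run tape t).out, ⟨rfl, fun t _ => Machine.cycCode_lt _ _ _, ?_, ?_, ?_, rfl, ?_⟩,
    Machine.cycCode_init _ _, hy⟩
  · intro t ht
    obtain ⟨b, hb⟩ := hstep t ht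
    simp only [hsp t ht.le, hb, run_succ_of_some M tape hb, Option.map_some, Option.getD_some]
  · intro t ht
    obtain ⟨b, hb⟩ := hstep t ht
    simp only [hb, run_succ_of_some M tape hb, Option.map_some, Option.getD_some]
    rfl
  · simp only [hsp T le_rfl, hT, Option.map_none]
  · intro t ht
    obtain ⟨b, hb⟩ := hstep t ht
    simp only [hb, run_succ_of_some M tape hb, Option.map_some, Option.getD_some]
    rfl

theorem Machine.HaltsWith.pos {A Γ B : Type} {M : Machine A Γ B} {tape : List (InputSym A)}
    {y : List B} {s : ℕ} (h : M.HaltsWith tape y s) : 0 < s := by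
  obtain ⟨t, _, _, h⟩ := h
  exact (Finset.card_pos.mpr ⟨_, mem_visited (le_refl t)⟩).trans_le h

/-! ### Numerical coding of crossing tables -/

theorem cpair_lt_pow {a b Y : ℕ} (ha : a < Y) (hb : b < Y) (hY : 4 ≤ Y) : cpair a b < Y ^ 3 := by
  have h1 := cpair_le a b
  have h2 : (a + b + 1) ^ 2 < (2 * Y) ^ 2 := Nat.pow_lt_pow_left (by omega) (by omega)
  nlinarith [sq_nonneg Y]

/-- The result with a given code. -/
def unRes (n : ℕ) : Res :=
  ((unpr n).1, (unpr (unpr n).2).1, (unpr (unpr (unpr n).2).2).1, (unpr (unpr (unpr n).2).2).2)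

theorem enc_unRes (n : ℕ) : Enc.enc (unRes n) = n := by
  simp only [Enc.enc, unRes, cpair_unpr]

theorem unRes_enc (r : Res) : unRes (Enc.enc r) = r := Enc.inj (enc_unRes _)

/-- The base of the coding of tables of results of size at most `G`. -/
def tabBase (G : ℕ) : ℕ := (G + 4) ^ 27

/-- A result is coded by three nested pairings, each of which at most cubes the bound; hence the
exponent `27` in `tabBase`. -/
theorem enc_res_lt {G : ℕ} {r : Res} (h : r.size ≤ G) : Enc.enc r < tabBase G := by
  obtain ⟨a, b, c, d⟩ := r
  simp only [Res.size] at h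
  have hG : 4 ≤ G + 4 := by omega
  have up : ∀ k, 4 ≤ (G + 4) ^ (k + 1) := fun k =>
    hG.trans (Nat.le_self_pow (by omega) _)
  have le : ∀ k, ∀ x ≤ G, x < (G + 4) ^ (k + 1) := fun k x hx =>
    lt_of_lt_of_le (by omega : x < G + 4) (Nat.le_self_pow (by omega) _)
  have h1 : cpair c d < (G + 4) ^ 3 := cpair_lt_pow (by omega) (by omega) hG
  have h2 : cpair b (cpair c d) < ((G + 4) ^ 3) ^ 3 :=
    cpair_lt_pow (le 2 _ (by omega)) h1 (up 2)
  have h3 : cpair a (cpair b (cpair c d)) < (((G + 4) ^ 3) ^ 3) ^ 3 :=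
    cpair_lt_pow (by rw [← pow_mul]; exact le 8 _ (by omega)) h2 (by rw [← pow_mul]; exact up 8)
  rw [← pow_mul, ← pow_mul] at h3
  exact h3

/-- The entry with index `x` of a table that is coded with base `D`. -/
def lookTab (D T x : ℕ) : Res := unRes ((fun t => t / D)^[x] T % D)

theorem div_iterate (D T x : ℕ) : (fun t => t / D)^[x] T = T / D ^ x := by
  induction x with
  | zero => simp
  | succ x ih => rw [Function.iterate_succ_apply', ih, Nat.div_div_eq_div_mul, pow_succ]

/-- The code with base `D` of the table of the first `N` values of `R`; `W` is a bound. -/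
def mkTab (D W N : ℕ) (R : ℕ → Res) : ℕ :=
  ((fun p : ℕ × ℕ => (p.1 - 1, min W (p.2 * D + Enc.enc (R (p.1 - 1)))))^[N] (N, 0)).2

theorem mkTab_iterate_le (D W N : ℕ) (R : ℕ → Res) (k : ℕ) :
    ((fun p : ℕ × ℕ => (p.1 - 1, min W (p.2 * D + Enc.enc (R (p.1 - 1)))))^[k] (N, 0)).1 ≤ N ∧
    ((fun p : ℕ × ℕ => (p.1 - 1, min W (p.2 * D + Enc.enc (R (p.1 - 1)))))^[k] (N, 0)).2 ≤ W := by
  induction k with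
  | zero => simp
  | succ k ih => rw [Function.iterate_succ_apply']; exact ⟨by simp only; omega, min_le_left _ _⟩

theorem mkTab_le (D W N : ℕ) (R : ℕ → Res) : mkTab D W N R ≤ W := (mkTab_iterate_le D W N R N).2

/-- The table is written by Horner's scheme, beginning with the last entry, so that the entry with
index `x` ends up as the digit at place `x`. The cap `W` is never reached because it is at least `D
^ N`; it only gives a bound that holds for all arguments. -/
theorem lookTab_mkTab {D W N : ℕ} {R : ℕ → Res} (hR : ∀ x < N, Enc.enc (R x) < D)
    (hW : D ^ N ≤ W) {x : ℕ} (hx : x < N) : lookTab D (mkTab D W N R) x = R x := by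
  have key : ∀ k ≤ N, ∃ a < D ^ k,
      (fun p : ℕ × ℕ => (p.1 - 1, min W (p.2 * D + Enc.enc (R (p.1 - 1)))))^[k] (N, 0) =
        (N - k, a) ∧ ∀ j < k, a / D ^ j % D = Enc.enc (R (N - k + j)) := by
    intro k
    induction k with
    | zero => exact fun _ => ⟨0, by simp, by simp, by simp⟩
    | succ k ih =>
      intro hk
      obtain ⟨a, ha, he, hj⟩ := ih (by omega)
      have hr := hR (N - k - 1) (by omega)
      have hlt : a * D + Enc.enc (R (N - k - 1)) < D ^ (k + 1) := by
        rw [pow_succ]; nlinarith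
      have hle : D ^ (k + 1) ≤ D ^ N := Nat.pow_le_pow_right (by omega) hk
      refine ⟨_, hlt, ?_, fun j hjk => ?_⟩
      · rw [Function.iterate_succ_apply', he]
        simp only [min_eq_right (hlt.le.trans (hle.trans hW))]
        congr 1
      · rcases j with _ | j
        · rw [pow_zero, Nat.div_one, Nat.mul_add_mod_self_right, Nat.mod_eq_of_lt hr]
          congr 2
        · rw [pow_succ', ← Nat.div_div_eq_div_mul, mul_comm a, Nat.mul_add_div (by omega),
            Nat.div_eq_of_lt hr, add_zero, hj j (by omega)]
          congr 2; omega
  obtain ⟨a, _, he, hj⟩ := key N le_rfl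
  unfold lookTab
  rw [div_iterate]
  have : mkTab D W N R = a := by unfold mkTab; rw [he]
  rw [this, hj x hx, unRes_enc, Nat.sub_self, zero_add]

/-! ### The simulation is computable in linear space -/

instance (k : ℕ) : Enc (Fin k) := ⟨fun i => i, fun _ _ h => Fin.ext h⟩

namespace LSp

variable {γ : Type} [Enc γ]

/-- Residues as elements of a finite type: they serve as indices in definitions by `cases`. -/
theorem modFin {f : γ → ℕ} (hf : LSp f) {k : ℕ} (hk : 0 < k) :
    LSp fun x => (⟨f x % k, Nat.mod_lt _ hk⟩ : Fin k) := by
  obtain ⟨g, hg, h⟩ := hf.mod (const k)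
  exact ⟨g, hg, h⟩

theorem unRes {f : γ → ℕ} (hf : LSp f) : LSp fun x => SpaceTM.unRes (f x) := by
  obtain ⟨g, hg, h⟩ := hf
  exact ⟨g, hg, fun x => by rw [h, enc_unRes]; rfl⟩

theorem lookTab {D T c : γ → ℕ} (hD : LSp D) (hT : LSp T) (hc : LSp c) :
    LSp fun x => SpaceTM.lookTab (D x) (T x) (c x) := by
  refine unRes (mod ?_ hD)
  refine iterate (step := fun x t => t / D x) (div (snd id) (hD.comp (fst id))) hc hT hT ?_
  intro y i _
  rw [div_iterate]
  exact Nat.div_le_self _ _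

theorem mkTab {D W N : γ → ℕ} {R : γ → ℕ → Res} (hD : LSp D) (hW : LSp W) (hN : LSp N)
    (hR : LSp fun p : γ × ℕ => R p.1 p.2) :
    LSp fun x => SpaceTM.mkTab (D x) (W x) (N x) (R x) := by
  have hi : LSp fun p : γ × ℕ × ℕ => p.2.1 - 1 := (fst (snd id)).sub (const 1)
  refine snd (iterate (step := fun x (p : ℕ × ℕ) =>
    (p.1 - 1, Min.min (W x) (p.2 * D x + Enc.enc (R x (p.1 - 1)))))
    (mk hi (min (hW.comp (fst id)) (add (mul (snd (snd id)) (hD.comp (fst id)))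
      (enc (hR.comp (mk (fst id) hi)))))) hN (mk hN (const 0)) (bd := fun x => Enc.enc (N x, W x))
    (enc (mk hN hW)) ?_)
  intro y i _
  obtain ⟨h1, h2⟩ := mkTab_iterate_le (D y) (W y) (N y) (R y) i
  exact cpair_mono h1 h2

end LSp

end SpaceTM

namespace SpaceTM

theorem Machine.numStates_pos {A Γ B : Type} (M : Machine A Γ B) : 0 < M.numStates :=
  Fin.pos (M.stateCode M.start)

namespace LSp

variable {γ : Type} [Enc γ]

theorem cycMove {H u : γ → ℕ} (hH : LSp H) (hu : LSp u) (b : ℕ) (m : Move) :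
    LSp fun x => SpaceTM.cycMove (H x) b (u x) m := by
  have h : LSp fun x => b + 2 * u x := add (const b) (mul (const 2) hu)
  cases m with
  | left => exact add (mul (mod h hH) (const 2)) (div h hH)
  | stay => exact h
  | right => exact add hu (mul (const b) hH)

theorem pairMul {p q : γ → ℕ × ℕ} (hp : LSp p) (hq : LSp q) :
    LSp fun x => SpaceTM.pairMul (p x) (q x) :=
  mk (mul (fst hp) (fst hq)) (add (snd hp) (mul (fst hp) (snd hq)))

theorem guardRes {G : γ → ℕ} {r : γ → Res} (hG : LSp G) (hr : LSp r) :
    LSp fun x => SpaceTM.guardRes (G x) (r x) :=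
  ite_le (add (add (add (fst hr) (fst (snd hr))) (fst (snd (snd hr)))) (snd (snd (snd hr)))) hG hr
    (const _)

section

variable {A B : Type} [Finite A] [Finite B] (M : Machine A Bool B) {H G D T N : γ → ℕ}
  {s : γ → InputSym A} {r : γ → Res}

/-- The transition function of `M` is a finite object. After a case distinction over state, bit
under the head and input symbol, only arithmetic and a lookup in the table remain. -/
theorem iterStep (hH : LSp H) (hG : LSp G) (hD : LSp D) (hT : LSp T) (hs : LSp s) (hr : LSp r) :
    LSp fun x => SpaceTM.iterStep (M.cycStep (H x)) (G x) (SpaceTM.lookTab (D x) (T x)) (s x)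
      (r x) := by
  have hK := M.numStates_pos
  have hc : LSp fun x => (r x).2.1 := fst (snd hr)
  have hidx : LSp fun x => ((⟨(r x).2.1 % M.numStates, Nat.mod_lt _ hK⟩ : Fin M.numStates),
      (⟨(r x).2.1 / M.numStates % 2, Nat.mod_lt _ two_pos⟩ : Fin 2), s x) :=
    mk (modFin hc hK) (mk (modFin (div hc (const _)) two_pos) hs)
  have hu : LSp fun x => (r x).2.1 / M.numStates / 2 := div (div hc (const _)) (const 2)
  have hcase := cases (f := fun (a : Fin M.numStates × Fin 2 × InputSym A) x =>
      if (r x).1 = 0 then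
        SpaceTM.guardRes (G x) <| match ((M.step (M.stateCode.symm a.1) a.2.2
            (if (a.2.1 : ℕ) = 0 then M.blank else !M.blank)).map fun a =>
              (a.inputMove, M.stateCode a.next + M.numStates *
                SpaceTM.cycMove (H x) (M.digit a.write) ((r x).2.1 / M.numStates / 2) a.workMove,
                a.output) : Option (Move × ℕ × Option B)) with
        | none => (2, (r x).2)
        | some (.stay, c, o) => (0, c, SpaceTM.pairMul (r x).2.2 (outPair o.toList))
        | some (.right, c, o) => (1, c, SpaceTM.pairMul (r x).2.2 (outPair o.toList))
        | some (.left, c, o) => (if (SpaceTM.lookTab (D x) (T x) c).1 = 1 then 0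
            else (SpaceTM.lookTab (D x) (T x) c).1, (SpaceTM.lookTab (D x) (T x) c).2.1,
            SpaceTM.pairMul (SpaceTM.pairMul (r x).2.2 (outPair o.toList))
              (SpaceTM.lookTab (D x) (T x) c).2.2)
      else r x) hidx ?_
  · convert hcase using 2 with x
    unfold SpaceTM.iterStep Machine.cycStep
    rw [dif_pos (Nat.mod_lt _ hK)]
  · rintro ⟨q, b, s⟩
    refine ite_eq (fst hr) (const 0) (guardRes hG ?_) hr
    simp only
    rcases M.step (M.stateCode.symm q) s (if (b : ℕ) = 0 then M.blank else !M.blank) with _ | a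
    · exact mk (const 2) (snd hr)
    · have hc' : LSp fun x => (M.stateCode a.next : ℕ) + M.numStates *
          SpaceTM.cycMove (H x) (M.digit a.write) ((r x).2.1 / M.numStates / 2) a.workMove :=
        add (const _) (mul (const _) (cycMove hH hu _ _))
      have hp : LSp fun x => SpaceTM.pairMul (r x).2.2 (outPair a.output.toList) :=
        pairMul (snd (snd hr)) (const _)
      simp only [Option.map_some]
      rcases a.inputMove with _ | _ | _
      · have hl := lookTab hD hT hc'
        exact mk (ite_eq (fst hl) (const 1) (const 0) (fst hl)) (mk (fst (snd hl))
          (pairMul hp (snd (snd hl))))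
      · exact mk (const 0) (mk hc' hp)
      · exact mk (const 1) (mk hc' hp)

theorem runCell (hH : LSp H) (hG : LSp G) (hN : LSp N) (hD : LSp D) (hT : LSp T) (hs : LSp s)
    (hr : LSp r) (hG4 : ∀ x, 4 ≤ G x) (hrG : ∀ x, (r x).size ≤ G x) :
    LSp fun x => SpaceTM.runCell (M.cycStep (H x)) (G x) (N x) (SpaceTM.lookTab (D x) (T x)) (s x)
      (r x) := by
  refine iterate (step := fun x => SpaceTM.iterStep (M.cycStep (H x)) (G x)
    (SpaceTM.lookTab (D x) (T x)) (s x)) ?_ hN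
    (ite_eq (fst hr) (const 1) (mk (const 0) (snd hr)) hr) (bd := fun x => tabBase (G x))
    (pow (add hG (const 4)) 27) ?_
  · exact iterStep M (hH.comp (fst id)) (hG.comp (fst id)) (hD.comp (fst id)) (hT.comp (fst id))
      (hs.comp (fst id)) (snd id)
  · intro x i _
    refine (enc_res_lt (iterStep_iterate_size (hG4 x) ?_ i)).le
    have := hrG x
    split_ifs with h
    · simp only [Res.size, h] at this ⊢; omega
    · exact this

end

end LSp

end SpaceTM

namespace SpaceTM

/-! ### Numerical simulation of machines on unary inputs -/

instance {A Γ B : Type} (M : Machine A Γ B) : Finite M.State := M.finite_state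

noncomputable instance {A Γ B : Type} (M : Machine A Γ B) : Enc M.State := encOfFinite _

/-- The effect of a move on the codes of the two halves of a tape: `l` is the code of the part to the
left of the head, `d` the digit under the head, and `r` the code of the part to the right. -/
def tapeMove (b l d r : ℕ) : Move → ℕ × ℕ
  | Move.left => (l / b, l % b + b * (d + b * r))
  | Move.stay => (l, d + b * r)
  | Move.right => (d + b * l, r)

/-- This turns blankness outside the window into a bound on the numbers that represent the two
halves of a working tape, the blank being the digit `0`. -/
theorem lt_pow_of_digits {b : ℕ} (hb : 2 ≤ b) (s x : ℕ) (h : ∀ j, s ≤ j → x / b ^ j % b = 0) :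
    x < b ^ s := by
  have key : ∀ y, (∀ j, y / b ^ j % b = 0) → y = 0 := by
    intro y
    induction y using Nat.strong_induction_on with
    | _ y ih =>
      intro hy
      by_contra hne
      have h0 : y % b = 0 := by simpa using hy 0
      have := ih (y / b) (Nat.div_lt_self (by omega) hb) fun j => by
        rw [Nat.div_div_eq_div_mul, ← pow_succ']; exact hy (j + 1)
      have h1 := Nat.div_add_mod y b
      rw [this, h0] at h1
      omega
  have h0 := key (x / b ^ s) fun j => by
    rw [Nat.div_div_eq_div_mul, ← pow_add]; exact h _ (by omega)
  exact (Nat.div_eq_zero_iff_lt (by positivity)).mp h0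

/-- `x` codes the sequence of digits `β` in base `b`. -/
def DigitsOf (b : ℕ) (β : ℕ → ℕ) (x : ℕ) : Prop := ∀ j, x / b ^ j % b = β j

theorem DigitsOf.tail {b : ℕ} {β : ℕ → ℕ} {x : ℕ} (h : DigitsOf b β x) :
    DigitsOf b (fun j => β (j + 1)) (x / b) := fun j => by
  rw [Nat.div_div_eq_div_mul, ← pow_succ', h]

theorem DigitsOf.cons {b : ℕ} {β : ℕ → ℕ} {x : ℕ} (h : DigitsOf b (fun j => β (j + 1)) x)
    (h0 : β 0 < b) : DigitsOf b β (β 0 + b * x) := by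
  rintro (_ | j)
  · rw [pow_zero, Nat.div_one, Nat.add_mul_mod_self_left, Nat.mod_eq_of_lt h0]
  · rw [pow_succ', ← Nat.div_div_eq_div_mul, Nat.add_mul_div_left _ _ (by omega),
      Nat.div_eq_of_lt h0, zero_add, h]

theorem tapeMove_spec {b l r : ℕ} {β : ℤ → ℕ} {p : ℤ} (hβ : ∀ z, β z < b)
    (hl : DigitsOf b (fun j => β (p - 1 - j)) l) (hr : DigitsOf b (fun j => β (p + 1 + j)) r)
    (m : Move) : DigitsOf b (fun j => β (moveWork p m - 1 - j)) (tapeMove b l (β p) r m).1 ∧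
      DigitsOf b (fun j => β (moveWork p m + j)) (tapeMove b l (β p) r m).2 := by
  have hr' : DigitsOf b (fun j => β (p + j)) (β p + b * r) := by
    have := DigitsOf.cons (b := b) (β := fun j => β (p + j)) (x := r) (by
      convert hr using 3; push_cast; ring) (hβ _)
    simpa using this
  cases m with
  | stay => exact ⟨hl, hr'⟩
  | left =>
    refine ⟨?_, ?_⟩
    · have := hl.tail
      intro j
      simp only [tapeMove, moveWork]
      rw [this j]
      push_cast
      ring_nf
    · have h0 := hl 0
      simp only [pow_zero, Nat.div_one, Nat.cast_zero, sub_zero] at h0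
      have := DigitsOf.cons (b := b) (β := fun j => β (p - 1 + j)) (x := β p + b * r) (by
        convert hr' using 3; push_cast; ring) (hβ _)
      simp only [tapeMove, moveWork, h0]
      simpa using this
  | right =>
    refine ⟨?_, hr⟩
    have := DigitsOf.cons (b := b) (β := fun j => β (p - j)) (x := l) (by
      convert hl using 3; push_cast; ring) (hβ _)
    simp only [tapeMove, moveWork, add_sub_cancel_right]
    simpa using this

/-- The number with a given binary representation. -/
def bitsVal (l : List Bool) : ℕ := Nat.ofDigits 2 (l.map Bool.toNat)

theorem bitsVal_append (l l' : List Bool) :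
    ((2 ^ (l ++ l').length, bitsVal (l ++ l')) : ℕ × ℕ) =
      pairMul (2 ^ l.length, bitsVal l) (2 ^ l'.length, bitsVal l') := by
  simp only [bitsVal, pairMul, List.map_append, Nat.ofDigits_append, List.length_append, pow_add,
    List.length_map]

theorem bitsVal_lt (l : List Bool) : bitsVal l < 2 ^ l.length := by
  have := Nat.ofDigits_lt_base_pow_length (b := 2) (l := l.map Bool.toNat) (by norm_num) (by
    intro x hx
    obtain ⟨b, _, rfl⟩ := List.mem_map.mp hx
    cases b <;> simp)
  simpa [bitsVal] using this

theorem bitsVal_bits (n : ℕ) : bitsVal n.bits = n := by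
  have h := Nat.ofDigits_digits 2 n
  rw [Nat.digits_two_eq_bits] at h
  rw [bitsVal]
  convert h using 3
  funext b; cases b <;> rfl

section Sim

variable {Γ : Type} [Finite Γ] (M : Machine Unit Γ Bool)

/-- The base of the representation of the working tape. -/
noncomputable def workBase (Γ : Type) : ℕ := Nat.card Γ + 1

open Classical in
/-- The digit that represents a working symbol: the blank is `0`. -/
noncomputable def Machine.workDigit (g : Γ) : ℕ := if g = M.blank then 0 else Finite.equivFin Γ g + 1

theorem Machine.workDigit_lt (g : Γ) : M.workDigit g < workBase Γ := by
  have := (Finite.equivFin Γ g).isLt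
  unfold workDigit workBase
  split_ifs <;> omega

theorem Machine.workDigit_injective : Function.Injective M.workDigit := by
  intro g g' h
  unfold workDigit at h
  split_ifs at h with h1 h2 h2
  · rw [h1, h2]
  · exact (Finite.equivFin Γ).injective (Fin.ext (by omega))

/-- The working symbol represented by a digit. -/
noncomputable def Machine.ofWorkDigit (d : ℕ) : Γ :=
  haveI : Nonempty Γ := ⟨M.blank⟩
  Function.invFun M.workDigit d

theorem Machine.ofWorkDigit_workDigit (g : Γ) : M.ofWorkDigit (M.workDigit g) = g :=
  haveI : Nonempty Γ := ⟨M.blank⟩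
  Function.leftInverse_invFun M.workDigit_injective g

theorem Machine.two_le_workBase (M : Machine Unit Γ Bool) : 2 ≤ workBase Γ := by
  have : Nonempty Γ := ⟨M.blank⟩
  have : 0 < Nat.card Γ := Nat.card_pos
  unfold workBase; omega

/-- The symbols on the input tape that holds a unary number. -/
def unarySym (n i : ℕ) : InputSym Unit :=
  if i = 0 then .leftEnd else if i ≤ n then .letter () else .rightEnd

theorem symAt_unary (n i : ℕ) : symAt (inputTape 0 (List.replicate n ())) i = unarySym n i := by
  unfold symAt unarySym inputTape
  rcases i with _ | i
  · simp
  · simp only [List.replicate_zero, List.nil_append, List.map_replicate, List.getD_cons_succ]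
    rw [if_neg (by omega)]
    split_ifs with h
    · rw [List.getD_append _ _ _ _ (by simpa using h), List.getD_replicate _ h]
    · rw [List.getD_append_right _ _ _ _ (by simp; omega)]
      rcases h2 : i - (List.replicate n (InputSym.letter ())).length with _ | k <;> simp

/-- Configurations of the simulation: the state, the position of the input head, the two halves of
the working tape, the output, and a status (`0`: running, `1`: halted, `2`: out of space). -/
abbrev Sim : Type := M.State × ℕ × (ℕ × ℕ) × (ℕ × ℕ) × ℕ

/-- The initial configuration. -/
def simInit : Sim M := (M.start, 0, (0, 0), (1, 0), 0)

/-- One step of the simulation, without a bound on the space. -/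
noncomputable def simNext (n : ℕ) (σ : Sim M) : Sim M :=
  if σ.2.2.2.2 = 0 then
    match M.step σ.1 (unarySym n σ.2.1) (M.ofWorkDigit (σ.2.2.1.2 % workBase Γ)) with
    | none => (σ.1, σ.2.1, σ.2.2.1, σ.2.2.2.1, 1)
    | some a => (a.next, moveInput (n + 2) σ.2.1 a.inputMove,
        tapeMove (workBase Γ) σ.2.2.1.1 (M.workDigit a.write) (σ.2.2.1.2 / workBase Γ) a.workMove,
        pairMul σ.2.2.2.1 (2 ^ a.output.toList.length, bitsVal a.output.toList), 0)
  else σ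

/-- One step of the simulation. -/
noncomputable def simStep (n Y : ℕ) (σ : Sim M) : Sim M :=
  if Enc.enc (simNext M n σ) ≤ Y then simNext M n σ else (M.start, 0, (0, 0), (0, 0), 2)

/-- The result of the simulation in bounded space and time. -/
noncomputable def simRun (n Y : ℕ) : Sim M := (simStep M n Y)^[Y] (simInit M)

/-- A configuration of the simulation represents a configuration of the machine. -/
def SimRel (σ : Sim M) (c : M.Config) : Prop :=
  σ.1 = c.state ∧ σ.2.1 = c.inputPos ∧
  DigitsOf (workBase Γ) (fun j => M.workDigit (c.work (c.workPos - 1 - j))) σ.2.2.1.1 ∧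
  DigitsOf (workBase Γ) (fun j => M.workDigit (c.work (c.workPos + j))) σ.2.2.1.2 ∧
  σ.2.2.2.1 = (2 ^ c.out.length, bitsVal c.out) ∧ σ.2.2.2.2 = 0

variable {M}

theorem simRel_init : SimRel M (simInit M) M.init := by
  refine ⟨rfl, rfl, fun j => ?_, fun j => ?_, rfl, rfl⟩ <;>
    simp [simInit, Machine.init, Machine.workDigit]

theorem SimRel.sym {σ : Sim M} {c : M.Config} (h : SimRel M σ c) (n : ℕ) :
    M.step σ.1 (unarySym n σ.2.1) (M.ofWorkDigit (σ.2.2.1.2 % workBase Γ)) =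
      M.action (inputTape 0 (List.replicate n ())) c := by
  obtain ⟨h1, h2, _, h4, _⟩ := h
  have := h4 0
  simp only [pow_zero, Nat.div_one, Nat.cast_zero, add_zero] at this
  rw [h1, h2, this, M.ofWorkDigit_workDigit, ← symAt_unary]
  rfl

theorem SimRel.next {σ : Sim M} {c : M.Config} (h : SimRel M σ c) {n : ℕ}
    {a : Action M.State Γ Bool}
    (ha : M.action (inputTape 0 (List.replicate n ())) c = some a) :
    SimRel M (simNext M n σ) (M.perform (inputTape 0 (List.replicate n ())) c a) := by
  have hs := h.sym n
  obtain ⟨h1, h2, h3, h4, h5, h6⟩ := h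
  unfold simNext
  rw [if_pos h6, hs, ha]
  have hlen : (inputTape 0 (List.replicate n ())).length = n + 2 := by simp [inputTape]
  have hne : ∀ z, z ≠ c.workPos → M.workDigit (Function.update c.work c.workPos a.write z) =
      M.workDigit (c.work z) := fun z hz => by rw [Function.update_of_ne hz]
  have ht := tapeMove_spec (b := workBase Γ) (l := σ.2.2.1.1) (r := σ.2.2.1.2 / workBase Γ)
    (β := fun z => M.workDigit (Function.update c.work c.workPos a.write z)) (p := c.workPos)
    (fun z => M.workDigit_lt _)
    (fun j => (h3 j).trans (hne _ (by omega)).symm)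
    (fun j => (h4.tail j).trans (by
      simp only
      rw [hne _ (by omega)]
      congr 2; push_cast; ring)) a.workMove
  simp only [Function.update_self] at ht
  refine ⟨rfl, ?_, ht.1, ht.2, ?_, rfl⟩
  · simp only [h2, Machine.perform, hlen]
  · simp only [h5, Machine.perform, bitsVal_append]

/-- The code of a configuration has pairings nested to depth five, each of which at most cubes the
bound; hence the exponent `243 = 3 ^ 5`. -/
theorem enc_sim_lt {σ : Sim M} {Z : ℕ} (hZ : M.numStates + 4 ≤ Z) (h1 : σ.2.1 < Z)
    (h2 : σ.2.2.1.1 < Z) (h3 : σ.2.2.1.2 < Z) (h4 : σ.2.2.2.1.1 < Z) (h5 : σ.2.2.2.1.2 < Z)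
    (h6 : σ.2.2.2.2 < Z) : Enc.enc σ < Z ^ 243 := by
  obtain ⟨q, i, ⟨l, r⟩, ⟨p, v⟩, t⟩ := σ
  simp only at h1 h2 h3 h4 h5 h6
  have h4Z : 4 ≤ Z := by omega
  have h0 : Enc.enc q < Z := by
    have := (Finite.equivFin M.State q).isLt
    have h : Enc.enc q = (Finite.equivFin M.State q : ℕ) := rfl
    unfold Machine.numStates at hZ
    omega
  have le : ∀ k, k ≠ 0 → ∀ x < Z, x < Z ^ k := fun k hk x hx => hx.trans_le (Nat.le_self_pow hk _)
  have le4 : ∀ k, k ≠ 0 → 4 ≤ Z ^ k := fun k hk => h4Z.trans (Nat.le_self_pow hk _)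
  have e1 : cpair p v < Z ^ 3 := cpair_lt_pow h4 h5 h4Z
  have e2 : cpair (cpair p v) t < (Z ^ 3) ^ 3 :=
    cpair_lt_pow e1 (le 3 (by omega) _ h6) (le4 3 (by omega))
  have e3 : cpair l r < Z ^ 3 := cpair_lt_pow h2 h3 h4Z
  rw [← pow_mul] at e2
  have e4 : cpair (cpair l r) (cpair (cpair p v) t) < (Z ^ (3 * 3)) ^ 3 :=
    cpair_lt_pow (e3.trans_le (Nat.pow_le_pow_right (by omega) (by omega))) e2 (le4 9 (by omega))
  rw [← pow_mul] at e4
  have e5 := cpair_lt_pow (le _ (by omega) _ h1) e4 (le4 _ (by omega))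
  rw [← pow_mul] at e5
  have e6 := cpair_lt_pow (le _ (by omega) _ h0) e5 (le4 _ (by omega))
  rw [← pow_mul] at e6
  exact e6

variable {n u s : ℕ}

theorem simNext_of_ne {σ : Sim M} (h : σ.2.2.2.2 ≠ 0) : simNext M n σ = σ := by
  unfold simNext; rw [if_neg h]

/-- The simulation follows a halting computation. -/
theorem exists_sim (h : M.HaltsWith (inputTape 0 (List.replicate n ())) (Nat.bits u) s) :
    ∃ T, (∀ k ≤ T, ((simNext M n)^[k] (simInit M)).2.2.2.2 = 0) ∧
      (∀ k, T < k → ((simNext M n)^[k] (simInit M)).2.2.2.2 = 1 ∧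
        ((simNext M n)^[k] (simInit M)).2.2.2.1.2 = u) ∧
      ∀ k, Enc.enc ((simNext M n)^[k] (simInit M)) <
        (M.numStates + n + workBase Γ ^ s + 2 ^ u.size + 4) ^ 243 := by
  obtain ⟨T, hT, hlt, hy, hcard⟩ := h.exists_first
  obtain ⟨a, ha⟩ := Machine.exists_window hcard
  have hblank := Machine.work_eq_blank ha
  have hrel : ∀ k ≤ T, SimRel M ((simNext M n)^[k] (simInit M))
      (M.run (inputTape 0 (List.replicate n ())) k) := by
    intro k
    induction k with
    | zero => exact fun _ => simRel_init
    | succ k ih =>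
      intro hk
      obtain ⟨b, hb⟩ := Option.ne_none_iff_exists'.mp (hlt k (by omega))
      rw [Function.iterate_succ_apply', M.run_succ_of_some _ hb]
      exact (ih (by omega)).next hb
  have hsucc : (simNext M n)^[T + 1] (simInit M) =
      (((simNext M n)^[T] (simInit M)).1, ((simNext M n)^[T] (simInit M)).2.1,
        ((simNext M n)^[T] (simInit M)).2.2.1, ((simNext M n)^[T] (simInit M)).2.2.2.1, 1) := by
    have hr := hrel T le_rfl
    have hs := hr.sym n
    rw [Function.iterate_succ_apply']
    generalize (simNext M n)^[T] (simInit M) = σ at *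
    rw [hT] at hs
    unfold simNext
    rw [if_pos hr.2.2.2.2.2, hs]
  have hlater : ∀ k, T < k → (simNext M n)^[k] (simInit M) =
      (simNext M n)^[T + 1] (simInit M) := by
    intro k hk
    obtain ⟨d, rfl⟩ := Nat.exists_eq_add_of_le' (show T + 1 ≤ k from hk)
    rw [Function.iterate_add_apply]
    refine Function.iterate_fixed (simNext_of_ne ?_) d
    rw [hsucc]; simp
  -- The output only grows, so its final length bounds it at all times.
  have hout : ∀ k ≤ T, (M.run (inputTape 0 (List.replicate n ())) k).out.length ≤ u.size := by
    have hmono : ∀ d ≤ T, (M.run (inputTape 0 (List.replicate n ())) (T - d)).out.length ≤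
        u.size := by
      intro d
      induction d with
      | zero => intro _; rw [Nat.sub_zero, hy, Nat.size_eq_bits_len]
      | succ d ih =>
        intro hd
        have := ih (by omega)
        obtain ⟨b, hb⟩ := Option.ne_none_iff_exists'.mp (hlt (T - (d + 1)) (by omega))
        rw [show T - d = T - (d + 1) + 1 by omega, M.run_succ_of_some _ hb] at this
        simp only [Machine.perform, List.length_append] at this
        omega
    intro k hk
    have := hmono (T - k) (by omega)
    rwa [Nat.sub_sub_self hk] at this
  have hpos : ∀ k ≤ T, (M.run (inputTape 0 (List.replicate n ())) k).inputPos ≤ n + 1 := by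
    intro k
    induction k with
    | zero => intro _; exact Nat.zero_le _
    | succ k ih =>
      intro hk
      have := ih (by omega)
      obtain ⟨b, hb⟩ := Option.ne_none_iff_exists'.mp (hlt k (by omega))
      rw [M.run_succ_of_some _ hb]
      have hlen : (inputTape 0 (List.replicate n ())).length = n + 2 := by simp [inputTape]
      simp only [Machine.perform, hlen]
      cases b.inputMove <;> simp only [moveInput] <;> omega
  have hbound : ∀ k ≤ T, ∀ t ≤ 1, Enc.enc ((((simNext M n)^[k] (simInit M)).1,
      ((simNext M n)^[k] (simInit M)).2.1, ((simNext M n)^[k] (simInit M)).2.2.1,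
      ((simNext M n)^[k] (simInit M)).2.2.2.1, t) : Sim M) <
        (M.numStates + n + workBase Γ ^ s + 2 ^ u.size + 4) ^ 243 := by
    intro k hk t ht
    obtain ⟨_, h2, h3, h4, h5, _⟩ := hrel k hk
    have hb := M.two_le_workBase
    have hd0 : M.workDigit M.blank = 0 := by simp [Machine.workDigit]
    have hw := ha k hk
    -- The head is in a window of `s` cells. On both sides, the cells at place `s` and beyond are
    -- outside the window and therefore blank.
    have hL := lt_pow_of_digits hb s _ fun j hj => by
      rw [h3 j]; simp only; rw [hblank k hk _ (by omega), hd0]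
    have hR := lt_pow_of_digits hb s _ fun j hj => by
      rw [h4 j]; simp only; rw [hblank k hk _ (by omega), hd0]
    have ho : 2 ^ (M.run (inputTape 0 (List.replicate n ())) k).out.length ≤ 2 ^ u.size :=
      Nat.pow_le_pow_right (by omega) (hout k hk)
    have hv := bitsVal_lt (M.run (inputTape 0 (List.replicate n ())) k).out
    have hp := hpos k hk
    refine enc_sim_lt (by omega) ?_ ?_ ?_ ?_ ?_ ?_
    · simp only [h2]; omega
    · simp only; omega
    · simp only; omega
    · simp only [h5]; omega
    · simp only [h5]; omega
    · simp only; omega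
  refine ⟨T, fun k hk => (hrel k hk).2.2.2.2.2, fun k hk => ?_, fun k => ?_⟩
  · rw [hlater k hk, hsucc]
    refine ⟨rfl, ?_⟩
    simp only [(hrel T le_rfl).2.2.2.2.1, hy, bitsVal_bits]
  · rcases Nat.lt_or_ge T k with hk | hk
    · rw [hlater k hk, hsucc]
      exact hbound T le_rfl 1 le_rfl
    · have := hbound k hk 0 (by omega)
      rwa [← (hrel k hk).2.2.2.2.2] at this

theorem simStep_iterate (Y k : ℕ) : (simStep M n Y)^[k] (simInit M) = (simNext M n)^[k] (simInit M) ∨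
    ((simStep M n Y)^[k] (simInit M)).2.2.2.2 = 2 := by
  induction k with
  | zero => exact Or.inl rfl
  | succ k ih =>
    rw [Function.iterate_succ_apply', Function.iterate_succ_apply']
    rcases ih with ih | ih
    · rw [ih]
      unfold simStep
      split_ifs
      · exact Or.inl rfl
      · exact Or.inr rfl
    · generalize (simStep M n Y)^[k] (simInit M) = σ at ih ⊢
      unfold simStep
      rw [simNext_of_ne (n := n) (show σ.2.2.2.2 ≠ 0 by omega)]
      split_ifs
      · exact Or.inr ih
      · exact Or.inr rfl

/-- Status `1` can only come from the unbounded simulation, since the bounded one either agrees with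
it or ends in status `2`. So a reported success is trustworthy for every `Y`. -/
theorem simRun_sound (h : M.HaltsWith (inputTape 0 (List.replicate n ())) (Nat.bits u) s) {Y : ℕ}
    (hY : (simRun M n Y).2.2.2.2 = 1) : (simRun M n Y).2.2.2.1.2 = u := by
  obtain ⟨T, h0, h1, _⟩ := exists_sim h
  unfold simRun at hY ⊢
  rcases simStep_iterate (M := M) (n := n) Y Y with he | he
  · rw [he] at hY ⊢
    rcases Nat.lt_or_ge T Y with hk | hk
    · exact (h1 _ hk).2
    · rw [h0 _ hk] at hY; omega
  · omega

/-- One number `Y` bounds both the codes and the number of steps: the configurations before halting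
are distinct and have codes below `Y`, so there are at most `Y` of them. -/
theorem simRun_complete (h : M.HaltsWith (inputTape 0 (List.replicate n ())) (Nat.bits u) s) {Y : ℕ}
    (hY : (M.numStates + n + workBase Γ ^ s + 2 ^ u.size + 4) ^ 243 ≤ Y) :
    (simRun M n Y).2.2.2.2 = 1 := by
  obtain ⟨T, h0, h1, hb⟩ := exists_sim h
  have hstep : ∀ k, (simStep M n Y)^[k] (simInit M) = (simNext M n)^[k] (simInit M) := by
    intro k
    induction k with
    | zero => rfl
    | succ k ih =>
      rw [Function.iterate_succ_apply', ih, Function.iterate_succ_apply']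
      have := hb (k + 1)
      rw [Function.iterate_succ_apply'] at this
      unfold simStep
      rw [if_pos (by omega)]
  -- If configurations `i < j ≤ T` were equal, the halted configuration after `T + 1` steps would
  -- equal an earlier one that is still running.
  have hinj : ∀ i j, i < j → j ≤ T →
      (simNext M n)^[i] (simInit M) ≠ (simNext M n)^[j] (simInit M) := by
    intro i j hij hj he
    have h2 := (h1 (T + 1 - j + j) (by omega)).1
    rw [Function.iterate_add_apply, ← he, ← Function.iterate_add_apply, h0 _ (by omega)] at h2
    omega
  have hcard : (Finset.range (T + 1)).card ≤ (Finset.range Y).card := by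
    refine Finset.card_le_card_of_injOn (fun k => Enc.enc ((simNext M n)^[k] (simInit M)))
      (fun k _ => ?_) (fun i hi j hj he => ?_)
    · have := hb k
      simp only [Finset.coe_range, Set.mem_Iio]; omega
    · simp only [Finset.coe_range, Set.mem_Iio] at hi hj
      have he := Enc.inj he
      rcases lt_trichotomy i j with hlt | heq | hgt
      · exact absurd he (hinj i j hlt (by omega))
      · exact heq
      · exact absurd he.symm (hinj j i hgt (by omega))
  rw [Finset.card_range, Finset.card_range] at hcard
  unfold simRun
  rw [hstep]
  exact (h1 Y (by omega)).1

variable (M) in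
theorem LSp.simRun {γ : Type} [Enc γ] {n Y : γ → ℕ} (hn : LSp n) (hY : LSp Y) :
    LSp fun x => SpaceTM.simRun M (n x) (Y x) := by
  have hsym : ∀ {δ : Type} [Enc δ] {m i : δ → ℕ}, LSp m → LSp i →
      LSp fun x => unarySym (m x) (i x) := fun hm hi =>
    ite_zero hi (const _) (ite_le hi hm (const _) (const _))
  have hb := M.two_le_workBase
  have hnext : LSp fun p : γ × Sim M => simNext M (n p.1) p.2 := by
    have hσ : LSp fun p : γ × Sim M => p.2 := snd id
    have hn' : LSp fun p : γ × Sim M => n p.1 := hn.comp (fst id)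
    have hpos : LSp fun p : γ × Sim M => p.2.2.1 := fst (snd hσ)
    have hl : LSp fun p : γ × Sim M => p.2.2.2.1.1 := fst (fst (snd (snd hσ)))
    have hr : LSp fun p : γ × Sim M => p.2.2.2.1.2 := snd (fst (snd (snd hσ)))
    have hv : LSp fun p : γ × Sim M => p.2.2.2.2.1 := fst (snd (snd (snd hσ)))
    have hf : LSp fun p : γ × Sim M => p.2.2.2.2.2 := snd (snd (snd (snd hσ)))
    have hidx : LSp fun p : γ × Sim M => (p.2.1, unarySym (n p.1) p.2.2.1,
        (⟨p.2.2.2.1.2 % workBase Γ, Nat.mod_lt _ (by omega)⟩ : Fin (workBase Γ))) :=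
      mk (fst hσ) (mk (hsym hn' hpos) (modFin hr (by omega)))
    refine ite_zero hf (cases (f := fun (a : M.State × InputSym Unit × Fin (workBase Γ))
      (p : γ × Sim M) => match M.step a.1 a.2.1 (M.ofWorkDigit a.2.2) with
        | none => (p.2.1, p.2.2.1, p.2.2.2.1, p.2.2.2.2.1, 1)
        | some a => (a.next, moveInput (n p.1 + 2) p.2.2.1 a.inputMove,
            tapeMove (workBase Γ) p.2.2.2.1.1 (M.workDigit a.write) (p.2.2.2.1.2 / workBase Γ)
              a.workMove,
            SpaceTM.pairMul p.2.2.2.2.1 (2 ^ a.output.toList.length, bitsVal a.output.toList), 0))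
      hidx ?_) hσ
    rintro ⟨q, i, d⟩
    simp only
    rcases M.step q i (M.ofWorkDigit d) with _ | a
    · exact mk (fst hσ) (mk hpos (mk (mk hl hr) (mk hv (const 1))))
    · have hr' := div hr (const (workBase Γ))
      have hdr : LSp fun p : γ × Sim M => M.workDigit a.write + workBase Γ *
          (p.2.2.2.1.2 / workBase Γ) := add (const _) (mul (const _) hr')
      refine mk (const _) (mk ?_ (mk ?_ (mk (pairMul hv (const _)) (const 0))))
      · rcases a.inputMove with _ | _ | _
        · exact sub hpos (const 1)
        · exact hpos
        · exact min (succ hpos) (sub (add hn' (const 2)) (const 1))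
      · rcases a.workMove with _ | _ | _
        · exact mk (div hl (const _)) (add (mod hl (const _)) (mul (const _) hdr))
        · exact mk hl hdr
        · exact mk (add (const _) (mul (const _) hl)) hr'
  refine iterate (step := fun x => simStep M (n x) (Y x))
    (ite_le (enc hnext) (hY.comp (fst id)) hnext (const _)) hY (const _)
    (bd := fun x => Y x + (Enc.enc (simInit M) +
      Enc.enc ((M.start, 0, (0, 0), (0, 0), 2) : Sim M))) (add hY (const _)) ?_
  -- After at least one step, a state has either passed the test against `Y x` or is the failure
  -- state.
  intro x i _
  rcases i with _ | i
  · simp only [Function.iterate_zero, _root_.id]; omega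
  · rw [Function.iterate_succ_apply']
    unfold simStep
    split_ifs <;> omega

end Sim

end SpaceTM

namespace SpaceTM

/-! ### The parameters of the one-way simulation -/

/-- A power, bounded by `Y`. -/
def bpow (Y b e : ℕ) : ℕ := (fun a => min Y (a * b))^[e] 1

theorem bpow_eq {Y b : ℕ} (hY : 1 ≤ Y) (hb : 1 ≤ b) (e : ℕ) : bpow Y b e = min Y (b ^ e) := by
  unfold bpow
  induction e with
  | zero => simp [hY]
  | succ e ih =>
    rw [Function.iterate_succ_apply', ih, pow_succ]
    rcases le_total Y (b ^ e) with h | h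
    · have h1 : Y * 1 ≤ Y * b := Nat.mul_le_mul_left _ hb
      have h2 : b ^ e * 1 ≤ b ^ e * b := Nat.mul_le_mul_left _ hb
      rw [min_eq_left h, min_eq_left (by omega), min_eq_left (by omega)]
    · rw [min_eq_right h]

/-- A result strictly below the cap certifies that the cap never acted. This lets the search
recognize exact parameters without knowing them beforehand. -/
theorem bpow_of_lt {Y b e : ℕ} (hb : 1 ≤ b) (h : bpow Y b e < Y) : bpow Y b e = b ^ e := by
  have := bpow_eq (show 1 ≤ Y by omega) hb e
  omega

theorem LSp.bpow {γ : Type} [Enc γ] {Y b e : γ → ℕ} (hY : LSp Y) (hb : LSp b) (he : LSp e) :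
    LSp fun x => SpaceTM.bpow (Y x) (b x) (e x) := by
  refine iterate (step := fun x a => Min.min (Y x) (a * b x))
    (min (hY.comp (fst id)) (mul (snd id) (hb.comp (fst id)))) he (const 1)
    (bd := fun x => Y x + 1) (succ hY) ?_
  intro x i _
  simp only [Enc.enc]
  rcases i with _ | i
  · simp
  · rw [Function.iterate_succ_apply']
    have := Nat.min_le_left (Y x) ((fun a => Min.min (Y x) (a * b x))^[i] 1 * b x)
    omega

theorem one_le_outBase (B : Type) : 1 ≤ outBase B := by unfold outBase; omega

section Params

variable {A B Γ₁ Γ₂ : Type} [Finite Γ₁] [Finite Γ₂]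
  (M : Machine A Bool B) (M₁ : Machine Unit Γ₁ Bool) (M₂ : Machine Unit Γ₂ Bool)

/-- The parameters of the simulation on inputs of length `n`, computed in space `log Y`: half the
number of words on the cyclic tape, a bound on outputs, the number of configurations, and a bound on
tables. -/
abbrev Params : Type := ℕ × ℕ × ℕ × ℕ

/-- The parameters for given lengths of the cyclic tape and of the output. -/
noncomputable def paramsOf (Y f l : ℕ) : Params :=
  (bpow Y 2 (f - 1), M.numStates * bpow Y 2 f + 2 * bpow Y (outBase B) l,
    M.numStates * bpow Y 2 f,
    bpow Y (tabBase (M.numStates * bpow Y 2 f + 2 * bpow Y (outBase B) l + 4))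
      (M.numStates * bpow Y 2 f))

/-- The parameters for inputs of length `n`. -/
noncomputable def params (n Y : ℕ) : Params :=
  paramsOf M Y (simRun M₁ n Y).2.2.2.1.2 (simRun M₂ n Y).2.2.2.1.2

/-- This number is `0` if the space suffices for the computation of the parameters. -/
noncomputable def paramsFail (n Y : ℕ) : ℕ :=
  if (simRun M₁ n Y).2.2.2.2 = 1 then
    if (simRun M₂ n Y).2.2.2.2 = 1 then
      (bpow Y 2 (simRun M₁ n Y).2.2.2.1.2 + 1 - Y) +
      (bpow Y (outBase B) (simRun M₂ n Y).2.2.2.1.2 + 1 - Y) +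
      ((params M M₁ M₂ n Y).2.2.2 + 1 - Y)
    else 1
  else 1

/-- The exact parameters. -/
noncomputable def exactParams (f l : ℕ) : Params :=
  (2 ^ (f - 1), M.numStates * 2 ^ f + 2 * outBase B ^ l, M.numStates * 2 ^ f,
    tabBase (M.numStates * 2 ^ f + 2 * outBase B ^ l + 4) ^ (M.numStates * 2 ^ f))

theorem one_le_tabBase (G : ℕ) : 1 ≤ tabBase (G + 4) := Nat.one_le_pow _ _ (by omega)

variable {M M₁ M₂}

/-- The summands of `paramsFail` are truncated differences `a + 1 - Y`, which vanish exactly if `a <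
Y`, that is, if no capped power reached its cap. The bound on tables is judged last, since it is
built from the other powers. Any successful `Y` will do; success need not be monotone in `Y`. -/
theorem params_of_fail {n Y f l s₁ s₂ : ℕ} (hf : 1 ≤ f)
    (h₁ : M₁.HaltsWith (inputTape 0 (List.replicate n ())) (Nat.bits f) s₁)
    (h₂ : M₂.HaltsWith (inputTape 0 (List.replicate n ())) (Nat.bits l) s₂)
    (h : paramsFail M M₁ M₂ n Y = 0) :
    params M M₁ M₂ n Y = exactParams M f l ∧ (exactParams M f l).2.2.2 < Y := by
  unfold paramsFail at h
  split_ifs at h with e1 e2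
  have v1 := simRun_sound h₁ e1
  have v2 := simRun_sound h₂ e2
  unfold params at h ⊢
  rw [v1, v2] at h ⊢
  have hY : 1 ≤ Y := by omega
  have b2 := bpow_of_lt (Y := Y) (b := 2) (e := f) (by norm_num) (by omega)
  have bl := bpow_of_lt (Y := Y) (e := l) (one_le_outBase B) (by omega)
  have b1 : bpow Y 2 (f - 1) = 2 ^ (f - 1) := by
    have hle : (2 : ℕ) ^ (f - 1) ≤ 2 ^ f := Nat.pow_le_pow_right (by norm_num) (by omega)
    rw [bpow_eq hY (by norm_num)]
    rw [b2] at h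
    omega
  have bw : (paramsOf M Y f l).2.2.2 < Y := by omega
  simp only [paramsOf, b2, bl, b1] at bw ⊢
  have key := bpow_of_lt (one_le_tabBase _) bw
  rw [key] at bw ⊢
  exact ⟨rfl, bw⟩

theorem paramsFail_eq_zero {n Y f l s₁ s₂ : ℕ}
    (h₁ : M₁.HaltsWith (inputTape 0 (List.replicate n ())) (Nat.bits f) s₁)
    (h₂ : M₂.HaltsWith (inputTape 0 (List.replicate n ())) (Nat.bits l) s₂)
    (hY₁ : (M₁.numStates + n + workBase Γ₁ ^ s₁ + 2 ^ f.size + 4) ^ 243 ≤ Y)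
    (hY₂ : (M₂.numStates + n + workBase Γ₂ ^ s₂ + 2 ^ l.size + 4) ^ 243 ≤ Y)
    (hY₃ : 2 ^ f < Y) (hY₄ : outBase B ^ l < Y) (hY₅ : (exactParams M f l).2.2.2 < Y) :
    paramsFail M M₁ M₂ n Y = 0 := by
  have e1 := simRun_complete h₁ hY₁
  have e2 := simRun_complete h₂ hY₂
  have v1 := simRun_sound h₁ e1
  have v2 := simRun_sound h₂ e2
  unfold paramsFail params
  rw [if_pos e1, if_pos e2, v1, v2]
  have hY : 1 ≤ Y := by omega
  have b2 : bpow Y 2 f = 2 ^ f := by rw [bpow_eq hY (by norm_num)]; omega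
  have bl : bpow Y (outBase B) l = outBase B ^ l := by rw [bpow_eq hY (one_le_outBase B)]; omega
  simp only [paramsOf, exactParams, b2, bl] at hY₅ ⊢
  rw [bpow_eq hY (one_le_tabBase _)]
  omega

variable (M M₁ M₂) in
theorem LSp.params {γ : Type} [Enc γ] {n Y : γ → ℕ} (hn : LSp n) (hY : LSp Y) :
    LSp fun x => SpaceTM.params M M₁ M₂ (n x) (Y x) := by
  have v1 := fst (snd (snd (snd (simRun M₁ hn hY)))) |>.snd
  have v2 := fst (snd (snd (snd (simRun M₂ hn hY)))) |>.snd
  have b2 := mul (const M.numStates) (bpow hY (const 2) v1)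
  have bg := add b2 (mul (const 2) (bpow hY (const (outBase B)) v2))
  exact mk (bpow hY (const 2) (sub v1 (const 1))) (mk bg (mk b2
    (bpow hY (pow (add (add bg (const 4)) (const 4)) 27) b2)))

variable (M M₁ M₂) in
theorem LSp.paramsFail {γ : Type} [Enc γ] {n Y : γ → ℕ} (hn : LSp n) (hY : LSp Y) :
    LSp fun x => SpaceTM.paramsFail M M₁ M₂ (n x) (Y x) := by
  have s1 := simRun M₁ hn hY
  have s2 := simRun M₂ hn hY
  have v1 := fst (snd (snd (snd s1))) |>.snd
  have v2 := fst (snd (snd (snd s2))) |>.snd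
  refine ite_eq (snd (snd (snd (snd s1)))) (const 1) (ite_eq (snd (snd (snd (snd s2)))) (const 1)
    ?_ (const 1)) (const 1)
  exact add (add (sub (succ (bpow hY (const 2) v1)) hY)
    (sub (succ (bpow hY (const (outBase B)) v2)) hY))
    (sub (succ (snd (snd (snd (params M M₁ M₂ hn hY))))) hY)

end Params

/-! ### The one-way simulation at a cell -/

section Update

variable {A B : Type} [Finite B] (M : Machine A Bool B)

/-- The simulation at a cell with the table `T`, started with the result `E`. -/
noncomputable def cellRes (p : Params) (s : InputSym A) (T : ℕ) (E : Res) : Res :=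
  runCell (M.cycStep p.1) (p.2.1 + 4) p.2.2.1 (lookTab (tabBase (p.2.1 + 4)) T) s
    (guardRes (p.2.1 + 4) E)

/-- The table for the computations to the left of the next cell. -/
noncomputable def cellTab (p : Params) (s : InputSym A) (T : ℕ) : ℕ :=
  mkTab (tabBase (p.2.1 + 4)) p.2.2.2 p.2.2.1 fun x => cellRes M p s T (1, x, 1, 0)

/-- The table for the first cell. -/
noncomputable def initTab (p : Params) : ℕ :=
  mkTab (tabBase (p.2.1 + 4)) p.2.2.2 p.2.2.1 fun x => guardRes (p.2.1 + 4) (1, x, 1, 0)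

theorem LSp.cellRes [Finite A] {γ : Type} [Enc γ] {p : γ → Params} {s : γ → InputSym A} {T : γ → ℕ}
    {E : γ → Res} (hp : LSp p) (hs : LSp s) (hT : LSp T) (hE : LSp E) :
    LSp fun x => SpaceTM.cellRes M (p x) (s x) (T x) (E x) := by
  have hG : LSp fun x => (p x).2.1 + 4 := add (fst (snd hp)) (const 4)
  exact runCell M (fst hp) hG (fst (snd (snd hp))) (pow (add hG (const 4)) 27) hT hs
    (guardRes hG hE) (fun x => by omega) (fun x => guardRes_size (by omega) _)

theorem LSp.cellTab [Finite A] {γ : Type} [Enc γ] {p : γ → Params} {s : γ → InputSym A} {T : γ → ℕ}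
    (hp : LSp p) (hs : LSp s) (hT : LSp T) : LSp fun x => SpaceTM.cellTab M (p x) (s x) (T x) := by
  have hG : LSp fun x => (p x).2.1 + 4 := add (fst (snd hp)) (const 4)
  refine mkTab (pow (add hG (const 4)) 27) (snd (snd (snd hp))) (fst (snd (snd hp)))
    (R := fun x y => SpaceTM.cellRes M (p x) (s x) (T x) (1, y, 1, 0)) ?_
  exact cellRes M (hp.comp (fst id)) (hs.comp (fst id)) (hT.comp (fst id))
    (mk (const 1) (mk (snd id) (const (1, 0))))

theorem LSp.initTab {γ : Type} [Enc γ] {p : γ → Params} (hp : LSp p) :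
    LSp fun x => SpaceTM.initTab (p x) := by
  have hG : LSp fun x => (p x).2.1 + 4 := add (fst (snd hp)) (const 4)
  exact mkTab (pow (add hG (const 4)) 27) (snd (snd (snd hp))) (fst (snd (snd hp)))
    (R := fun x y => SpaceTM.guardRes ((p x).2.1 + 4) (1, y, 1, 0))
    (guardRes (hG.comp (fst id)) (mk (const 1) (mk (snd id) (const (1, 0)))))

variable {M}

theorem cellRes_size (p : Params) (s : InputSym A) (T : ℕ) (E : Res) :
    (cellRes M p s T E).size ≤ p.2.1 + 4 :=
  runCell_size (by omega) _ (guardRes_size (by omega) _)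

namespace TwoWayRun

variable {tape : List (InputSym A)} {T f L : ℕ} {pos c : ℕ → ℕ} {mv : ℕ → Move} {e : ℕ → Option B}
  {out : ℕ → List B}

theorem cellSpec_congr {cs : InputSym A → ℕ → Option (Move × ℕ × Option B)} {N : ℕ}
    (h : TwoWayRun cs tape N T pos c mv e out) {i : ℕ} {R R' : ℕ → Res}
    (hR : CellSpec T pos c mv out i R) (heq : ∀ x < N, R' x = R x) :
    CellSpec T pos c mv out i R' := fun u hu hp => by
  rw [heq _ (h.lt u hu)]; exact hR u hu hp

theorem lookSpec_initTab
    (h : TwoWayRun (M.cycStep (exactParams M f L).1) tape (exactParams M f L).2.2.1 T pos c mv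
      e out) :
    LookSpec T pos c mv out 0 (lookTab (tabBase ((exactParams M f L).2.1 + 4))
      (initTab (exactParams M f L))) := by
  refine h.lookSpec_zero fun x hx => ?_
  have hsize : guardRes ((exactParams M f L).2.1 + 4) (1, x, 1, 0) = (1, x, 1, 0) := by
    unfold guardRes
    rw [if_pos]
    have : (exactParams M f L).2.2.1 ≤ (exactParams M f L).2.1 := Nat.le_add_right _ _
    simp only [Res.size]; omega
  unfold initTab
  rw [lookTab_mkTab (fun y _ => enc_res_lt (guardRes_size (by omega) _)) ?_ hx, hsize]
  exact le_rfl

theorem cellRes_correct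
    (h : TwoWayRun (M.cycStep (exactParams M f L).1) tape (exactParams M f L).2.2.1 T pos c mv
      e out) {i tab : ℕ}
    (hLk : LookSpec T pos c mv out i (lookTab (tabBase ((exactParams M f L).2.1 + 4)) tab))
    {u : ℕ} (hu : u ≤ T) (hp : pos u = i) {l : List B}
    (hl : l.length + ((out T).length - (out u).length) ≤ L) :
    Correct T pos c mv out i u l
      (cellRes M (exactParams M f L) (symAt tape i) tab (1, c u, outPair l)) := by
  have hG : (exactParams M f L).2.2.1 + 2 * outBase B ^ L + 3 ≤ (exactParams M f L).2.1 + 4 := by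
    simp only [exactParams]; omega
  unfold cellRes
  rw [guardRes_eq hG (by omega) (h.lt u hu) (by omega)]
  exact h.runCell_correct hLk hG hu hp hl

/-- The entries of a table carry only the output produced since the entry into the cell. So each
simulation for the table starts with empty accumulated output, and `L` bounds all outputs that
occur. -/
theorem lookSpec_cellTab
    (h : TwoWayRun (M.cycStep (exactParams M f L).1) tape (exactParams M f L).2.2.1 T pos c mv
      e out) (hL : (out T).length ≤ L) {i tab : ℕ} (hi : i + 1 < tape.length)
    (hLk : LookSpec T pos c mv out i (lookTab (tabBase ((exactParams M f L).2.1 + 4)) tab)) :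
    LookSpec T pos c mv out (i + 1) (lookTab (tabBase ((exactParams M f L).2.1 + 4))
      (cellTab M (exactParams M f L) (symAt tape i) tab)) := by
  refine h.lookSpec_succ hi (h.cellSpec_congr (R := fun x =>
    cellRes M (exactParams M f L) (symAt tape i) tab (1, x, 1, 0)) (fun u hu hp => ?_) ?_)
  · exact h.cellRes_correct hLk hu hp (l := []) (by simp; omega)
  · intro x hx
    exact lookTab_mkTab (fun y _ => enc_res_lt (cellRes_size _ _ _ _)) le_rfl hx

/-- The simulation at a cell, started at a time `u`, ends with the end of the computation or with
the next time at which the cell is left to the right. -/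
theorem cellRes_eq
    (h : TwoWayRun (M.cycStep (exactParams M f L).1) tape (exactParams M f L).2.2.1 T pos c mv
      e out) (hL : (out T).length ≤ L) {i tab : ℕ}
    (hLk : LookSpec T pos c mv out i (lookTab (tabBase ((exactParams M f L).2.1 + 4)) tab))
    {u : ℕ} (hu : u ≤ T) (hp : pos u = i) :
    cellRes M (exactParams M f L) (symAt tape i) tab (1, c u, outPair (out u)) =
      (2, c T, outPair (out T)) ∨
    ∃ w, u < w ∧ w ≤ T ∧ pos w = moveInput tape.length i .right ∧
      cellRes M (exactParams M f L) (symAt tape i) tab (1, c u, outPair (out u)) =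
        (1, c w, outPair (out w)) := by
  classical
  have hle := h.out_length_le hu le_rfl
  have hc := h.cellRes_correct hLk hu hp (l := out u) (by omega)
  by_cases hex : ∃ w, u ≤ w ∧ w < T ∧ pos w = i ∧ mv w = .right
  · obtain ⟨h1, h2, h3, h4⟩ := Nat.find_spec hex
    right
    obtain ⟨d, hd⟩ := h.exists_out (Nat.find hex + 1) (show u ≤ Nat.find hex + 1 by omega) (by omega)
    refine ⟨Nat.find hex + 1, by omega, by omega, ?_, ?_⟩
    · rw [h.pos_succ _ h2, h3, h4]
    · rw [hc.1 (Nat.find hex) d ⟨h1, h2, h3, h4, fun w hw1 hw2 hw3 =>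
        Nat.find_min hex hw2 ⟨hw1, by omega, hw3⟩⟩ hd, hd]
  · left
    obtain ⟨d, hd⟩ := h.exists_out T hu le_rfl
    rw [hc.2 d (fun w hw1 hw2 hw3 => hex ⟨w, hw1, hw2, hw3⟩) hd, hd]

end TwoWayRun

end Update

end SpaceTM

namespace SpaceTM

/-! ### The online machine -/

/-- Data of the one-way simulation: the length of the input and the space that is available for the
parameters, the table, and the result of the simulation so far. -/
abbrev OnData : Type := (ℕ × ℕ) × ℕ × Res

/-- States of the one-way simulation: the phase and the data. -/
abbrev OnState : Type := Fin 5 × OnData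

section Online

variable {A B Γ₁ Γ₂ : Type} [Finite A] [Finite B] [Finite Γ₁] [Finite Γ₂]
  (M : Machine A Bool B) (M₁ : Machine Unit Γ₁ Bool) (M₂ : Machine Unit Γ₂ Bool)

/-- The length of the input is found by counting the empty cells. -/
def onCount (s : InputSym A) (x : OnData) : OnState × Act B :=
  match s with
  | .leftEnd => ((0, x), .adv)
  | .empty => ((0, (x.1.1 + 1, x.1.2), x.2), .adv)
  | _ => ((1, x), .cont)

/-- Search for space that suffices for the computation of the parameters. -/
noncomputable def onSearch (x : OnData) : OnState × Act B :=
  if paramsFail M M₁ M₂ x.1.1 x.1.2 = 0 then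
    ((2, x.1, initTab (params M M₁ M₂ x.1.1 x.1.2), (1, M.stateCode M.start, 1, 0)), .cont)
  else ((1, (x.1.1, x.1.2 + 1), x.2), .cont)

/-- The simulation at the left marker. -/
noncomputable def onFirst (x : OnData) : OnState × Act B :=
  ((3, x.1, cellTab M (params M M₁ M₂ x.1.1 x.1.2) .leftEnd x.2.1,
      cellRes M (params M M₁ M₂ x.1.1 x.1.2) .leftEnd x.2.1 x.2.2), .cont)

/-- The simulation at the other cells. -/
noncomputable def onCell (s : InputSym A) (x : OnData) : OnState × Act B :=
  if x.2.2.1 = 1 then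
    ((3, x.1, (match s with
          | .rightEnd => x.2.1
          | s => cellTab M (params M M₁ M₂ x.1.1 x.1.2) s x.2.1),
        cellRes M (params M M₁ M₂ x.1.1 x.1.2) s x.2.1 x.2.2), .adv)
  else ((4, x), .cont)

/-- The output is written. -/
noncomputable def onEmit (x : OnData) : OnState × Act B :=
  if x.2.2.2.2.1 ≤ 1 then ((4, x), .halt)
  else ((4, x.1, x.2.1, x.2.2.1, x.2.2.2.1, x.2.2.2.2.1 / outBase B, x.2.2.2.2.2 / outBase B),
      if h : x.2.2.2.2.2 % outBase B < Nat.card B then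
        .emit ((Finite.equivFin B).symm ⟨x.2.2.2.2.2 % outBase B, h⟩)
      else .halt)

/-- The transitions of the one-way simulation. -/
noncomputable def onStep (p : OnState × InputSym A) : OnState × Act B :=
  match p.1.1 with
  | 0 => onCount p.2 p.1.2
  | 1 => onSearch M M₁ M₂ p.1.2
  | 2 => onFirst M M₁ M₂ p.1.2
  | 3 => onCell M M₁ M₂ p.2 p.1.2
  | 4 => onEmit p.1.2

namespace LSp

theorem onCount (s : InputSym A) : LSp (onCount s : OnData → OnState × Act B) := by
  rcases s with _ | _ | _ | a
  · exact mk (mk (const _) id) (const _)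
  · exact mk (mk (const _) id) (const _)
  · exact mk (mk (const _) (mk (mk (succ (fst (fst id))) (snd (fst id))) (snd id))) (const _)
  · exact mk (mk (const _) id) (const _)

theorem onSearch : LSp (onSearch M M₁ M₂ : OnData → OnState × Act B) :=
  ite_zero (paramsFail M M₁ M₂ (fst (fst id)) (snd (fst id)))
    (mk (mk (const _) (mk (fst id)
      (mk (initTab (params M M₁ M₂ (fst (fst id)) (snd (fst id)))) (const _)))) (const _))
    (mk (mk (const _) (mk (mk (fst (fst id)) (succ (snd (fst id)))) (snd id))) (const _))

theorem onFirst : LSp (onFirst M M₁ M₂ : OnData → OnState × Act B) := by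
  have hp := params M M₁ M₂ (γ := OnData) (fst (fst id)) (snd (fst id))
  exact mk (mk (const _) (mk (fst id) (mk (cellTab M hp (const _) (fst (snd id)))
    (cellRes M hp (const _) (fst (snd id)) (snd (snd id)))))) (const _)

theorem onCell (s : InputSym A) : LSp (onCell M M₁ M₂ s : OnData → OnState × Act B) := by
  have hp := params M M₁ M₂ (γ := OnData) (fst (fst id)) (snd (fst id))
  have hT : LSp fun x : OnData => x.2.1 := fst (snd id)
  have hE : LSp fun x : OnData => x.2.2 := snd (snd id)
  refine ite_eq (fst hE) (const 1) (mk (mk (const _) (mk (fst id) (mk ?_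
    (cellRes M hp (const _) hT hE)))) (const _)) (mk (mk (const _) id) (const _))
  rcases s with _ | _ | _ | a
  · exact cellTab M hp (const _) hT
  · exact hT
  · exact cellTab M hp (const _) hT
  · exact cellTab M hp (const _) hT

theorem onEmit : LSp (onEmit : OnData → OnState × Act B) := by
  have hE : LSp fun x : OnData => x.2.2 := snd (snd id)
  have hP : LSp fun x : OnData => x.2.2.2.2.1 := fst (snd (snd hE))
  have hv : LSp fun x : OnData => x.2.2.2.2.2 := snd (snd (snd hE))
  have hb := one_le_outBase B
  refine ite_le hP (const 1) (mk (mk (const _) id) (const _)) (mk (mk (const _)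
    (mk (fst id) (mk (fst (snd id)) (mk (fst hE) (mk (fst (snd hE)) (mk
      (div hP (const _)) (div hv (const _)))))))) ?_)
  exact cases (f := fun (d : Fin (outBase B)) (_ : OnData) =>
    if h : (d : ℕ) < Nat.card B then (.emit ((Finite.equivFin B).symm ⟨d, h⟩) : Act B)
    else .halt) (modFin hv hb) fun d => const _

theorem onStep : LSp (onStep M M₁ M₂ : OnState × InputSym A → OnState × Act B) := by
  refine cases (f := fun (a : Fin 5 × InputSym A) (x : OnState × InputSym A) =>
    match a.1 with
    | 0 => SpaceTM.onCount a.2 x.1.2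
    | 1 => SpaceTM.onSearch M M₁ M₂ x.1.2
    | 2 => SpaceTM.onFirst M M₁ M₂ x.1.2
    | 3 => SpaceTM.onCell M M₁ M₂ a.2 x.1.2
    | 4 => SpaceTM.onEmit x.1.2) (mk (fst (fst id)) (snd id)) ?_
  have hx : LSp fun x : OnState × InputSym A => x.1.2 := snd (fst id)
  rintro ⟨t, s⟩
  match t with
  | 0 => exact (onCount s).comp hx
  | 1 => exact (onSearch M M₁ M₂).comp hx
  | 2 => exact (onFirst M M₁ M₂).comp hx
  | 3 => exact (onCell M M₁ M₂ s).comp hx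
  | 4 => exact onEmit.comp hx

end LSp

end Online

end SpaceTM

/-! ### Correctness and space of the online machine. -/

namespace SpaceTM

section Tape

variable {A : Type}

theorem symAt_inputTape_zero (n : ℕ) (x : List A) : symAt (inputTape n x) 0 = .leftEnd := rfl

theorem symAt_inputTape_of_le {n i : ℕ} (x : List A) (hi : i < n) :
    symAt (inputTape n x) (i + 1) = .empty := by
  simp only [symAt, inputTape, List.getD_cons_succ, List.append_assoc]
  rw [List.getD_append _ _ _ _ (by simpa using hi), List.getD_replicate _ hi]

theorem symAt_inputTape_add (n i : ℕ) (x : List A) :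
    symAt (inputTape n x) (n + 1 + i) = symAt (inputTape 0 x) (i + 1) := by
  rw [show n + 1 + i = n + i + 1 by omega]
  simp only [symAt, inputTape, List.getD_cons_succ, List.append_assoc, List.replicate_zero,
    List.nil_append]
  rw [List.getD_append_right _ _ _ _ (by simp)]
  simp

theorem symAt_inputTape_eq {x : List A} {i : ℕ} :
    (i < x.length → ∃ a, symAt (inputTape 0 x) (i + 1) = .letter a) ∧
    (x.length ≤ i → symAt (inputTape 0 x) (i + 1) = .rightEnd) := by
  simp only [symAt, inputTape, List.getD_cons_succ, List.replicate_zero, List.nil_append]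
  refine ⟨fun h => ⟨x[i], ?_⟩, fun h => ?_⟩
  · rw [List.getD_append _ _ _ _ (by simpa using h)]
    rw [List.getD_eq_getElem _ _ (by simpa using h)]
    simp
  · rw [List.getD_append_right _ _ _ _ (by simpa using h)]
    rcases i - (x.map InputSym.letter).length with _ | k <;> simp

theorem length_inputTape (n : ℕ) (x : List A) : (inputTape n x).length = n + x.length + 2 := by
  simp only [inputTape, List.length_cons, List.length_append, List.length_replicate,
    List.length_map, List.length_nil]

end Tape

section Online

variable {A B Γ₁ Γ₂ : Type} [Finite A] [Finite B] [Finite Γ₁] [Finite Γ₂]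
  {M : Machine A Bool B} {M₁ : Machine Unit Γ₁ Bool} {M₂ : Machine Unit Γ₂ Bool}

/-- A bound on the codes of states. -/
def onBound (n Y : ℕ) : ℕ := (n + Y + 8) ^ 729

/-- States with bounded components. -/
def OnState.Small (n Y : ℕ) (x : OnState) : Prop :=
  x.2.1.1 ≤ n ∧ x.2.1.2 ≤ Y ∧ x.2.2.1 ≤ Y ∧ x.2.2.2.size ≤ Y

-- The code of a result accounts for the exponent `27`, and three further levels of pairing cube the
-- bound three times: `27 * 27 = 729`.
set_option exponentiation.threshold 1000 in
theorem OnState.Small.enc_le {n Y : ℕ} {x : OnState} (h : x.Small n Y) :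
    Enc.enc x ≤ onBound n Y := by
  obtain ⟨t, ⟨m, y⟩, T, E⟩ := x
  obtain ⟨h1, h2, h3, h4⟩ := h
  simp only at h1 h2 h3 h4
  have ht := t.isLt
  obtain ⟨Z, hZ⟩ : ∃ Z, Z = n + Y + 8 := ⟨_, rfl⟩
  have hE : Enc.enc E < Z ^ 27 := (enc_res_lt h4).trans_le (by
    unfold tabBase; exact Nat.pow_le_pow_left (by omega) _)
  have le : ∀ k, k ≠ 0 → ∀ x < Z, x < Z ^ k := fun k hk x hx => hx.trans_le (Nat.le_self_pow hk _)
  have le4 : ∀ k, k ≠ 0 → 4 ≤ Z ^ k := fun k hk =>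
    (by omega : 4 ≤ Z).trans (Nat.le_self_pow hk _)
  have e1 : cpair m y < (Z ^ 27) ^ 3 :=
    cpair_lt_pow (le 27 (by omega) _ (by omega)) (le 27 (by omega) _ (by omega)) (le4 _ (by omega))
  have e2 : cpair T (Enc.enc E) < (Z ^ 27) ^ 3 :=
    cpair_lt_pow (le 27 (by omega) _ (by omega)) hE (le4 _ (by omega))
  rw [← pow_mul] at e1 e2
  have e3 := cpair_lt_pow e1 e2 (le4 _ (by omega))
  rw [← pow_mul] at e3
  have e4 := cpair_lt_pow (le _ (by omega) (t : ℕ) (by omega)) e3 (le4 _ (by omega))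
  rw [← pow_mul] at e4
  unfold onBound
  rw [← hZ]
  exact e4.le

theorem NMReach.single {tape : List (InputSym A)} {n Y : ℕ} {x y : OnState} {i j : ℕ}
    {o o' : List B} (h : NMStep (onStep M M₁ M₂) tape (x, i, o) (y, j, o'))
    (hx : x.Small n Y) (hy : y.Small n Y) :
    NMReach (onStep M M₁ M₂) tape (onBound n Y) (x, i, o) (y, j, o') :=
  Relation.ReflTransGen.single ⟨h, hx.enc_le, hy.enc_le⟩

-- The first nonempty cell ends the count. It stays under the head, and on empty input it is already
-- the right marker.
variable (M M₁ M₂) in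
theorem reach_count (x : List A) (Y : ℕ) :
    NMReach (onStep M M₁ M₂) (inputTape x.length x) (onBound x.length Y)
      ((0, (0, 0), 0, (0, 0, 0, 0)), 0, []) ((1, (x.length, 0), 0, (0, 0, 0, 0)), x.length + 1, [])
    := by
  have hsmall : ∀ t k, k ≤ x.length →
      OnState.Small x.length Y (t, (k, 0), 0, (0, 0, 0, 0)) := fun t k hk =>
    ⟨hk, Nat.zero_le _, Nat.zero_le _, Nat.zero_le _⟩
  have hlen := length_inputTape x.length x
  have key : ∀ k ≤ x.length, NMReach (onStep M M₁ M₂) (inputTape x.length x) (onBound x.length Y)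
      ((0, (0, 0), 0, (0, 0, 0, 0)), 0, []) ((0, (k, 0), 0, (0, 0, 0, 0)), k + 1, []) := by
    intro k
    induction k with
    | zero =>
      intro _
      have := NMReach.single (M := M) (M₁ := M₁) (M₂ := M₂) (.adv (tape := inputTape x.length x)
        (i := 0) (o := []) (x := (0, (0, 0), 0, (0, 0, 0, 0))) (x' := (0, (0, 0), 0, (0, 0, 0, 0)))
        (step := onStep M M₁ M₂) rfl) (hsmall 0 0 (by omega)) (hsmall 0 0 (by omega))
      rwa [show moveInput (inputTape x.length x).length 0 .right = 0 + 1 by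
        simp only [moveInput]; omega] at this
    | succ k ih =>
      intro hk
      refine (ih (by omega)).trans ?_
      have := NMReach.single (M := M) (M₁ := M₁) (M₂ := M₂) (.adv (tape := inputTape x.length x)
        (i := k + 1) (o := []) (x := (0, (k, 0), 0, (0, 0, 0, 0)))
        (x' := (0, (k + 1, 0), 0, (0, 0, 0, 0))) (step := onStep M M₁ M₂) (by
          rw [symAt_inputTape_of_le x (by omega)]; rfl))
        (hsmall 0 k (by omega)) (hsmall 0 (k + 1) (by omega))
      rwa [show moveInput (inputTape x.length x).length (k + 1) .right = k + 1 + 1 by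
        simp only [moveInput]; omega] at this
  refine (key _ le_rfl).trans (NMReach.single (.cont ?_) (hsmall 0 _ le_rfl) (hsmall 1 _ le_rfl))
  have := symAt_inputTape_add x.length 0 x
  rw [add_zero] at this
  rw [this]
  rcases Nat.eq_zero_or_pos x.length with h0 | h0
  · rw [symAt_inputTape_eq.2 h0.le]; rfl
  · obtain ⟨a, ha⟩ := (symAt_inputTape_eq (x := x)).1 h0
    rw [ha]; rfl

theorem reach_search {tape : List (InputSym A)} {i n Y Y₀ : ℕ} (hY : Y ≤ Y₀)
    (hfail : ∀ y < Y, paramsFail M M₁ M₂ n y ≠ 0) :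
    NMReach (onStep M M₁ M₂) tape (onBound n Y₀)
      ((1, (n, 0), 0, (0, 0, 0, 0)), i, []) ((1, (n, Y), 0, (0, 0, 0, 0)), i, []) := by
  induction Y with
  | zero => exact .refl
  | succ Y ih =>
    refine (ih (by omega) fun y hy => hfail y (by omega)).trans (NMReach.single (.cont ?_)
      ⟨le_rfl, (by simp only; omega), Nat.zero_le _, Nat.zero_le _⟩
      ⟨le_rfl, hY, Nat.zero_le _, Nat.zero_le _⟩)
    simp only [onStep, onSearch]
    rw [if_neg (hfail Y (by omega))]

/-- The output is the digit sequence of the second number, with its length recorded by the power of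
the base. Each division by the base removes one letter from both, and the power `1` tells that
nothing is left, even if trailing letters have digit `0`. -/
theorem reach_emit {tape : List (InputSym A)} {i n Y Y₀ T st c : ℕ} (hY : Y ≤ Y₀) (hT : T ≤ Y₀)
    (l : List B) : ∀ o : List B, Res.size (st, c, outPair l) ≤ Y₀ →
    NMReach (onStep M M₁ M₂) tape (onBound n Y₀)
      ((4, (n, Y), T, (st, c, outPair l)), i, o) ((4, (n, Y), T, (st, c, 1, 0)), i, o ++ l) := by
  induction l with
  | nil => intro o _; rw [List.append_nil]; exact .refl
  | cons b l ih =>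
    intro o hsize
    have hb := (Finite.equivFin B b).isLt
    have hbase : 2 ≤ outBase B := by unfold outBase; omega
    have hlt : (Finite.equivFin B b : ℕ) < outBase B := by unfold outBase; omega
    have h1 : outBase B ^ (l.length + 1) / outBase B = outBase B ^ l.length := by
      rw [pow_succ, Nat.mul_div_cancel _ (by omega)]
    have h2 : (Finite.equivFin B b + outBase B * outCode l) / outBase B = outCode l := by
      rw [Nat.add_mul_div_left _ _ (by omega), Nat.div_eq_of_lt hlt, zero_add]
    have h3 : (Finite.equivFin B b + outBase B * outCode l) % outBase B = Finite.equivFin B b := by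
      rw [Nat.add_mul_mod_self_left, Nat.mod_eq_of_lt hlt]
    have hsize' : Res.size (st, c, outPair l) ≤ Y₀ := by
      refine le_trans ?_ hsize
      have e1 : outBase B ^ l.length ≤ outBase B ^ (l.length + 1) :=
        Nat.pow_le_pow_right (by omega) (by omega)
      have e2 : outCode l ≤ outBase B * outCode l := Nat.le_mul_of_pos_left _ (by omega)
      simp only [Res.size, outPair, outCode, List.length_cons]
      omega
    have h4 : ¬ outBase B ^ (l.length + 1) ≤ 1 := by
      have : 0 < outBase B ^ l.length := by positivity
      rw [pow_succ]; nlinarith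
    have hstep : NMStep (onStep M M₁ M₂) tape ((4, (n, Y), T, (st, c, outPair (b :: l))), i, o)
        ((4, (n, Y), T, (st, c, outPair l)), i, o ++ [b]) := by
      refine .emit ?_
      change onEmit (((n, Y), T, (st, c, outPair (b :: l))) : OnData) = _
      unfold onEmit
      rw [if_neg (show ¬ (((n, Y), T, (st, c, outPair (b :: l))) : OnData).2.2.2.2.1 ≤ 1 from h4)]
      simp only [outPair, outCode, List.length_cons, h1, h2, h3]
      rw [dif_pos hb]
      simp
    have := (NMReach.single hstep ⟨le_rfl, hY, hT, hsize⟩ ⟨le_rfl, hY, hT, hsize'⟩).trans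
      (ih (o ++ [b]) hsize')
    rwa [List.append_assoc, List.singleton_append] at this

/-- The simulation of the cells to the right of the left marker. -/
theorem reach_cells {x : List A} {T f L Y Y₀ : ℕ} {pos c : ℕ → ℕ} {mv : ℕ → Move}
    {e : ℕ → Option B} {out : ℕ → List B} (hY : Y ≤ Y₀)
    (hp : params M M₁ M₂ x.length Y = exactParams M f L) (hW : (exactParams M f L).2.2.2 ≤ Y₀)
    (hG : (exactParams M f L).2.1 + 4 ≤ Y₀)
    (h : TwoWayRun (M.cycStep (exactParams M f L).1) (inputTape 0 x) (exactParams M f L).2.2.1 T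
      pos c mv e out) (hL : (out T).length ≤ L) :
    ∀ k u i tab, T - u = k → u ≤ T → pos u = i + 1 → i ≤ x.length → tab ≤ Y₀ →
      Res.size (1, c u, outPair (out u)) ≤ Y₀ →
      TwoWayRun.LookSpec T pos c mv out (i + 1) (lookTab (tabBase ((exactParams M f L).2.1 + 4)) tab) →
      ∃ tab' j, tab' ≤ Y₀ ∧ Res.size (2, c T, outPair (out T)) ≤ Y₀ ∧
      NMReach (onStep M M₁ M₂) (inputTape x.length x) (onBound x.length Y₀)
        ((3, (x.length, Y), tab, (1, c u, outPair (out u))), x.length + 1 + i, [])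
        ((4, (x.length, Y), tab', (2, c T, outPair (out T))), j, []) := by
  intro k
  induction k using Nat.strong_induction_on with
  | _ k ih =>
  intro u i tab hk hu hpu hi htab hsize hLk
  -- On the right marker the table stays as it is, because a right move does not leave this cell.
  obtain ⟨tab', htab'⟩ : ∃ tab', tab' = (match symAt (inputTape 0 x) (i + 1) with
    | .rightEnd => tab
    | s => cellTab M (exactParams M f L) s tab) := ⟨_, rfl⟩
  have htabY : tab' ≤ Y₀ := by
    have hc := fun s => (mkTab_le (tabBase ((exactParams M f L).2.1 + 4)) (exactParams M f L).2.2.2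
      (exactParams M f L).2.2.1 fun x => cellRes M (exactParams M f L) s tab (1, x, 1, 0)).trans hW
    rw [htab']
    rcases symAt (inputTape 0 x) (i + 1) with _ | _ | _ | a
    · exact hc _
    · exact htab
    · exact hc _
    · exact hc _
  have hstep : NMStep (onStep M M₁ M₂) (inputTape x.length x)
      ((3, (x.length, Y), tab, (1, c u, outPair (out u))), x.length + 1 + i, ([] : List B))
      ((3, (x.length, Y), tab', cellRes M (exactParams M f L) (symAt (inputTape 0 x) (i + 1)) tab
        (1, c u, outPair (out u))),
        moveInput (inputTape x.length x).length (x.length + 1 + i) .right, []) := by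
    refine .adv ?_
    rw [symAt_inputTape_add]
    simp only [onStep, onCell, hp, if_true]
    rw [htab']
  have hsmall : OnState.Small x.length Y₀ (3, (x.length, Y), tab, (1, c u, outPair (out u))) :=
    ⟨le_rfl, hY, htab, hsize⟩
  have hres : (cellRes M (exactParams M f L) (symAt (inputTape 0 x) (i + 1)) tab
      (1, c u, outPair (out u))).size ≤ Y₀ := (cellRes_size _ _ _ _).trans hG
  have hreach := NMReach.single hstep hsmall ⟨le_rfl, hY, htabY, hres⟩
  rcases h.cellRes_eq hL hLk hu hpu with he | ⟨w, huw, hw, hpw, he⟩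
  · rw [he] at hreach hres
    refine ⟨tab', _, htabY, hres, hreach.trans (NMReach.single (.cont ?_)
      ⟨le_rfl, hY, htabY, hres⟩ ⟨le_rfl, hY, htabY, hres⟩)⟩
    simp [onStep, onCell]
  · rw [he] at hreach hres
    have hl0 := length_inputTape 0 x
    have hl1 := length_inputTape x.length x
    rcases Nat.lt_or_ge i x.length with hlt | hge
    · obtain ⟨a, ha⟩ := (symAt_inputTape_eq (x := x)).1 hlt
      have hnext := h.lookSpec_cellTab hL (i := i + 1) (by omega) hLk
      have ht : tab' = cellTab M (exactParams M f L) (symAt (inputTape 0 x) (i + 1)) tab := by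
        rw [htab', ha]
      rw [← ht] at hnext
      rw [show moveInput (inputTape 0 x).length (i + 1) .right = i + 1 + 1 by
        simp only [moveInput]; omega] at hpw
      rw [show moveInput (inputTape x.length x).length (x.length + 1 + i) .right =
        x.length + 1 + (i + 1) by simp only [moveInput]; omega] at hreach
      obtain ⟨tab'', j, h1, h2, h3⟩ := ih (T - w) (by omega) w (i + 1) tab' rfl hw hpw hlt htabY
        hres hnext
      exact ⟨tab'', j, h1, h2, hreach.trans h3⟩
    -- At the right marker both heads stay in place. The same cell is simulated again with the same
    -- table, from a later time; hence the induction on the remaining time `T - u` rather than on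
    -- the cell.
    · have ht : tab' = tab := by rw [htab', symAt_inputTape_eq.2 hge]
      rw [show moveInput (inputTape 0 x).length (i + 1) .right = i + 1 by
        simp only [moveInput]; omega] at hpw
      rw [show moveInput (inputTape x.length x).length (x.length + 1 + i) .right =
        x.length + 1 + i by simp only [moveInput]; omega, ht] at hreach
      obtain ⟨tab'', j, h1, h2, h3⟩ := ih (T - w) (by omega) w i tab rfl hw hpw hi htab
        hres hLk
      exact ⟨tab'', j, h1, h2, hreach.trans h3⟩

variable (M M₁ M₂) in
/-- Space that suffices for the computation of the parameters. -/
noncomputable def searchBound (n f l s₁ s₂ : ℕ) : ℕ :=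
  (M₁.numStates + n + workBase Γ₁ ^ s₁ + 2 ^ f.size + 4) ^ 243 +
  (M₂.numStates + n + workBase Γ₂ ^ s₂ + 2 ^ l.size + 4) ^ 243 +
  2 ^ f + outBase B ^ l + (exactParams M f l).2.2.2 + 1

variable (M M₁ M₂) in
/-- The one-way simulation as an online machine. -/
theorem exists_online : ∃ (Γ : Type) (_ : Finite Γ) (M' : Machine A Γ B) (C : ℕ), M'.IsOnline ∧
    ∀ (x : List A) (y : List B) (f l s₁ s₂ : ℕ), M.HaltsWith (inputTape 0 x) y f →
      M₁.HaltsWith (inputTape 0 (List.replicate x.length ())) (Nat.bits f) s₁ →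
      M₂.HaltsWith (inputTape 0 (List.replicate x.length ())) (Nat.bits l) s₂ → y.length ≤ l →
      M'.HaltsWith (inputTape x.length x) y
        (C * ((onBound x.length (searchBound M M₁ M₂ x.length f l s₁ s₂)).size + 1)) := by
  classical
  obtain ⟨Γ, hΓ, M', C, hon, hM'⟩ := exists_machine_of_step (LSp.onStep M M₁ M₂)
    (0, (0, 0), 0, (0, 0, 0, 0))
  refine ⟨Γ, hΓ, M', C, hon, fun x y f l s₁ s₂ h h₁ h₂ hy => ?_⟩
  obtain ⟨Y₀, hY₀⟩ : ∃ Y₀, Y₀ = searchBound M M₁ M₂ x.length f l s₁ s₂ := ⟨_, rfl⟩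
  rw [← hY₀]
  have hf : 1 ≤ f := h.pos
  obtain ⟨f', rfl⟩ := Nat.exists_eq_add_of_le' hf
  obtain ⟨T, pos, c, mv, e, out, hrun, hc0, hout⟩ := h.exists_twoWayRun
  have hvalid : paramsFail M M₁ M₂ x.length Y₀ = 0 := by
    have hb : ∀ a b c d e : ℕ, a ≤ a + b + c + d + e + 1 ∧ b ≤ a + b + c + d + e + 1 ∧
        c < a + b + c + d + e + 1 ∧ d < a + b + c + d + e + 1 ∧ e < a + b + c + d + e + 1 := by
      omega
    rw [hY₀]
    obtain ⟨b1, b2, b3, b4, b5⟩ := hb _ _ _ _ _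
    exact paramsFail_eq_zero h₁ h₂ b1 b2 b3 b4 b5
  have hex : ∃ Y, paramsFail M M₁ M₂ x.length Y = 0 := ⟨Y₀, hvalid⟩
  -- The search stops at the least successful bound. The states keep only the length of the input
  -- and this `Y`; the parameters are computed anew whenever they are needed.
  obtain ⟨Y, hYd⟩ : ∃ Y, Y = Nat.find hex := ⟨_, rfl⟩
  have hYf : paramsFail M M₁ M₂ x.length Y = 0 := hYd ▸ Nat.find_spec hex
  have hY : Y ≤ Y₀ := hYd ▸ Nat.find_min' hex hvalid
  have hmin : ∀ z < Y, paramsFail M M₁ M₂ x.length z ≠ 0 := fun z hz =>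
    Nat.find_min hex (hYd ▸ hz)
  obtain ⟨hp, hW⟩ := params_of_fail hf h₁ h₂ hYf
  have hWY : (exactParams M (f' + 1) l).2.2.2 ≤ Y₀ := by omega
  -- The bound on results is below the base of the tables, and a table has at least one entry, so
  -- the bound on tables dominates it.
  have hGY : (exactParams M (f' + 1) l).2.1 + 4 ≤ Y₀ := by
    refine le_trans ?_ hWY
    have hN : M.numStates * 2 ^ (f' + 1) ≠ 0 :=
      Nat.mul_ne_zero M.numStates_pos.ne' (by positivity)
    refine le_trans ?_ (Nat.le_self_pow hN _)
    unfold tabBase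
    exact le_trans (by simp only [exactParams]; omega) (Nat.le_self_pow (by norm_num) _)
  have hL : (out T).length ≤ l := by rw [hout]; exact hy
  have hrun : TwoWayRun (M.cycStep (exactParams M (f' + 1) l).1) (inputTape 0 x)
    (exactParams M (f' + 1) l).2.2.1 T pos c mv e out := hrun
  have hinit := hrun.lookSpec_initTab
  have hfirst := hrun.cellRes_eq hL hinit (Nat.zero_le _) hrun.pos_zero
  have hnext := hrun.lookSpec_cellTab hL (by rw [length_inputTape]; omega) hinit
  -- The online head has passed the left marker long before, but the symbol on cell `0` of the
  -- simulated tape is known without reading it.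
  rw [symAt_inputTape_zero] at hfirst hnext
  rw [hrun.out_zero] at hfirst
  have hres0 : Res.size (1, (M.stateCode M.start : ℕ), 1, 0) ≤ Y₀ := by
    have h1 := hrun.lt 0 (Nat.zero_le _)
    have h2 : (exactParams M (f' + 1) l).2.2.1 ≤ (exactParams M (f' + 1) l).2.1 :=
      Nat.le_add_right _ _
    rw [hc0] at h1
    simp only [Res.size]; omega
  have hres1 := (cellRes_size (M := M) (exactParams M (f' + 1) l) .leftEnd
    (initTab (exactParams M (f' + 1) l)) (1, c 0, outPair ([] : List B))).trans hGY
  have hT0 : initTab (exactParams M (f' + 1) l) ≤ Y₀ := (mkTab_le _ _ _ _).trans hWY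
  have hT1 : cellTab M (exactParams M (f' + 1) l) .leftEnd (initTab (exactParams M (f' + 1) l)) ≤
    Y₀ := (mkTab_le _ _ _ _).trans hWY
  have hr1 : NMReach (onStep M M₁ M₂) (inputTape x.length x) (onBound x.length Y₀)
      ((0, (0, 0), 0, (0, 0, 0, 0)), 0, [])
      ((3, (x.length, Y), cellTab M (exactParams M (f' + 1) l) .leftEnd
        (initTab (exactParams M (f' + 1) l)), cellRes M (exactParams M (f' + 1) l) .leftEnd
          (initTab (exactParams M (f' + 1) l)) (1, c 0, outPair ([] : List B))), x.length + 1, []) := by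
    have hA : NMReach (onStep M M₁ M₂) (inputTape x.length x) (onBound x.length Y₀)
        ((1, (x.length, Y), 0, (0, 0, 0, 0)), x.length + 1, ([] : List B))
        ((2, (x.length, Y), initTab (exactParams M (f' + 1) l),
          (1, (M.stateCode M.start : ℕ), 1, 0)), x.length + 1, []) := by
      refine NMReach.single (.cont ?_) ⟨le_rfl, hY, Nat.zero_le _, Nat.zero_le _⟩
        ⟨le_rfl, hY, hT0, hres0⟩
      simp only [onStep, onSearch, hYf, hp, if_true]
    refine (reach_count M M₁ M₂ x Y₀).trans ((reach_search hY hmin).trans (hA.trans ?_))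
    refine NMReach.single (.cont ?_) ⟨le_rfl, hY, hT0, hres0⟩ ⟨le_rfl, hY, hT1, hres1⟩
    simp only [onStep, onFirst, hp, hc0]
    rfl
  obtain ⟨tab, j, htab, hsize, hr2⟩ : ∃ tab' j, tab' ≤ Y₀ ∧
      Res.size (2, c T, outPair (out T)) ≤ Y₀ ∧
      NMReach (onStep M M₁ M₂) (inputTape x.length x) (onBound x.length Y₀)
        ((0, (0, 0), 0, (0, 0, 0, 0)), 0, [])
        ((4, (x.length, Y), tab', (2, c T, outPair (out T))), j, []) := by
    rcases hfirst with he | ⟨w, hw0, hw, hpw, he⟩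
    · rw [he] at hr1 hres1
      refine ⟨_, _, hT1, hres1, hr1.trans (NMReach.single (.cont ?_) ⟨le_rfl, hY, hT1, hres1⟩
        ⟨le_rfl, hY, hT1, hres1⟩)⟩
      simp [onStep, onCell]
    · rw [he] at hr1 hres1
      rw [show moveInput (inputTape 0 x).length 0 .right = 0 + 1 by
        rw [length_inputTape]; simp only [moveInput]; omega] at hpw
      obtain ⟨tab', j, h1, h2, h3⟩ := reach_cells hY hp hWY hGY hrun hL (T - w) w 0 _ rfl hw hpw
        (Nat.zero_le _) hT1 hres1 hnext
      exact ⟨tab', j, h1, h2, hr1.trans h3⟩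
  have hr3 := reach_emit (M := M) (M₁ := M₁) (M₂ := M₂) (tape := inputTape x.length x) (i := j)
    (n := x.length) hY htab (out T) [] hsize
  rw [List.nil_append, hout] at hr3
  rw [hout] at hr2
  refine hM' _ _ _ _ _ (hr2.trans hr3) (Nat.zero_le _) ?_
  simp [onStep, onEmit]

end Online

end SpaceTM

namespace SpaceTM

/-! ### Pumping of computations on unary inputs -/

section Pump

variable {K S : Type}

/-- A computation of a two-way device on the tape `τ` with positions `0, …, n + 1`, a second tape
`τ'` that arises from it by the insertion of `m` cells into the homogeneous part `1, …, n`, and a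
set `R` of configurations on the second tape that is closed under transitions. -/
structure PumpData (Step : K → S → K → ℤ → Prop) (c : ℕ → K) (p : ℕ → ℤ) (T n m : ℕ)
    (τ τ' : ℤ → S) (R : K → ℤ → Prop) : Prop where
  step : ∀ t < T, Step (c t) (τ (p t)) (c (t + 1)) (p (t + 1) - p t)
  move : ∀ t < T, p (t + 1) ≤ p t + 1 ∧ p t ≤ p (t + 1) + 1
  range : ∀ t ≤ T, 0 ≤ p t ∧ p t ≤ n + 1
  closed : ∀ κ i κ' z, R κ i → Step κ (τ' i) κ' z → R κ' (i + z)
  left : ∀ i : ℤ, 0 ≤ i → i ≤ n → τ' i = τ i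
  right : ∀ i : ℤ, 1 ≤ i → i ≤ n + 1 → τ' (i + m) = τ i
  inner : ∀ i j : ℤ, 1 ≤ i → i ≤ n → 1 ≤ j → j ≤ n + m → τ' j = τ i
  dvd : ∀ d : ℕ, 1 ≤ d → d < n → d ∣ m
  pigeon : ∀ g : ℕ → ℕ, (∀ j, 1 ≤ j → j ≤ n → g j ≤ T) →
    ∃ a b, 1 ≤ a ∧ a < b ∧ b ≤ n ∧ c (g a) = c (g b)

namespace PumpData

variable {Step : K → S → K → ℤ → Prop} {c : ℕ → K} {p : ℕ → ℤ} {T n m : ℕ} {τ τ' : ℤ → S}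
  {R : K → ℤ → Prop}

/-- A part of the computation can be repeated on the second tape at a shifted position. -/
theorem follow (h : PumpData Step c p T n m τ τ' R) {u w : ℕ} (huw : u ≤ w) (hw : w ≤ T) {x : ℤ}
    (hτ : ∀ v, u ≤ v → v < w → τ' (p v + x) = τ (p v)) (hu : R (c u) (p u + x)) :
    R (c w) (p w + x) := by
  induction w, huw using Nat.le_induction with
  | base => exact hu
  | succ w huw ih =>
    have h1 := ih (by omega) fun v h1 h2 => hτ v h1 (by omega)
    have h2 := h.step w (by omega)
    rw [← hτ w huw (by omega)] at h2
    have := h.closed _ _ _ _ h1 h2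
    rwa [show p w + x + (p (w + 1) - p w) = p (w + 1) + x by ring] at this

/-- From the left end, the computation on the second tape halts, or it reaches the right end. -/
theorem left_or_cross (h : PumpData Step c p T n m τ τ' R) {t : ℕ} (ht : t ≤ T) (hp : p t = 0)
    (hR : R (c t) 0) : (∃ j, R (c T) j ∧ τ' j = τ (p T)) ∨
      ∃ w, t < w ∧ w ≤ T ∧ p w = n + 1 ∧ R (c w) (n + 1 + m) := by
  classical
  by_cases hex : ∃ w, t < w ∧ w ≤ T ∧ p w = n + 1
  · right
    obtain ⟨w, hw⟩ : ∃ w, w = Nat.find hex := ⟨_, rfl⟩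
    obtain ⟨htw, hwT, hpw⟩ : t < w ∧ w ≤ T ∧ p w = n + 1 := hw ▸ Nat.find_spec hex
    have hmin : ∀ v, t < v → v < w → p v ≠ n + 1 := fun v h1 h2 h3 =>
      Nat.find_min hex (hw ▸ h2) ⟨h1, by omega, h3⟩
    refine ⟨w, htw, hwT, hpw, ?_⟩
    -- The traversal from the left end to the right end begins at the last visit `t₀` of the left
    -- end. Strictly between `t₀` and `w` the head is on the homogeneous part.
    obtain ⟨t₀, htt₀, ht₀w, hpt₀, hlast⟩ : ∃ t₀, t ≤ t₀ ∧ t₀ < w ∧ p t₀ = 0 ∧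
        ∀ v, t₀ < v → v < w → p v ≠ 0 := by
      have hP : (fun v => t ≤ v ∧ v < w ∧ p v = 0) t := ⟨le_rfl, htw, hp⟩
      have hspec := Nat.findGreatest_spec (P := fun v => t ≤ v ∧ v < w ∧ p v = 0) htw.le hP
      refine ⟨_, hspec.1, hspec.2.1, hspec.2.2, fun v h1 h2 h3 => ?_⟩
      exact Nat.findGreatest_is_greatest h1 h2.le ⟨by have := hspec.1; omega, h2, h3⟩
    have hin : ∀ v, t₀ < v → v < w → 1 ≤ p v ∧ p v ≤ n := fun v h1 h2 => by
      have := h.range v (by omega)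
      have := hlast v h1 h2
      have := hmin v (by omega) h2
      omega
    -- `Nat.find (hgex j)` is the first time from `t₀` on at which the head is at `j` or beyond; as
    -- it moves by at most one cell, it is then exactly at `j`. The guard `j ≤ n + 1` merely makes
    -- the time defined for all `j`.
    have hgex : ∀ j : ℕ, ∃ v, t₀ ≤ v ∧ (j ≤ n + 1 → (j : ℤ) ≤ p v) := fun j =>
      ⟨w, ht₀w.le, fun hj => by rw [hpw]; exact_mod_cast hj⟩
    have hg1 : ∀ j, t₀ ≤ Nat.find (hgex j) := fun j => (Nat.find_spec (hgex j)).1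
    have hg2 : ∀ j : ℕ, j ≤ n + 1 → (j : ℤ) ≤ p (Nat.find (hgex j)) := fun j =>
      (Nat.find_spec (hgex j)).2
    have hgw : ∀ j, Nat.find (hgex j) ≤ w := fun j =>
      Nat.find_min' (hgex j) ⟨ht₀w.le, fun hj => by rw [hpw]; exact_mod_cast hj⟩
    have hg3 : ∀ j : ℕ, 1 ≤ j → j ≤ n → t₀ < Nat.find (hgex j) ∧ Nat.find (hgex j) < w ∧
        p (Nat.find (hgex j)) = j := by
      intro j h1 h2
      have e1 := hg1 j
      have e2 := hg2 j (by omega)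
      have e3 : t₀ < Nat.find (hgex j) := by
        refine lt_of_le_of_ne e1 fun he => ?_
        rw [← he, hpt₀] at e2; omega
      obtain ⟨v, hv⟩ : ∃ v, Nat.find (hgex j) = v + 1 := ⟨Nat.find (hgex j) - 1, by omega⟩
      have e4 : p v < j := by
        by_contra hlt
        exact Nat.find_min (hgex j) (show v < _ by omega) ⟨by omega, fun _ => by omega⟩
      have e5 := h.move v (by have := hgw j; omega)
      rw [hv] at e2 e3 ⊢
      have e6 : p (v + 1) = j := by omega
      refine ⟨e3, lt_of_le_of_ne (hv ▸ hgw j) fun he => ?_, e6⟩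
      rw [he, hpw] at e6; omega
    obtain ⟨a, b, ha, hab, hb, hc⟩ := h.pigeon (fun j => Nat.find (hgex j)) fun j h1 h2 =>
      (hgw j).trans hwT
    have hgab : Nat.find (hgex a) ≤ Nat.find (hgex b) :=
      Nat.find_min' (hgex a) ⟨hg1 b, fun _ => by have := hg2 b (by omega); omega⟩
    obtain ⟨ha1, ha2, ha3⟩ := hg3 a ha (by omega)
    obtain ⟨hb1, hb2, hb3⟩ := hg3 b (by omega) hb
    -- the computation up to the first arrival at `b` is the same on both tapes
    have hRb : R (c (Nat.find (hgex b))) b := by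
      have := h.follow (u := t) (w := Nat.find (hgex b)) (x := 0) (by omega) (by omega)
        (fun v h1 h2 => by
          have h3 := h.range v (by omega)
          have h4 : p v ≠ n + 1 := by
            rcases Nat.eq_or_lt_of_le h1 with rfl | h5
            · omega
            · exact hmin v h5 (by omega)
          rw [add_zero]
          exact h.left _ h3.1 (by omega)) (by rwa [hp])
      rwa [hb3, add_zero] at this
    -- the part between the first arrivals at `a` and `b` can be repeated
    have hloop : ∀ k : ℕ, k * (b - a) ≤ m → R (c (Nat.find (hgex b))) (b + (k * (b - a) : ℕ)) := by
      intro k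
      induction k with
      | zero => intro _; simpa using hRb
      | succ k ih =>
        intro hk
        have h1 := ih (by rw [Nat.succ_mul] at hk; omega)
        have hba : ((b - a : ℕ) : ℤ) = b - a := by omega
        have h2 := h.follow (u := Nat.find (hgex a)) (x := ((k + 1) * (b - a) : ℕ)) hgab
          (by omega) (fun v h1 h2 => by
            have h3 := hin v (by omega) (by omega)
            exact h.inner _ _ h3.1 h3.2 (by omega) (by omega)) (by
            rw [ha3, hc]
            convert h1 using 1
            push_cast [hba]; ring)
        rwa [hb3] at h2
    have hRm : R (c (Nat.find (hgex b))) (p (Nat.find (hgex b)) + m) := by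
      -- The length `b - a` of the repeated part divides `m`, so a whole number of repetitions
      -- shifts the computation by exactly `m` cells. The rest of the traversal then follows the
      -- original one from the other side of the inserted cells.
      obtain ⟨k, hk⟩ := h.dvd (b - a) (by omega) (by omega)
      have := hloop k (by rw [hk, mul_comm])
      rw [hb3]
      convert this using 3
      rw [hk, mul_comm]
    have := h.follow (w := w) hb2.le hwT (fun v h1 h2 => by
      have h3 := hin v (by omega) h2
      exact h.right _ h3.1 (by omega)) hRm
    rwa [hpw] at this
  · left
    refine ⟨p T, ?_, ?_⟩
    · have := h.follow (u := t) (w := T) (x := 0) ht le_rfl (fun v h1 h2 => by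
        have h3 := h.range v (by omega)
        have h4 : p v ≠ n + 1 := by
          rcases Nat.eq_or_lt_of_le h1 with rfl | h5
          · omega
          · exact fun h6 => hex ⟨v, h5, by omega, h6⟩
        rw [add_zero]
        exact h.left _ h3.1 (by omega)) (by rwa [hp])
      rwa [add_zero] at this
    · have h3 := h.range T le_rfl
      refine h.left _ h3.1 ?_
      have h4 : p T ≠ n + 1 := by
        rcases Nat.eq_or_lt_of_le ht with rfl | h5
        · omega
        · exact fun h6 => hex ⟨T, h5, le_rfl, h6⟩
      omega

/-- Reflection. -/
theorem reflect (h : PumpData Step c p T n m τ τ' R) :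
    PumpData (fun κ s κ' z => Step κ s κ' (-z)) c (fun t => n + 1 - p t) T n m
      (fun i => τ (n + 1 - i)) (fun i => τ' (n + 1 + m - i)) (fun κ i => R κ (n + 1 + m - i)) where
  step t ht := by
    have := h.step t ht
    rw [show -((n : ℤ) + 1 - p (t + 1) - (n + 1 - p t)) = p (t + 1) - p t by ring, sub_sub_cancel]
    exact this
  move t ht := by have := h.move t ht; constructor <;> omega
  range t ht := by have := h.range t ht; constructor <;> omega
  closed κ i κ' z h1 h2 := by
    have := h.closed _ _ _ _ h1 h2
    rwa [show (n : ℤ) + 1 + m - (i + z) = n + 1 + m - i + -z by ring]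
  left i h1 h2 := by
    rw [← h.right (n + 1 - i) (by omega) (by omega)]
    congr 1; ring
  right i h1 h2 := by
    rw [← h.left (n + 1 - i) (by omega) (by omega)]
    congr 1; ring
  inner i j h1 h2 h3 h4 := h.inner _ _ (by omega) (by omega) (by omega) (by omega)
  dvd := h.dvd
  pigeon := h.pigeon

/-- The computation on the second tape halts as the one on the first tape does. -/
theorem exists_halt (h : PumpData Step c p T n m τ τ' R) : ∀ k t, T - t = k → t ≤ T →
    ((p t = 0 ∧ R (c t) 0) ∨ (p t = n + 1 ∧ R (c t) (n + 1 + m))) →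
    ∃ j, R (c T) j ∧ τ' j = τ (p T) := by
  intro k
  induction k using Nat.strong_induction_on with
  | _ k ih =>
  rintro t hk ht (⟨hp, hR⟩ | ⟨hp, hR⟩)
  · rcases h.left_or_cross ht hp hR with h1 | ⟨w, htw, hw, hpw, hRw⟩
    · exact h1
    · exact ih (T - w) (by omega) w rfl hw (Or.inr ⟨hpw, hRw⟩)
  · rcases h.reflect.left_or_cross ht (by rw [hp]; ring) (by simpa using hR) with
      ⟨j, h1, h2⟩ | ⟨w, htw, hw, hpw, hRw⟩
    · refine ⟨_, h1, ?_⟩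
      simpa using h2
    · refine ih (T - w) (by omega) w rfl hw (Or.inl ⟨by omega, ?_⟩)
      simpa using hRw

end PumpData

end Pump

end SpaceTM

/-! ### Pumping applied to Turing machines on unary inputs. -/

namespace SpaceTM

namespace Machine

variable {A Γ B : Type} (M : Machine A Γ B)

/-- A configuration without the position of the input head. -/
abbrev Core : Type := M.State × (ℤ → Γ) × ℤ × List B

variable {M}

/-- The configuration without the position of the input head. -/
def Config.core (c : M.Config) : M.Core := (c.state, c.work, c.workPos, c.out)

/-- The displacement of the input head. -/
def moveDiff {A : Type} : InputSym A → Move → ℤ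
  | _, .stay => 0
  | .leftEnd, .left => 0
  | _, .left => -1
  | .rightEnd, .right => 0
  | _, .right => 1

variable (M) in
/-- Transitions in terms of displacements. -/
def CoreStep (κ : M.Core) (s : InputSym A) (κ' : M.Core) (z : ℤ) : Prop :=
  ∃ a, M.step κ.1 s (κ.2.1 κ.2.2.1) = some a ∧ z = moveDiff s a.inputMove ∧
    κ' = (a.next, Function.update κ.2.1 κ.2.2.1 a.write, moveWork κ.2.2.1 a.workMove,
      κ.2.2.2 ++ a.output.toList)

theorem run_inputPos_lt {tape : List (InputSym A)} (h : 0 < tape.length) (t : ℕ) :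
    (M.run tape t).inputPos < tape.length := by
  induction t with
  | zero => exact h
  | succ t ih =>
    rcases ha : M.action tape (M.run tape t) with _ | a
    · rwa [run_succ_of_none M tape ha]
    · rw [run_succ_of_some M tape ha]
      simp only [perform]
      cases a.inputMove <;> simp only [moveInput] <;> omega

theorem halt_unique {tape : List (InputSym A)} {t t' : ℕ}
    (h : M.action tape (M.run tape t) = none) (h' : M.action tape (M.run tape t') = none) :
    M.run tape t = M.run tape t' := by
  have key : ∀ t, M.action tape (M.run tape t) = none → ∀ d, M.run tape (t + d) = M.run tape t := by
    intro t ht d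
    induction d with
    | zero => rfl
    | succ d ih => rw [← Nat.add_assoc, run_succ_of_none, ih]; rw [ih]; exact ht
  rcases le_total t t' with hle | hle
  · rw [← key t h (t' - t), Nat.add_sub_cancel' hle]
  · rw [← key t' h' (t - t'), Nat.add_sub_cancel' hle]

theorem run_out_prefix {tape : List (InputSym A)} {t : ℕ} :
    ∀ t', t ≤ t' → (M.run tape t).out <+: (M.run tape t').out := by
  intro t' h
  induction t', h using Nat.le_induction with
  | base => exact List.prefix_rfl
  | succ t' _ ih =>
    refine ih.trans ?_
    rcases ha : M.action tape (M.run tape t') with _ | a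
    · rw [run_succ_of_none M tape ha]
    · rw [run_succ_of_some M tape ha]
      exact List.prefix_append _ _

/-- The number of configurations, up to the position of the input head, in a bounded computation. -/
theorem exists_core_eq [Finite Γ] {tape : List (InputSym A)} {T s k n : ℕ}
    (hs : (M.visited tape T).card ≤ s) (hk : (M.run tape T).out.length ≤ k)
    (hn : M.numStates * s * Nat.card Γ ^ s * (k + 1) < n) (g : ℕ → ℕ)
    (hg : ∀ j, 1 ≤ j → j ≤ n → g j ≤ T) :
    ∃ a b, 1 ≤ a ∧ a < b ∧ b ≤ n ∧ (M.run tape (g a)).core = (M.run tape (g b)).core := by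
  classical
  obtain ⟨a₀, ha₀⟩ := exists_window hs
  have hblank := work_eq_blank ha₀
  have := M.finite_state
  have hlen : ∀ t ≤ T, (M.run tape t).out.length < k + 1 := fun t ht =>
    ((run_out_prefix T ht).length_le.trans hk).trans_lt (Nat.lt_succ_self k)
  -- All outputs during the run are prefixes of the final one, so the length determines the output
  -- and only `k + 1` values have to be counted. The tape outside the window is blank.
  let X := M.State × Fin s × (Fin s → Γ) × Fin (k + 1)
  have hX : Nat.card X < Nat.card (Fin n) := by
    simp only [X, Nat.card_prod, Nat.card_fun, Nat.card_fin]
    rw [← mul_assoc, ← mul_assoc]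
    exact hn
  let F : Fin n → X := fun j =>
    ((M.run tape (g (j + 1))).state,
      ⟨((M.run tape (g (j + 1))).workPos - a₀).toNat, by
        have := ha₀ _ (hg (j + 1) (by omega) (by omega)); omega⟩,
      fun i => (M.run tape (g (j + 1))).work (a₀ + i),
      ⟨(M.run tape (g (j + 1))).out.length, hlen _ (hg (j + 1) (by omega) (by omega))⟩)
  obtain ⟨i, j, hij, hF⟩ : ∃ i j : Fin n, i < j ∧ F i = F j := by
    by_contra hcon
    push Not at hcon
    have hinj : Function.Injective F := fun i j h => by
      rcases lt_trichotomy i j with h1 | h1 | h1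
      · exact absurd h (hcon i j h1)
      · exact h1
      · exact absurd h.symm (hcon j i h1)
    have := Nat.card_le_card_of_injective F hinj
    omega
  refine ⟨i + 1, j + 1, by omega, by have : (i : ℕ) < j := hij; omega, by omega, ?_⟩
  have hi := hg (i + 1) (by omega) (by omega)
  have hj := hg (j + 1) (by omega) (by omega)
  have h1 : (M.run tape (g (i + 1))).state = (M.run tape (g (j + 1))).state :=
    congrArg (fun x : X => x.1) hF
  have h2 : ((M.run tape (g (i + 1))).workPos - a₀).toNat =
      ((M.run tape (g (j + 1))).workPos - a₀).toNat := congrArg (fun x : X => (x.2.1 : ℕ)) hF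
  have h3 : (fun i : Fin s => (M.run tape (g (_ + 1))).work (a₀ + i)) =
      fun i : Fin s => (M.run tape (g (j + 1))).work (a₀ + i) := congrArg (fun x : X => x.2.2.1) hF
  have h4 : (M.run tape (g (i + 1))).out.length = (M.run tape (g (j + 1))).out.length :=
    congrArg (fun x : X => (x.2.2.2 : ℕ)) hF
  have hp1 := ha₀ _ hi
  have hp2 := ha₀ _ hj
  refine Prod.ext h1 (Prod.ext (funext fun z => ?_) (Prod.ext ?_ ?_))
  · by_cases hz : a₀ ≤ z ∧ z < a₀ + s
    · have := congrFun h3 ⟨(z - a₀).toNat, by omega⟩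
      simp only at this
      rwa [show a₀ + ((z - a₀).toNat : ℤ) = z by omega] at this
    · simp only [Config.core]
      rw [hblank _ hi z hz, hblank _ hj z hz]
  · simp only [Config.core]; omega
  · have e1 := run_out_prefix (M := M) (tape := tape) T hi
    have e2 := run_out_prefix (M := M) (tape := tape) T hj
    exact (List.prefix_of_prefix_length_le e1 e2 h4.le).eq_of_length h4

end Machine

section Unary

variable {Γ : Type} {M : Machine Unit Γ Bool}

/-- The displacement depends on the symbol alone and not on the position or the length of the input.
This is what allows parts of a computation to be moved along the tape. -/
theorem moveInput_unary {n i : ℕ} (hi : i ≤ n + 1) (m : Move) :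
    (moveInput (n + 2) i m : ℤ) - i = Machine.moveDiff (unarySym n i) m := by
  unfold unarySym
  cases m <;> simp only [moveInput]
  · split_ifs <;> simp only [Machine.moveDiff] <;> omega
  · split_ifs <;> simp only [Machine.moveDiff] <;> omega
  · split_ifs <;> simp only [Machine.moveDiff] <;> omega

theorem coreStep_of_action {n t : ℕ} {a}
    (ha : M.action (inputTape 0 (List.replicate n ()))
      (M.run (inputTape 0 (List.replicate n ())) t) = some a) :
    M.CoreStep (M.run (inputTape 0 (List.replicate n ())) t).core
      (unarySym n (M.run (inputTape 0 (List.replicate n ())) t).inputPos)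
      (M.run (inputTape 0 (List.replicate n ())) (t + 1)).core
      ((M.run (inputTape 0 (List.replicate n ())) (t + 1)).inputPos -
        (M.run (inputTape 0 (List.replicate n ())) t).inputPos) := by
  have hlen : (inputTape 0 (List.replicate n ())).length = n + 2 := by
    rw [length_inputTape]; simp
  have hpos := M.run_inputPos_lt (tape := inputTape 0 (List.replicate n ())) (by omega) t
  refine ⟨a, ?_, ?_, ?_⟩
  · rw [← symAt_unary]; exact ha
  · rw [M.run_succ_of_some _ ha]
    simp only [Machine.perform, hlen]
    exact moveInput_unary (by omega) _
  · rw [M.run_succ_of_some _ ha]; rfl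

/-- If a machine has fewer than `n` configurations on the unary input of length `n`, up to the
position of the input head, then it gives the same output on a longer input. -/
theorem eq_of_few_cores [Finite Γ] {n m s s' u u' : ℕ}
    (h : M.HaltsWith (inputTape 0 (List.replicate n ())) (Nat.bits u) s)
    (h' : M.HaltsWith (inputTape 0 (List.replicate (n + m) ())) (Nat.bits u') s')
    (hdvd : ∀ d : ℕ, 1 ≤ d → d < n → d ∣ m)
    (hn : M.numStates * s * Nat.card Γ ^ s * (u.size + 1) < n) : u' = u := by
  obtain ⟨T, hT, hlt, hy, hcard⟩ := h.exists_first
  obtain ⟨T', hT', hy', _⟩ := h'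
  have hlen : ∀ k, (inputTape 0 (List.replicate k ())).length = k + 2 := fun k => by
    rw [length_inputTape]; simp
  have hpos : ∀ k t, (M.run (inputTape 0 (List.replicate k ())) t).inputPos < k + 2 := fun k t => by
    have := M.run_inputPos_lt (tape := inputTape 0 (List.replicate k ())) (by rw [hlen]; omega) t
    rwa [hlen] at this
  have hdata : PumpData M.CoreStep (fun t => (M.run (inputTape 0 (List.replicate n ())) t).core)
      (fun t => ((M.run (inputTape 0 (List.replicate n ())) t).inputPos : ℤ)) T n m
      (fun i => unarySym n i.toNat) (fun i => unarySym (n + m) i.toNat)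
      (fun κ i => ∃ t, (M.run (inputTape 0 (List.replicate (n + m) ())) t).core = κ ∧
        ((M.run (inputTape 0 (List.replicate (n + m) ())) t).inputPos : ℤ) = i) := by
    refine ⟨fun t ht => ?_, fun t ht => ?_, fun t _ => ?_, ?_, ?_, ?_, ?_, hdvd, ?_⟩
    · obtain ⟨a, ha⟩ := Option.ne_none_iff_exists'.mp (hlt t ht)
      exact coreStep_of_action ha
    · obtain ⟨a, ha⟩ := Option.ne_none_iff_exists'.mp (hlt t ht)
      rw [M.run_succ_of_some _ ha]
      have := hpos n t
      simp only [Machine.perform, hlen]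
      cases a.inputMove <;> simp only [moveInput] <;> omega
    · have := hpos n t
      constructor <;> omega
    · rintro _ _ κ' z ⟨t, rfl, rfl⟩ ⟨a, ha, rfl, rfl⟩
      rw [Int.toNat_natCast] at ha
      have ha' : M.action (inputTape 0 (List.replicate (n + m) ()))
          (M.run (inputTape 0 (List.replicate (n + m) ())) t) = some a := by
        rw [← symAt_unary] at ha; exact ha
      refine ⟨t + 1, ?_, ?_⟩
      · rw [M.run_succ_of_some _ ha']; rfl
      · rw [M.run_succ_of_some _ ha', Int.toNat_natCast,
          ← moveInput_unary (by have := hpos (n + m) t; omega)]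
        simp only [Machine.perform, hlen]
        ring
    · intro i h0 h1
      simp only [unarySym]
      split_ifs <;> first | rfl | omega
    · intro i h0 h1
      simp only [unarySym]
      split_ifs <;> first | rfl | omega
    · intro i j h0 h1 h2 h3
      simp only [unarySym]
      split_ifs <;> first | rfl | omega
    · exact fun g hg => Machine.exists_core_eq hcard
        (by rw [hy, Nat.size_eq_bits_len]) hn g hg
  obtain ⟨j, ⟨t, ht, hj⟩, hsym⟩ := hdata.exists_halt T 0 rfl (Nat.zero_le _)
    (Or.inl ⟨rfl, 0, rfl, rfl⟩)
  simp only [Int.toNat_natCast] at hsym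
  rw [← hj, Int.toNat_natCast, ← symAt_unary, ← symAt_unary] at hsym
  have hhalt : M.action (inputTape 0 (List.replicate (n + m) ()))
      (M.run (inputTape 0 (List.replicate (n + m) ())) t) = none := by
    rw [← hT]
    simp only [Machine.Config.core, Prod.mk.injEq] at ht
    unfold Machine.action
    unfold symAt at hsym
    rw [hsym, ht.1, ht.2.1, ht.2.2.1]
  -- The pumped halting configuration is reached on the longer input, so by determinism it is the
  -- one in which that computation writes `u'`; its output is that of the shorter input.
  have heq := Machine.halt_unique hhalt hT'
  have hout : (M.run (inputTape 0 (List.replicate (n + m) ())) t).out = Nat.bits u := by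
    rw [← hy]
    simp only [Machine.Config.core, Prod.mk.injEq] at ht
    exact ht.2.2.2
  rw [heq, hy'] at hout
  rw [← bitsVal_bits u', hout, bitsVal_bits]

end Unary

end SpaceTM

namespace SpaceTM

/-! ### Estimates of the space -/

theorem isBigO_natCast_iff {a b : ℕ → ℕ} :
    (fun n => (a n : ℝ)) =O[atTop] (fun n => (b n : ℝ)) ↔ ∃ C : ℕ, ∀ᶠ n in atTop, a n ≤ C * b n := by
  rw [isBigO_iff]
  constructor
  · rintro ⟨c, hc⟩
    refine ⟨⌈c⌉₊, hc.mono fun n hn => ?_⟩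
    simp only [Real.norm_natCast] at hn
    have : (a n : ℝ) ≤ (⌈c⌉₊ * b n : ℕ) := by
      push_cast
      exact hn.trans (mul_le_mul_of_nonneg_right (Nat.le_ceil c) (Nat.cast_nonneg _))
    exact_mod_cast this
  · rintro ⟨C, hC⟩
    refine ⟨C, hC.mono fun n hn => ?_⟩
    simp only [Real.norm_natCast]
    exact_mod_cast hn

/-- The logarithm of `a` is at most a constant multiple of `Q`. -/
def LogBound (Q a : ℕ → ℕ) : Prop := ∃ C, ∀ n, a n ≤ 2 ^ (C * Q n)

namespace LogBound

variable {Q a b : ℕ → ℕ}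

theorem const (hQ : ∀ n, 1 ≤ Q n) (c : ℕ) : LogBound Q fun _ => c :=
  ⟨c, fun n => (Nat.lt_two_pow_self (n := c)).le.trans
    (Nat.pow_le_pow_right two_pos (Nat.le_mul_of_pos_right _ (hQ n)))⟩

theorem add (hQ : ∀ n, 1 ≤ Q n) (ha : LogBound Q a) (hb : LogBound Q b) :
    LogBound Q fun n => a n + b n := by
  obtain ⟨C, hC⟩ := ha
  obtain ⟨D, hD⟩ := hb
  refine ⟨C + D + 1, fun n => ?_⟩
  have h1 := (hC n).trans (Nat.pow_le_pow_right two_pos (show C * Q n ≤ (C + D) * Q n by gcongr; omega))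
  have h2 := (hD n).trans (Nat.pow_le_pow_right two_pos (show D * Q n ≤ (C + D) * Q n by gcongr; omega))
  have h3 : 2 ^ ((C + D) * Q n + 1) ≤ 2 ^ ((C + D + 1) * Q n) :=
    Nat.pow_le_pow_right two_pos (by rw [Nat.succ_mul]; have := hQ n; omega)
  rw [pow_succ] at h3
  simp only
  omega

theorem mul (ha : LogBound Q a) (hb : LogBound Q b) : LogBound Q fun n => a n * b n := by
  obtain ⟨C, hC⟩ := ha
  obtain ⟨D, hD⟩ := hb
  refine ⟨C + D, fun n => ?_⟩
  rw [add_mul, pow_add]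
  exact Nat.mul_le_mul (hC n) (hD n)

theorem pow (ha : LogBound Q a) (k : ℕ) : LogBound Q fun n => a n ^ k := by
  obtain ⟨C, hC⟩ := ha
  refine ⟨C * k, fun n => (Nat.pow_le_pow_left (hC n) k).trans_eq ?_⟩
  rw [← pow_mul]; congr 1; ring

theorem const_pow {D : ℕ} (h : ∀ n, a n ≤ D * Q n) (c : ℕ) : LogBound Q fun n => c ^ a n := by
  refine ⟨c * D, fun n => ?_⟩
  calc c ^ a n ≤ (2 ^ c) ^ a n := Nat.pow_le_pow_left (Nat.lt_two_pow_self (n := c)).le _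
    _ = 2 ^ (c * a n) := (pow_mul _ _ _).symm
    _ ≤ 2 ^ (c * D * Q n) := Nat.pow_le_pow_right two_pos (by rw [mul_assoc]; gcongr; exact h n)

theorem of_le (h : ∀ n, a n ≤ Q n) : LogBound Q a :=
  ⟨1, fun n => (Nat.lt_two_pow_self (n := a n)).le.trans
    (Nat.pow_le_pow_right two_pos (by rw [one_mul]; exact h n))⟩

theorem two_pow_size (h : ∀ n, a n ≤ Q n) : LogBound Q fun n => 2 ^ (a n).size :=
  const_pow (D := 1) (fun n => by
    have : (a n).size ≤ a n := Nat.size_le.mpr Nat.lt_two_pow_self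
    have := h n; omega) 2

theorem of_size_le (h : ∀ n, (a n).size ≤ Q n) : LogBound Q a :=
  ⟨1, fun n => (Nat.lt_size_self (a n)).le.trans
    (Nat.pow_le_pow_right two_pos (by rw [one_mul]; exact h n))⟩

theorem size_le (hQ : ∀ n, 1 ≤ Q n) (ha : LogBound Q a) : ∃ C, ∀ n, (a n).size ≤ C * Q n := by
  obtain ⟨C, hC⟩ := ha
  refine ⟨C + 1, fun n => Nat.size_le.mpr ((hC n).trans_lt (Nat.pow_lt_pow_right (by norm_num) ?_))⟩
  rw [Nat.succ_mul]; have := hQ n; omega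

end LogBound

section

variable {A B Γ₁ Γ₂ : Type}
  (M : Machine A Bool B) (M₁ : Machine Unit Γ₁ Bool) (M₂ : Machine Unit Γ₂ Bool)

-- The dominant term is the table: its base has logarithm `O(f + ℓ + 1)` and its number of entries
-- is a constant times `2 ^ f`. Everything else is polynomial in `n`, `2 ^ s₁`, `2 ^ s₂`, `2 ^ f`,
-- `2 ^ ℓ`, up to constants in the exponents, and contributes only linear terms to the logarithm.
set_option exponentiation.threshold 1000 in
theorem size_onBound_le (f l s₁ s₂ : ℕ → ℕ) : ∃ C, ∀ n,
    (onBound n (searchBound M M₁ M₂ n (f n) (l n) (s₁ n) (s₂ n))).size + 1 ≤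
      C * (n.size + s₁ n + s₂ n + (f n + l n + 1) * 2 ^ f n) := by
  obtain ⟨Q, hQd⟩ : ∃ Q : ℕ → ℕ, ∀ n, Q n = n.size + s₁ n + s₂ n + (f n + l n + 1) * 2 ^ f n :=
    ⟨_, fun n => rfl⟩
  have hfl : ∀ n, f n + l n + 1 ≤ (f n + l n + 1) * 2 ^ f n := fun n =>
    Nat.le_mul_of_pos_right _ (by positivity)
  have hQ : ∀ n, 1 ≤ Q n := fun n => by have := hfl n; have := hQd n; omega
  have hf : ∀ n, f n ≤ Q n := fun n => by have := hfl n; have := hQd n; omega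
  have hl : ∀ n, l n ≤ Q n := fun n => by have := hfl n; have := hQd n; omega
  have hs₁ : ∀ n, s₁ n ≤ Q n := fun n => by have := hQd n; omega
  have hs₂ : ∀ n, s₂ n ≤ Q n := fun n => by have := hQd n; omega
  have hn : LogBound Q fun n => n := .of_size_le fun n => by have := hQd n; omega
  have hc := LogBound.const hQ
  have hsim : ∀ (K b : ℕ) (s u : ℕ → ℕ), (∀ n, s n ≤ Q n) → (∀ n, u n ≤ Q n) →
      LogBound Q fun n => (K + n + b ^ s n + 2 ^ (u n).size + 4) ^ 243 := fun K b s u hs hu =>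
    .pow (.add hQ (.add hQ (.add hQ (.add hQ (hc K) hn)
      (.const_pow (D := 1) (fun n => by rw [one_mul]; exact hs n) b)) (.two_pow_size hu)) (hc 4)) _
  -- the table
  have hQ' : ∀ n, 1 ≤ f n + l n + 1 := fun n => by omega
  have hbase : LogBound (fun n => f n + l n + 1) fun n =>
      tabBase (M.numStates * 2 ^ f n + 2 * outBase B ^ l n + 4) :=
    .pow (.add hQ' (.add hQ' (.add hQ' (.mul (.const hQ' _)
      (.const_pow (D := 1) (fun n => by omega) 2)) (.mul (.const hQ' 2)
      (.const_pow (D := 1) (fun n => by omega) _))) (.const hQ' 4)) (.const hQ' 4)) _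
  have htab : LogBound Q fun n => (exactParams M (f n) (l n)).2.2.2 := by
    obtain ⟨C, hC⟩ := hbase
    refine ⟨C * M.numStates, fun n => (Nat.pow_le_pow_left (hC n) _).trans ?_⟩
    rw [← pow_mul]
    refine Nat.pow_le_pow_right two_pos ?_
    calc C * (f n + l n + 1) * (M.numStates * 2 ^ f n)
        = C * M.numStates * ((f n + l n + 1) * 2 ^ f n) := by ring
      _ ≤ C * M.numStates * Q n := Nat.mul_le_mul_left _ (by rw [hQd]; omega)
  have hall : LogBound Q fun n =>
      onBound n (searchBound M M₁ M₂ n (f n) (l n) (s₁ n) (s₂ n)) :=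
    .pow (.add hQ (.add hQ hn (.add hQ (.add hQ (.add hQ (.add hQ (.add hQ
      (hsim _ _ _ _ hs₁ hf) (hsim _ _ _ _ hs₂ hl))
      (.const_pow (D := 1) (fun n => by rw [one_mul]; exact hf n) 2))
      (.const_pow (D := 1) (fun n => by rw [one_mul]; exact hl n) _)) htab) (hc 1))) (hc 8)) _
  obtain ⟨C, hC⟩ := hall.size_le hQ
  refine ⟨C + 1, fun n => ?_⟩
  rw [← hQd, Nat.succ_mul]
  have := hC n
  have := hQ n
  omega

end

/-- A function that grows at least like the iterated logarithm and that is constant on `n` and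
`n + n!` is at least of the order of the logarithm. -/
theorem exists_size_le_of_eq_factorial {f : ℕ → ℕ}
    (hf : (fun n : ℕ => Real.log (Real.log (n : ℝ))) =O[atTop] (fun n : ℕ => (f n : ℝ))) :
    ∃ C : ℕ, ∀ᶠ n in atTop, f (n + n.factorial) = f n → n.size ≤ C * f n + 1 := by
  obtain ⟨c, hc⟩ := isBigO_iff.mp hf
  obtain ⟨N, hN⟩ := eventually_atTop.mp hc
  refine ⟨⌈4 * c⌉₊, ?_⟩
  filter_upwards [eventually_ge_atTop N, eventually_ge_atTop 16] with n hnN hn16 heq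
  have h1 := hN (n + n.factorial) (by omega)
  rw [heq, Real.norm_natCast] at h1
  have hn : (16 : ℝ) ≤ n := by exact_mod_cast hn16
  -- Since `n!` is at least exponential in `n`, the iterated logarithm of `n + n!` is of the order
  -- of `log n`.
  have hfac : (2 : ℝ) ^ (n - 1) ≤ (n + n.factorial : ℕ) := by
    have : 2 ^ (n - 1) ≤ n.factorial := by
      have h2 : ∀ k, 2 ^ k ≤ (k + 1).factorial := by
        intro k
        induction k with
        | zero => simp
        | succ k ih => rw [pow_succ, Nat.factorial_succ]; nlinarith
      have := h2 (n - 1)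
      rwa [show n - 1 + 1 = n by omega] at this
    have h3 : 2 ^ (n - 1) ≤ n + n.factorial := by omega
    exact_mod_cast h3
  have hlog2 := Real.log_two_gt_d9
  have hlog2' := Real.log_two_lt_d9
  have h4 : (n : ℝ) / 4 ≤ Real.log (n + n.factorial : ℕ) := by
    have h5 := Real.log_le_log (by positivity) hfac
    rw [Real.log_pow, Nat.cast_sub (by omega)] at h5
    push_cast at h5 ⊢
    nlinarith
  -- For `n ≥ 16` the number `n / 4` is at least the square root of `n`.
  have h6 : Real.log n / 2 ≤ Real.log (Real.log (n + n.factorial : ℕ)) := by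
    refine le_trans ?_ (Real.log_le_log (by positivity) h4)
    rw [Real.log_div (by positivity) (by norm_num)]
    have h7 : Real.log 16 ≤ Real.log n := Real.log_le_log (by norm_num) hn
    have h8 : Real.log 16 = 2 * Real.log 4 := by
      rw [show (16 : ℝ) = 4 ^ 2 by norm_num, Real.log_pow]; norm_num
    linarith
  have h9 : Real.log n ≤ 2 * c * f n := by
    have := (le_abs_self _).trans h1
    linarith
  have h10 : ((n.size : ℝ) - 1) * Real.log 2 ≤ Real.log n := by
    obtain ⟨k, hk⟩ : ∃ k, n.size = k + 1 := ⟨n.size - 1, by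
      have := Nat.size_pos.mpr (show 0 < n by omega); omega⟩
    have h11 : 2 ^ k ≤ n := Nat.lt_size.mp (by omega)
    have h12 : ((2 : ℝ) ^ k) ≤ n := by exact_mod_cast h11
    have h13 := Real.log_le_log (by positivity) h12
    rw [Real.log_pow] at h13
    rw [hk]; push_cast; linarith
  -- The factor `2` in `h9` becomes `4` because `log 2 > 1 / 2`.
  have h14 : (n.size : ℝ) ≤ 4 * c * f n + 1 := by
    have h15 : (1 : ℝ) ≤ n.size := by
      exact_mod_cast Nat.size_pos.mpr (show 0 < n by omega)
    nlinarith
  have h16 : (n.size : ℝ) ≤ (⌈4 * c⌉₊ * f n + 1 : ℕ) := by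
    push_cast
    have := mul_le_mul_of_nonneg_right (Nat.le_ceil (4 * c)) (Nat.cast_nonneg (α := ℝ) (f n))
    linarith
  exact_mod_cast h16

/-- A space bound for the computation of a function that grows at least like the iterated logarithm
is at least of the order of the logarithm. -/
theorem exists_size_le {Γ : Type} [Finite Γ] {M : Machine Unit Γ Bool} {f s : ℕ → ℕ}
    (hf : (fun n : ℕ => Real.log (Real.log (n : ℝ))) =O[atTop] (fun n : ℕ => (f n : ℝ)))
    (hM : ∀ n, M.HaltsWith (inputTape 0 (List.replicate n ())) (Nat.bits (f n)) (s n)) :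
    ∃ C : ℕ, ∀ᶠ n in atTop, n.size ≤ C * (s n + f n + 1) := by
  obtain ⟨C, hC⟩ := exists_size_le_of_eq_factorial hf
  have hQ : ∀ n, 1 ≤ s n + f n + 1 := fun n => by omega
  have hcores : LogBound (fun n => s n + f n + 1) fun n =>
      M.numStates * s n * Nat.card Γ ^ s n * ((f n).size + 1) := by
    refine .mul (.mul (.mul (.const hQ _) (.of_le fun n => by omega))
      (.const_pow (D := 1) (fun n => by omega) _)) (.of_le fun n => ?_)
    have : (f n).size ≤ f n := Nat.size_le.mpr Nat.lt_two_pow_self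
    omega
  obtain ⟨D, hD⟩ := hcores.size_le hQ
  refine ⟨C + D + 1, hC.mono fun n hn => ?_⟩
  -- With few configurations pumping applies, the number `n!` of inserted cells being divisible by
  -- every possible period. Otherwise `n` is at most the number of configurations, whose logarithm
  -- is linear in the space and `f`.
  rcases Nat.lt_or_ge (M.numStates * s n * Nat.card Γ ^ s n * ((f n).size + 1)) n with h | h
  · have := hn (eq_of_few_cores (hM n) (hM _)
      (fun d h1 h2 => Nat.dvd_factorial (by omega) h2.le) h)
    refine this.trans ?_
    nlinarith [Nat.zero_le (C * s n), Nat.zero_le (D * (s n + f n + 1))]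
  · have h1 := (Nat.size_le_size h).trans (hD n)
    refine h1.trans ?_
    gcongr
    omega

theorem length_le_logSize {A B : Type} [Fintype A] (F : List A → List B) (x : List A) :
    (F x).length ≤ logSize F x.length := by
  refine le_trans ?_ (le_max_right _ _)
  have := Finset.le_sup (f := fun v : Fin x.length → A => (F (List.ofFn v)).length)
    (Finset.mem_univ x.get)
  simpa using this

end SpaceTM

/-! ### The final estimate. -/

theorem mainTheorem4 {A B : Type} [Fintype A] [Fintype B]
    (F : List A → List B) (f : ℕ → ℕ)
    (hf : (fun n : ℕ => Real.log (Real.log (n : ℝ))) =O[atTop] (fun n : ℕ => (f n : ℝ)))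
    (M : SpaceTM.Machine A Bool B) (hM : M.ComputesOffline F f)
    (hfc : SpaceTM.unaryFun f ∈
      SpaceTM.OfflineSpace (fun n => f n * 2 ^ f n * SpaceTM.logSize F n))
    (ℓ : ℕ → ℕ) (hle : ∀ x : List A, (F x).length ≤ ℓ x.length)
    (hlO : (fun n : ℕ => (ℓ n : ℝ)) =O[atTop]
      (fun n : ℕ => ((f n * SpaceTM.logSize F n : ℕ) : ℝ)))
    (hlc : SpaceTM.unaryFun ℓ ∈
      SpaceTM.OfflineSpace (fun n => f n * 2 ^ f n * SpaceTM.logSize F n)) :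
    F ∈ SpaceTM.OneDSpacePrime
      (fun n => f n * 2 ^ f n * SpaceTM.logSize F n) (SpaceTM.logSize F) := by
  obtain ⟨Γ₁, hΓ₁, M₁, s₁, hs₁, hM₁⟩ := hfc
  obtain ⟨Γ₂, hΓ₂, M₂, s₂, hs₂, hM₂⟩ := hlc
  obtain ⟨Γ, hΓ, M', C, hon, hM'⟩ := SpaceTM.exists_online M M₁ M₂
  have hf₁ : ∀ n, M₁.HaltsWith (SpaceTM.inputTape 0 (List.replicate n ())) (Nat.bits (f n))
      (s₁ n) := fun n => by
    simpa [SpaceTM.unaryFun] using hM₁ (List.replicate n ())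
  have hf₂ : ∀ n, M₂.HaltsWith (SpaceTM.inputTape 0 (List.replicate n ())) (Nat.bits (ℓ n))
      (s₂ n) := fun n => by
    simpa [SpaceTM.unaryFun] using hM₂ (List.replicate n ())
  have hrun : ∀ x : List A, M'.HaltsWith (SpaceTM.inputTape x.length x) (F x)
      (C * ((SpaceTM.onBound x.length (SpaceTM.searchBound M M₁ M₂ x.length (f x.length)
        (ℓ x.length) (s₁ x.length) (s₂ x.length))).size + 1)) := fun x =>
    hM' x (F x) _ _ _ _ (hM x) (hf₁ _) (hf₂ _) (hle x)
  -- Over an empty alphabet there is only the empty word, so `hM` says nothing about `f n` for `n >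
  -- 0`; in particular `f n` may vanish there. The space bound is then taken to be `0` at positive
  -- lengths, where there are no inputs.
  rcases isEmpty_or_nonempty A with hA | ⟨⟨a⟩⟩
  · refine ⟨Γ, hΓ, M', fun n => if n = 0 then C * ((SpaceTM.onBound n (SpaceTM.searchBound M M₁ M₂ n
      (f n) (ℓ n) (s₁ n) (s₂ n))).size + 1) else 0, SpaceTM.logSize F, ?_, isBigO_refl _ _, hon,
      fun x => ?_, SpaceTM.length_le_logSize F⟩
    · rw [SpaceTM.isBigO_natCast_iff]
      refine ⟨0, (eventually_gt_atTop 0).mono fun n hn => ?_⟩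
      rw [if_neg hn.ne']
      exact Nat.zero_le _
    · obtain rfl : x = [] := List.eq_nil_iff_forall_not_mem.mpr fun a => hA.elim a
      exact hrun []
  · refine ⟨Γ, hΓ, M', fun n => C * ((SpaceTM.onBound n (SpaceTM.searchBound M M₁ M₂ n
      (f n) (ℓ n) (s₁ n) (s₂ n))).size + 1), SpaceTM.logSize F, ?_, isBigO_refl _ _, hon, hrun,
      SpaceTM.length_le_logSize F⟩
    -- A word of each length exists, and every run visits at least its initial cell.
    have hf1 : ∀ n, 1 ≤ f n := fun n => by
      simpa [Nat.succ_le_iff] using (hM (List.replicate n a)).pos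
    have hg1 : ∀ n, 1 ≤ SpaceTM.logSize F n := fun n => le_max_left _ _
    rw [SpaceTM.isBigO_natCast_iff] at hs₁ hs₂ hlO ⊢
    obtain ⟨C₁, hC₁⟩ := hs₁
    obtain ⟨C₂, hC₂⟩ := hs₂
    obtain ⟨C₃, hC₃⟩ := hlO
    obtain ⟨C₄, hC₄⟩ := SpaceTM.exists_size_le hf hf₁
    obtain ⟨C₅, hC₅⟩ := SpaceTM.size_onBound_le M M₁ M₂ f ℓ s₁ s₂
    refine ⟨C * (C₅ * (C₄ * (C₁ + 2) + C₁ + C₂ + (C₃ + 2))), ?_⟩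
    filter_upwards [hC₁, hC₂, hC₃, hC₄] with n h1 h2 h3 h4
    have hfg : f n ≤ f n * SpaceTM.logSize F n := Nat.le_mul_of_pos_right _ (hg1 n)
    have hp : 1 ≤ 2 ^ f n := Nat.one_le_two_pow
    obtain ⟨S, hS⟩ : ∃ S, S = f n * 2 ^ f n * SpaceTM.logSize F n := ⟨_, rfl⟩
    have hS' : S = f n * SpaceTM.logSize F n * 2 ^ f n := by rw [hS]; ring
    rw [← hS] at h1 h2 ⊢
    have hfS : f n ≤ S := by
      rw [hS']; exact hfg.trans (Nat.le_mul_of_pos_right _ hp)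
    -- Of the summands in `h4`, the space for computing `f` contributes `C₁ * S`, while `f n` and
    -- `1` contribute at most `S` each.
    have h5 : n.size ≤ C₄ * (C₁ + 2) * S := by
      refine h4.trans ?_
      rw [mul_assoc]
      refine Nat.mul_le_mul_left _ ?_
      have := hf1 n
      rw [add_mul]; omega
    -- Here the bound `ℓ = O(f · log F)` enters: each of `f n` and `1` is at most `f n * logSize F
    -- n`, and `ℓ n` is at most `C₃` times that product.
    have h6 : (f n + ℓ n + 1) * 2 ^ f n ≤ (C₃ + 2) * S := by
      rw [hS', ← mul_assoc]
      refine Nat.mul_le_mul_right _ ?_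
      have := hf1 n
      rw [add_mul]; omega
    rw [mul_assoc]
    refine Nat.mul_le_mul_left _ ((hC₅ n).trans ?_)
    rw [mul_assoc]
    refine Nat.mul_le_mul_left _ ?_
    have h7 : (C₄ * (C₁ + 2) + C₁ + C₂ + (C₃ + 2)) * S =
      C₄ * (C₁ + 2) * S + C₁ * S + C₂ * S + (C₃ + 2) * S := by ring
    rw [h7]
    omega
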